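/- Let $m$ be Lebesgue measure on $(0,\infty)$ and let $L_0$ be the space of real-valued, a.e. finite, Lebesgue measurable functions on $(0,\infty)$, identified $m$-a.e. For $x\in L_0$ let $x^*(t)=\inf\{s\ge 0:\ m(\{|x|\ge s\})\le t\}$ be its non-increasing right-continuous rearrangement (with values in $[0,\infty]$), and write $y\prec\prec x$ if $\int_0^t y^*(s)\,ds\le\int_0^t x^*(s)\,ds$ for all $t\ge 0$. Let $E\subseteq L_0$ be a Banach space of functions which is a fully symmetric space on $(0,\infty)$, i.e. * (ideal lattice) if $x\in E$, $y\in L_0$ and $|y|\le|x|$, then $y\in E$ and $\|y\|_E\le\|x\|_E$; * (symmetric) every $x\in E$ satisfies $m(\{|x|>s\})<\infty$ for some $s$, and if $x\in E$, $y\in L_0$ and $y^*=x^*$, then $y\in E$ and $\|y\|_E=\|x\|_E$; * (fully symmetric) if $x\in E$, $y\in L_1+L_\infty$ and $y\prec\prec x$, then $y\in E$ and $\|y\|_E\le\|x\|_E$. The norm of $E$ is called a Fatou norm if $\|x_n\|_E\uparrow\|x\|_E$ whenever $0\le x_n\uparrow x$ a.e. with $x_n,x\in E$. For $0\le x\in L_1+L_\infty$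 let $\Omega_+(x)=\{Tx:\ T\in\Sigma_+\}$ be the orbit of $x$ with respect to the semigroup $\Sigma_+$ of all positive linear operators $T:L_1+L_\infty\to L_1+L_\infty$ with $\|T\|_{L_1\to L_1}\le 1$ and $\|T\|_{L_\infty\to L_\infty}\le 1$. For $0\le x\in E\cap(L_1+L_\infty)$ let $Q_+(x)$ be the $\|\cdot\|_E$-closure in $E$ of the convex hull of the set of extreme points of $\Omega_+(x)$. For $x\in E$ put $$\varphi_{fin}(x)=\lim_{s\to\infty}\frac1s\,\bigl\|\sigma_s(x^*)\chi_{[0,1]}\bigr\|_E,\qquad (\sigma_s g)(u)=g(u/s).$$ **Theorem.** Suppose that $E\subseteq L_1$ and let $0\le x\in E$. If $\varphi_{fin}(x)=0$, then $\Omega_+(x)=Q_+(x)$. If, in addition, the norm of $E$ is a Fatou norm, then the converse also holds: $\Omega_+(x)=Q_+(x)$ implies $\varphi_{fin}(x)=0$. -/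

import Mathlib

open MeasureTheory Set Filter Topology
open scoped ENNReal

namespace Orbits

noncomputable section

/-- Lebesgue measure on the semi-axis `(0, ∞)`. -/
abbrev m : Measure ℝ := volume.restrict (Ioi (0 : ℝ))

/-- Real (a.e. finite) Lebesgue measurable functions on `(0, ∞)`, identified `m`-a.e. -/
abbrev L0 : Type := ℝ →ₘ[m] ℝ

/-- The space `L₁`, as a subspace of `L0`. -/
abbrev L1 : Submodule ℝ L0 := Lp.LpSubmodule ℝ ℝ 1 m

/-- The space `L_∞`, as a subspace of `L0`. -/
abbrev Linfty : Submodule ℝ L0 := Lp.LpSubmodule ℝ ℝ ∞ m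

/-- The space `L₁ + L_∞`, as a subspace of `L0`. -/
abbrev L1Linfty : Submodule ℝ L0 := L1 ⊔ Linfty

/-! ### Rearrangements -/

/-- The non-increasing right-continuous rearrangement
`x*(t) = inf {s ≥ 0 : m {|x| ≥ s} ≤ t}`, with values in `[0, ∞]` (the infimum of the empty set
is `∞`). -/
def rearr (x : L0) (t : ℝ) : ℝ≥0∞ :=
  sInf {s : ℝ≥0∞ | m {u | s ≤ ‖x u‖ₑ} ≤ ENNReal.ofReal t}

theorem rearr_antitone (x : L0) : Antitone (rearr x) := fun _ _ h =>
  sInf_le_sInf fun _ hs => le_trans hs (ENNReal.ofReal_le_ofReal h)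

/-- `x*` as a real-valued function (it is finite on `(0, ∞)` for every `x` in `S0`). -/
def rearrReal (x : L0) (t : ℝ) : ℝ := (rearr x t).toReal

theorem measurable_rearrReal (x : L0) : Measurable (rearrReal x) :=
  (rearr_antitone x).measurable.ennreal_toReal

/-- `y` is submajorized by `x` in the sense of Hardy, Littlewood and Polya. -/
def Submajorized (y x : L0) : Prop :=
  ∀ t : ℝ, 0 ≤ t → ∫⁻ s in Ioc 0 t, rearr y s ≤ ∫⁻ s in Ioc 0 t, rearr x s

/-- The set `S0` of all functions `x` such that `m {|x| > s}` is finite for some `s`. -/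
def S0 : Set L0 := {x | ∃ s : ℝ, m {u | s < |x u|} < ∞}

/-- The dilation `(σ_τ g)(u) = g (u / τ)`. -/
def dilation (τ : ℝ) (g : ℝ → ℝ) (u : ℝ) : ℝ := g (u / τ)

/-- The function `σ_s(x*) χ_[0,1]`. -/
def dilatedHead (s : ℝ) (x : L0) : L0 :=
  AEEqFun.mk ((Icc (0 : ℝ) 1).indicator (dilation s (rearrReal x)))
    (((measurable_rearrReal x).comp (measurable_id.div_const s)).indicator
      measurableSet_Icc).aestronglyMeasurable

/-! ### Symmetric spaces

A Banach space of measurable functions on `(0, ∞)` is given as a Banach space `E` together with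
a linear injection `ι : E → L0`, by which its elements are identified with (classes of)
functions. -/

section Spaces

variable {E : Type*} [NormedAddCommGroup E] [NormedSpace ℝ E]

/-- `E` is an ideal lattice of measurable functions. -/
structure IsIdealLattice (ι : E →ₗ[ℝ] L0) : Prop where
  injective : Function.Injective ι
  solid : ∀ (x : E) (y : L0), |y| ≤ |ι x| → ∃ z : E, ι z = y ∧ ‖z‖ ≤ ‖x‖

/-- `E` is a symmetric space. -/
structure IsSymmetricSpace (ι : E →ₗ[ℝ] L0) : Prop extends IsIdealLattice ι where
  subset_S0 : ∀ x : E, ι x ∈ S0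
  symmetric : ∀ (x : E) (y : L0), rearr y = rearr (ι x) → ∃ z : E, ι z = y ∧ ‖z‖ = ‖x‖

/-- `E` is a fully symmetric space. -/
structure IsFullySymmetric (ι : E →ₗ[ℝ] L0) : Prop extends IsSymmetricSpace ι where
  fully : ∀ (x : E) (y : L0), y ∈ L1Linfty → Submajorized y (ι x) →
    ∃ z : E, ι z = y ∧ ‖z‖ ≤ ‖x‖

/-- The norm of `E` is a Fatou norm: `0 ≤ x_n ↑ x ∈ E` a.e. implies `‖x_n‖ ↑ ‖x‖`
(monotonicity of the norms is automatic in an ideal lattice). -/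
def HasFatouNorm (ι : E →ₗ[ℝ] L0) : Prop :=
  ∀ (u : ℕ → E) (x : E), (∀ n, 0 ≤ ι (u n)) → Monotone (fun n => ι (u n)) →
    (∀ᵐ t ∂m, Tendsto (fun n => ι (u n) t) atTop (𝓝 (ι x t))) →
    Tendsto (fun n => ‖u n‖) atTop (𝓝 ‖x‖)

/-- The norm `‖f‖_E` of a function `f`; it is `∞` if `f` does not belong to `E`. -/
def fnNorm (ι : E →ₗ[ℝ] L0) (f : L0) : ℝ≥0∞ := ⨅ (z : E) (_ : ι z = f), ‖z‖ₑ

/-- `φ_fin(x) = c`, that is, `(1/s) ‖σ_s(x*) χ_[0,1]‖_E` tends to `c` as `s → ∞`. -/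
def PhiFinEq (ι : E →ₗ[ℝ] L0) (x : L0) (c : ℝ≥0∞) : Prop :=
  Tendsto (fun s : ℝ => ENNReal.ofReal (1 / s) * fnNorm ι (dilatedHead s x)) atTop (𝓝 c)

end Spaces

/-! ### Orbits -/

/-- The semigroup `Σ₊` of substochastic operators: positive linear operators on `L₁ + L_∞` that
map `L₁` to `L₁` and `L_∞` to `L_∞`, with norm at most one in both cases. (An `eLpNorm` is `∞`
outside of the corresponding space.) -/
structure IsSubstochastic (T : L1Linfty →ₗ[ℝ] L1Linfty) : Prop where
  pos : ∀ f : L1Linfty, 0 ≤ (f : L0) → 0 ≤ (T f : L0)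
  contr_one : ∀ f : L1Linfty, eLpNorm (T f : L0) 1 m ≤ eLpNorm (f : L0) 1 m
  contr_top : ∀ f : L1Linfty, eLpNorm (T f : L0) ∞ m ≤ eLpNorm (f : L0) ∞ m

/-- The orbit `Ω₊(x)` of `x ∈ L₁ + L_∞` with respect to the semigroup `Σ₊`. -/
def OmegaPlus (x : L0) : Set L0 :=
  {y | ∃ T : L1Linfty →ₗ[ℝ] L1Linfty, IsSubstochastic T ∧
    ∃ f : L1Linfty, (f : L0) = x ∧ y = T f}

/-- `Q₊(x)`: the closure, in the norm of `E`, of the convex hull of the extreme points of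
`Ω₊(x)`. -/
def QPlus {E : Type*} [NormedAddCommGroup E] [NormedSpace ℝ E] (ι : E →ₗ[ℝ] L0) (x : L0) :
    Set L0 :=
  ι '' closure (ι ⁻¹' convexHull ℝ (extremePoints ℝ (OmegaPlus x)))

end

end Orbits

namespace Orbits

noncomputable section

/-! ### Layer cake and rearrangements -/

/-! Everything is expressed through c ↦ ∫(f - c)⁺ (`exc`, `excR`). Since ∫₀ᵗ f* is the minimum over
c of ct + ∫(|f| - c)⁺, attained at c = f*(t), comparing these functions for all c ≥ 0 yields
submajorization.

The orbit of an integrable x ≥ 0 consists of the 0 ≤ y ∈ L₁ with exc y ≤ exc x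
(`mem_OmegaPlus_iff`). That images satisfy this follows by splitting x into (x - c)⁺ and min(x, c).
Conversely, averaging operators move the sets where x is largest onto prescribed nested sets; a
Hahn-Banach argument then matches finitely many integrals of y approximately, and an ultrafilter
limit of the operators (`exists_limit_operator`) matches y itself. Integrals over sets of finite
measure are continuous for the norm of E, so Q₊(x) ⊆ Ω₊(x) holds without any condition on φ_fin.

Extreme points enter through two facts. An element z of the orbit with exc z = exc x on [q, ∞) and
values in {0} ∪ [q, ∞) is extreme (`mem_extremePoints_OmegaPlus`). A nonzero extreme point satisfies
exc z = exc x for all large c (`exists_excR_eq_of_mem_extremePoints`): its largest values are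
distributed like those of x.

Necessity. For bounded x the limit φ_fin(x) is 0 directly. For unbounded x, approximate the
indicator of {x ≥ 1} by a convex combination w of extreme points. The nonzero ones carry a weight Λ
bounded below, and each has the same head as x*. On a union of small sets w has integral at least
Λ∫₀^τ x*, while the indicator contributes a negligible amount. So the small error v = w - 1
submajorizes a multiple of the dilated head, which forces φ_fin(x) = 0.

Sufficiency. Reduce to y constant on disjoint blocks B_i of finite total measure. Truncate x to g
with the same integral as y and take T with Tg = y. The integrals over B_i of the images of the
level sets of g, inverted in the level, give decreasing functions F_i on (0, m B_i) whose mean is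
the value of y and which together are equimeasurable with g (`exists_block_functions`). Placing F_i
on B_i after each of n cyclic rotations gives n extreme points. Their average is a Riemann sum of
F_i, and the error is at most the sum of two functions e with exc e(c) ≤ exc x(nc)
(`exists_extremePoints_average`). Their norms are at most a constant times (1/n)‖σ_n(x*)χ_[0,1]‖,
hence small. -/

theorem volume_Ioi_zero_inter_ofReal_lt (M : ℝ≥0∞) :
    m {s : ℝ | ENNReal.ofReal s < M} = M := by
  rw [Measure.restrict_apply (measurableSet_lt ENNReal.measurable_ofReal measurable_const)]
  induction M using ENNReal.recTopCoe with
  | top =>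
    have : {s : ℝ | ENNReal.ofReal s < ∞} ∩ Ioi 0 = Ioi 0 := by
      ext s; simp
    rw [this, Real.volume_Ioi]
  | coe r =>
    have : {s : ℝ | ENNReal.ofReal s < (r : ℝ≥0∞)} ∩ Ioi 0 = Ioo 0 (r : ℝ) := by
      ext s
      simp only [mem_inter_iff, mem_ofPred_eq, mem_Ioi, mem_Ioo]
      constructor
      · rintro ⟨h1, h2⟩
        refine ⟨h2, ?_⟩
        rw [← ENNReal.ofReal_coe_nnreal] at h1
        exact (ENNReal.ofReal_lt_ofReal_iff_of_nonneg h2.le).1 h1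
      · rintro ⟨h1, h2⟩
        refine ⟨?_, h1⟩
        rw [← ENNReal.ofReal_coe_nnreal]
        exact (ENNReal.ofReal_lt_ofReal_iff_of_nonneg h1.le).2 h2
    rw [this, Real.volume_Ioo]
    simp

/-- Tonelli on the region under the graph. The measure is left general because a measure with
density occurs later, in the layer-cake formula for products. -/
theorem lintegral_eq_lintegral_meas_ofReal_lt {α : Type*} [MeasurableSpace α] (μ : Measure α)
    [SFinite μ] {g : α → ℝ≥0∞} (hg : Measurable g) :
    ∫⁻ a, g a ∂μ = ∫⁻ c, μ {a | ENNReal.ofReal c < g a} ∂m := by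
  have h1 : ∀ a, g a = ∫⁻ c, indicator {c : ℝ | ENNReal.ofReal c < g a} 1 c ∂m := by
    intro a
    rw [lintegral_indicator_one (measurableSet_lt ENNReal.measurable_ofReal measurable_const),
      volume_Ioi_zero_inter_ofReal_lt]
  have hS : MeasurableSet {p : α × ℝ | ENNReal.ofReal p.2 < g p.1} :=
    measurableSet_lt (ENNReal.measurable_ofReal.comp measurable_snd) (hg.comp measurable_fst)
  calc ∫⁻ a, g a ∂μ = ∫⁻ a, ∫⁻ c, indicator {p : α × ℝ | ENNReal.ofReal p.2 < g p.1} 1 (a, c) ∂m ∂μ :=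
        lintegral_congr fun a => by rw [h1 a]; rfl
    _ = ∫⁻ c, ∫⁻ a, indicator {p : α × ℝ | ENNReal.ofReal p.2 < g p.1} 1 (a, c) ∂μ ∂m :=
        lintegral_lintegral_swap ((measurable_one.indicator hS).aemeasurable)
    _ = _ := lintegral_congr fun c => by
        have : (fun a => indicator {p : α × ℝ | ENNReal.ofReal p.2 < g p.1}
            (1 : α × ℝ → ℝ≥0∞) (a, c)) = indicator {a | ENNReal.ofReal c < g a} 1 := rfl
        rw [this, lintegral_indicator_one (measurableSet_lt measurable_const hg)]

/-- If s_n decreases strictly to c, the sets {s_n ≤ |x|} increase to {c < |x|}, so continuity from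
below replaces the closed superlevel sets of the definition by open ones. This exchange of level and
time is what makes x* equimeasurable with |x|. -/
theorem lt_rearr_iff (x : L0) (t : ℝ) (c : ℝ≥0∞) :
    c < rearr x t ↔ ENNReal.ofReal t < m {u | c < ‖x u‖ₑ} := by
  constructor
  · intro h
    by_contra! hle
    refine h.not_ge (le_of_forall_gt_imp_ge_of_dense fun s hs => sInf_le ?_)
    exact (measure_mono fun u hu => hs.trans_le hu).trans hle
  · intro h
    by_contra! hle
    have hc : c < ∞ := by
      by_contra! hc
      have : {u | c < ‖x u‖ₑ} = ∅ := by
        ext u; simp [top_le_iff.1 hc]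
      simp [this] at h
    obtain ⟨s, hs1, hs2, hs3⟩ := exists_seq_strictAnti_tendsto' hc
    have hU : {u | c < ‖x u‖ₑ} = ⋃ n, {u | s n ≤ ‖x u‖ₑ} := by
      ext u
      simp only [mem_ofPred_eq, mem_iUnion]
      constructor
      · intro hu
        obtain ⟨n, hn⟩ := (hs3.eventually (gt_mem_nhds hu)).exists
        exact ⟨n, hn.le⟩
      · rintro ⟨n, hn⟩
        exact (hs2 n).1.trans_le hn
    have hmono : Monotone fun n => {u | s n ≤ ‖x u‖ₑ} := fun a b hab u hu =>
      (hs1.antitone hab).trans hu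
    refine h.not_ge ?_
    rw [hU, hmono.measure_iUnion]
    refine iSup_le fun n => ?_
    obtain ⟨r, hr, hrs⟩ := sInf_lt_iff.1 (hle.trans_lt (hs2 n).1)
    exact (measure_mono fun u hu => hrs.le.trans hu).trans hr

theorem measurable_rearr (x : L0) : Measurable (rearr x) := (rearr_antitone x).measurable

theorem lintegral_rearr_sub (f : L0) (c : ℝ≥0∞) :
    ∫⁻ s, (rearr f s - c) ∂m = ∫⁻ u, (‖f u‖ₑ - c) ∂m := by
  rw [lintegral_eq_lintegral_meas_ofReal_lt m (g := fun s => rearr f s - c)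
      ((measurable_rearr f).sub measurable_const),
    lintegral_eq_lintegral_meas_ofReal_lt m (g := fun u => ‖f u‖ₑ - c)
      ((AEEqFun.measurable f).enorm.sub measurable_const)]
  refine lintegral_congr fun d => ?_
  simp_rw [lt_tsub_iff_right, lt_rearr_iff]
  exact volume_Ioi_zero_inter_ofReal_lt _

theorem m_restrict_Ioc (t : ℝ) : m.restrict (Ioc 0 t) = volume.restrict (Ioc 0 t) := by
  rw [Measure.restrict_restrict measurableSet_Ioc]
  congr 1
  ext s; simp +contextual

theorem m_Ioc (t : ℝ) : m (Ioc 0 t) = ENNReal.ofReal t := by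
  have := m_restrict_Ioc t
  rw [← Measure.restrict_apply_self, this, Measure.restrict_apply_self, Real.volume_Ioc, sub_zero]

/-- From f* ≤ c + (f* - c)⁺ and equimeasurability. With the next lemma, which is the equality case c
= f*(t), this is the duality between ∫₀ᵗ f* and c ↦ ∫(|f| - c)⁺. -/
theorem setLIntegral_rearr_le (f : L0) (t : ℝ) (c : ℝ≥0∞) :
    ∫⁻ s in Ioc 0 t, rearr f s ≤ c * ENNReal.ofReal t + ∫⁻ u, (‖f u‖ₑ - c) ∂m := by
  rw [← lintegral_rearr_sub f c, ← m_restrict_Ioc]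
  calc ∫⁻ s in Ioc 0 t, rearr f s ∂m ≤ ∫⁻ s in Ioc 0 t, (c + (rearr f s - c)) ∂m :=
        lintegral_mono fun s => le_add_tsub
    _ = c * ENNReal.ofReal t + ∫⁻ s in Ioc 0 t, (rearr f s - c) ∂m := by
        rw [lintegral_add_left measurable_const, setLIntegral_const, m_Ioc]
    _ ≤ _ := by gcongr; exact Measure.restrict_le_self

/-- At c = f*(t) nothing is lost: f* ≥ c on (0, t], and (f* - c)⁺ vanishes beyond t. -/
theorem le_setLIntegral_rearr (f : L0) (t : ℝ) :
    rearr f t * ENNReal.ofReal t + ∫⁻ u, (‖f u‖ₑ - rearr f t) ∂m ≤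
      ∫⁻ s in Ioc 0 t, rearr f s := by
  rw [← lintegral_rearr_sub f, ← m_restrict_Ioc, ← lintegral_add_compl _ (measurableSet_Ioc (a := 0) (b := t))]
  have h0 : ∫⁻ s in (Ioc 0 t)ᶜ, (rearr f s - rearr f t) ∂m = 0 := by
    rw [Measure.restrict_restrict measurableSet_Ioc.compl]
    refine (setLIntegral_congr_fun (measurableSet_Ioc.compl.inter measurableSet_Ioi)
      (fun s hs => ?_)).trans lintegral_zero
    refine tsub_eq_zero_of_le (rearr_antitone f ?_)
    simp only [mem_inter_iff, mem_compl_iff, mem_Ioc, mem_Ioi] at hs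
    by_contra! h
    exact hs.1 ⟨hs.2, h.le⟩
  rw [h0, add_zero, ← m_Ioc, ← setLIntegral_const, ← lintegral_add_left measurable_const]
  refine le_of_eq (setLIntegral_congr_fun measurableSet_Ioc fun s hs => ?_)
  exact add_tsub_cancel_of_le (rearr_antitone f hs.2)

theorem submajorized_of_forall {y x : L0}
    (h : ∀ c : ℝ≥0∞, ∫⁻ u, (‖y u‖ₑ - c) ∂m ≤ ∫⁻ u, (‖x u‖ₑ - c) ∂m) : Submajorized y x :=
  fun t _ => (setLIntegral_rearr_le y t (rearr x t)).trans
    ((add_le_add_right (h _) _).trans (le_setLIntegral_rearr x t))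

theorem setLIntegral_enorm_le_rearr (f : L0) {B : Set ℝ} {t : ℝ}
    (h : m B ≤ ENNReal.ofReal t) : ∫⁻ u in B, ‖f u‖ₑ ∂m ≤ ∫⁻ s in Ioc 0 t, rearr f s := by
  refine le_trans ?_ (le_setLIntegral_rearr f t)
  calc ∫⁻ u in B, ‖f u‖ₑ ∂m ≤ ∫⁻ u in B, (rearr f t + (‖f u‖ₑ - rearr f t)) ∂m :=
        lintegral_mono fun s => le_add_tsub
    _ = rearr f t * m B + ∫⁻ s in B, (‖f s‖ₑ - rearr f t) ∂m := by
        rw [lintegral_add_left measurable_const, setLIntegral_const]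
    _ ≤ _ := by gcongr; exact Measure.restrict_le_self

/-! ### The integrals of the functions `(f - c)⁺` -/

/-- The integral of `(f - c)⁺`. -/
def exc (f : ℝ → ℝ) (c : ℝ) : ℝ≥0∞ := ∫⁻ u, ENNReal.ofReal (f u - c) ∂m

theorem exc_congr {f g : ℝ → ℝ} (h : f =ᵐ[m] g) (c : ℝ) : exc f c = exc g c :=
  lintegral_congr_ae (h.mono fun u hu => by simp only [hu])

theorem exc_mono {f g : ℝ → ℝ} (h : f ≤ᵐ[m] g) (c : ℝ) : exc f c ≤ exc g c :=
  lintegral_mono_ae (h.mono fun u hu => ENNReal.ofReal_le_ofReal (by linarith))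

theorem lintegral_enorm_sub_eq_exc {f : ℝ → ℝ} (hf : 0 ≤ᵐ[m] f) {c : ℝ} (hc : 0 ≤ c) :
    ∫⁻ u, (‖f u‖ₑ - ENNReal.ofReal c) ∂m = exc f c :=
  lintegral_congr_ae (hf.mono fun u hu => by
    simp only
    rw [Real.enorm_eq_ofReal hu, ENNReal.ofReal_sub _ hc])

theorem coe_nonneg {f : L0} (hf : 0 ≤ f) : 0 ≤ᵐ[m] f := by
  have h := AEEqFun.coeFn_le.2 hf
  filter_upwards [h, AEEqFun.coeFn_zero (α := ℝ) (β := ℝ) (μ := m)] with u hu h0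
  rw [h0] at hu; exact hu

theorem nonneg_of_coe {f : L0} (hf : 0 ≤ᵐ[m] f) : 0 ≤ f := by
  refine AEEqFun.coeFn_le.1 ?_
  filter_upwards [hf, AEEqFun.coeFn_zero (α := ℝ) (β := ℝ) (μ := m)] with u hu h0
  rw [h0]; exact hu

theorem submajorized_of_exc_le {y x : L0} (hy : 0 ≤ y) (hx : 0 ≤ x)
    (h : ∀ c, 0 ≤ c → exc y c ≤ exc x c) : Submajorized y x := by
  refine submajorized_of_forall fun c => ?_
  induction c using ENNReal.recTopCoe with
  | top => simp
  | coe c =>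
    rw [← ENNReal.ofReal_coe_nnreal, lintegral_enorm_sub_eq_exc (coe_nonneg hy) c.coe_nonneg,
      lintegral_enorm_sub_eq_exc (coe_nonneg hx) c.coe_nonneg]
    exact h _ c.2

theorem setLIntegral_rearr_le_exc {f : L0} (hf : 0 ≤ f) (t : ℝ) {c : ℝ} (hc : 0 ≤ c) :
    ∫⁻ s in Ioc 0 t, rearr f s ≤ ENNReal.ofReal c * ENNReal.ofReal t + exc f c := by
  rw [← lintegral_enorm_sub_eq_exc (coe_nonneg hf) hc]
  exact setLIntegral_rearr_le f t _

theorem rearr_lt_top {f : L0} (hf : f ∈ L1) {t : ℝ} (ht : 0 < t) : rearr f t < ∞ := by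
  have h1 : ∫⁻ u, ‖f u‖ₑ ∂m < ∞ := by
    have : eLpNorm f 1 m < ∞ := hf
    rwa [eLpNorm_one_eq_lintegral_enorm] at this
  set I := ∫⁻ u, ‖f u‖ₑ ∂m
  have htt : ENNReal.ofReal t ≠ 0 := by simpa using ht
  have hc : I / ENNReal.ofReal t + 1 < ∞ := by
    refine ENNReal.add_lt_top.2 ⟨ENNReal.div_lt_top h1.ne htt, ENNReal.one_lt_top⟩
  refine lt_of_le_of_lt ?_ hc
  by_contra! h
  rw [lt_rearr_iff] at h
  set c := I / ENNReal.ofReal t + 1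
  have h2 : c * m {u | c < ‖f u‖ₑ} ≤ I :=
    (mul_le_mul_right (measure_mono fun u (hu : c < ‖f u‖ₑ) => hu.le) _).trans
      (mul_meas_ge_le_lintegral (AEEqFun.measurable f).enorm c)
  have h3 : c * ENNReal.ofReal t ≤ I := (mul_le_mul_right h.le _).trans h2
  have h4 : c * ENNReal.ofReal t = I + ENNReal.ofReal t := by
    simp only [c]
    rw [add_mul, one_mul, ENNReal.div_mul_cancel htt ENNReal.ofReal_ne_top]
  rw [h4] at h3
  exact (ENNReal.lt_add_right h1.ne htt).not_ge h3

theorem le_setLIntegral_rearr_exc {f : L0} (hf : 0 ≤ f) (hf1 : f ∈ L1) {t : ℝ} (ht : 0 < t) :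
    ENNReal.ofReal (rearrReal f t) * ENNReal.ofReal t + exc f (rearrReal f t) ≤
      ∫⁻ s in Ioc 0 t, rearr f s := by
  have hc : 0 ≤ rearrReal f t := ENNReal.toReal_nonneg
  rw [← lintegral_enorm_sub_eq_exc (coe_nonneg hf) hc, rearrReal]
  rw [ENNReal.ofReal_toReal (rearr_lt_top hf1 ht).ne]
  exact le_setLIntegral_rearr f t

/-! ### Intermediate sets and top sets -/

/-- Non-atomicity: a ↦ m(P ∪ (R ∩ (0, a])) is 1-Lipschitz and increases from m P towards m R, so the
intermediate value theorem applies. The measure of R may be infinite. -/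
theorem exists_between_measure_eq {P R : Set ℝ} (hP : MeasurableSet P) (hR : MeasurableSet R)
    (hPR : P ⊆ R) {s : ℝ≥0∞} (hs : s ≠ ∞) (h1 : m P ≤ s) (h2 : s ≤ m R) :
    ∃ C, MeasurableSet C ∧ P ⊆ C ∧ C ⊆ R ∧ m C = s := by
  rcases h2.eq_or_lt with h2 | h2
  · exact ⟨R, hR, hPR, Subset.rfl, h2.symm⟩
  have hPf : m P ≠ ∞ := (h1.trans_lt hs.lt_top).ne
  set D : ℝ → Set ℝ := fun a => P ∪ (R ∩ Ioc (0 : ℝ) a) with hD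
  have hDm : ∀ a, MeasurableSet (D a) := fun a => hP.union (hR.inter measurableSet_Ioc)
  have hDf : ∀ a, m (D a) ≠ ∞ := fun a => by
    refine ((measure_union_le _ _).trans_lt (ENNReal.add_lt_top.2 ⟨hPf.lt_top, ?_⟩)).ne
    exact (measure_mono inter_subset_right).trans_lt (by rw [m_Ioc]; exact ENNReal.ofReal_lt_top)
  have hmono : Monotone D := fun a b hab =>
    union_subset_union_right _ (inter_subset_inter_right _ (Ioc_subset_Ioc_right hab))
  have hlip : ∀ a b, 0 ≤ a → a ≤ b → m.real (D b) ≤ m.real (D a) + (b - a) := by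
    intro a b ha hab
    have hsub : D b ⊆ D a ∪ Ioc a b := by
      rintro u (hu | ⟨hu, hu2⟩)
      · exact Or.inl (Or.inl hu)
      · by_cases hua : u ≤ a
        · exact Or.inl (Or.inr ⟨hu, hu2.1, hua⟩)
        · exact Or.inr ⟨not_le.1 hua, hu2.2⟩
    have hI : m (Ioc a b) ≤ ENNReal.ofReal (b - a) := by
      rw [← Real.volume_Ioc]; exact Measure.restrict_apply_le _ _
    have h3 : m (D b) ≤ m (D a) + ENNReal.ofReal (b - a) :=
      (measure_mono hsub).trans ((measure_union_le _ _).trans (by gcongr))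
    have h4 := ENNReal.toReal_mono (ENNReal.add_ne_top.2 ⟨hDf a, ENNReal.ofReal_ne_top⟩) h3
    rw [ENNReal.toReal_add (hDf a) ENNReal.ofReal_ne_top, ENNReal.toReal_ofReal (by linarith)] at h4
    exact h4
  have hcont : ContinuousOn (fun a => m.real (D a)) (Ici 0) := by
    refine (LipschitzOnWith.of_le_add_mul 1 fun a ha b hb => ?_).continuousOn
    rw [NNReal.coe_one, one_mul, Real.dist_eq]
    rcases le_total a b with hab | hab
    · have : m.real (D a) ≤ m.real (D b) := measureReal_mono (hmono hab) (hDf b)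
      have := abs_nonneg (a - b); linarith
    · rw [abs_of_nonneg (by linarith)]
      exact hlip b a hb hab
  have hUn : m (⋃ n : ℕ, D (n : ℝ)) = m R := by
    have : (⋃ n : ℕ, D (n : ℝ)) ∩ Ioi 0 = R ∩ Ioi 0 := by
      ext u
      simp only [mem_inter_iff, mem_iUnion, mem_Ioi]
      refine and_congr_left fun hu => ⟨?_, fun hR' => ?_⟩
      · rintro ⟨n, hn | hn⟩
        · exact hPR hn
        · exact hn.1
      · obtain ⟨n, hn⟩ := exists_nat_ge u
        exact ⟨n, Or.inr ⟨hR', hu, hn⟩⟩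
    rw [Measure.restrict_apply (MeasurableSet.iUnion fun n : ℕ => hDm (n : ℝ)), this,
      Measure.restrict_apply hR]
  have hmN : Monotone fun n : ℕ => D (n : ℝ) := fun a b hab => hmono (Nat.cast_le.2 hab)
  rw [hmN.measure_iUnion] at hUn
  rw [← hUn] at h2
  obtain ⟨n, hn⟩ := lt_iSup_iff.1 h2
  have h0 : m (D 0) = m P := by simp [hD]
  have hmem : s.toReal ∈ Icc (m.real (D 0)) (m.real (D n)) := by
    constructor
    · exact ENNReal.toReal_mono hs (h0.trans_le h1)
    · exact ENNReal.toReal_mono (hDf n) hn.le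
  obtain ⟨a, ha, has⟩ := intermediate_value_Icc (Nat.cast_nonneg n)
    (hcont.mono Icc_subset_Ici_self) hmem
  refine ⟨D a, hDm a, subset_union_left, union_subset hPR inter_subset_left, ?_⟩
  rw [← ENNReal.ofReal_toReal hs, ← has]
  exact (ENNReal.ofReal_toReal (hDf a)).symm

/-- `C` consists of the places where `f` takes its largest values, down to the value `c`. -/
structure IsTopSet (f : ℝ → ℝ) (C : Set ℝ) (c : ℝ) : Prop where
  meas : MeasurableSet C
  nonneg : 0 ≤ c
  ge : ∀ u ∈ C, c ≤ f u
  le : ∀ u ∉ C, f u ≤ c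

theorem IsTopSet.setLIntegral {f : ℝ → ℝ} {C : Set ℝ} {c : ℝ} (h : IsTopSet f C c) :
    ∫⁻ u in C, ENNReal.ofReal (f u) ∂m = ENNReal.ofReal c * m C + exc f c := by
  have h0 : ∫⁻ u in Cᶜ, ENNReal.ofReal (f u - c) ∂m = 0 :=
    (setLIntegral_congr_fun h.meas.compl fun u hu =>
      ENNReal.ofReal_of_nonpos (sub_nonpos.2 (h.le u hu))).trans lintegral_zero
  rw [exc, ← lintegral_add_compl (fun u => ENNReal.ofReal (f u - c)) h.meas, h0, add_zero,
    ← setLIntegral_const,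
    ← lintegral_add_left measurable_const]
  refine setLIntegral_congr_fun h.meas fun u hu => ?_
  rw [← ENNReal.ofReal_add h.nonneg (sub_nonneg.2 (h.ge u hu))]
  congr 1; ring

theorem exists_measurable_nonneg_rep {x : L0} (hx : 0 ≤ x) :
    ∃ f : ℝ → ℝ, Measurable f ∧ (∀ u, 0 ≤ f u) ∧ x =ᵐ[m] f :=
  ⟨fun u => max (x u) 0, (AEEqFun.measurable x).max measurable_const, fun _ => le_max_right _ _,
    (coe_nonneg hx).mono fun _ hu => (max_eq_left hu).symm⟩

theorem setLIntegral_le_exc (f : ℝ → ℝ) (C : Set ℝ) (c : ℝ) :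
    ∫⁻ u in C, ENNReal.ofReal (f u) ∂m ≤ ENNReal.ofReal c * m C + exc f c := by
  calc ∫⁻ u in C, ENNReal.ofReal (f u) ∂m
      ≤ ∫⁻ u in C, (ENNReal.ofReal c + ENNReal.ofReal (f u - c)) ∂m :=
        lintegral_mono fun u => by
          rw [← sub_add_cancel (f u) c, add_comm (f u - c)]
          simpa using ENNReal.ofReal_add_le (p := c) (q := f u - c)
    _ = ENNReal.ofReal c * m C + ∫⁻ u in C, ENNReal.ofReal (f u - c) ∂m := by
        rw [lintegral_add_left measurable_const, setLIntegral_const]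
    _ ≤ _ := by gcongr; exact setLIntegral_le_lintegral _ _

theorem meas_lt_top_of_exc {f : ℝ → ℝ} (hf : Measurable f) (h : exc f 0 ≠ ∞) {c : ℝ} (hc : 0 < c) :
    m {u | c ≤ f u} < ∞ := by
  have h1 := mul_meas_ge_le_lintegral (μ := m) hf.ennreal_ofReal (ENNReal.ofReal c)
  have h2 : {u | c ≤ f u} ⊆ {u | ENNReal.ofReal c ≤ ENNReal.ofReal (f u)} :=
    fun u hu => ENNReal.ofReal_le_ofReal hu
  refine (measure_mono h2).trans_lt ?_
  by_contra! h3
  rw [top_le_iff.1 h3, ENNReal.mul_top (by simpa using hc)] at h1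
  simp only [exc, sub_zero] at h
  exact h (top_le_iff.1 h1)

/-- The threshold is the infimum of the levels c ≥ 0 with m{f > c} ≤ s. Continuity from below gives
the first inequality; the second needs continuity from above, hence the finiteness of the superlevel
sets at positive levels. -/
theorem exists_threshold {f : ℝ → ℝ} (hf : Measurable f) (hf0 : ∀ u, 0 ≤ f u) (h : exc f 0 ≠ ∞)
    {s : ℝ≥0∞} (hs : 0 < s) (hs' : s ≠ ∞) :
    ∃ c, 0 ≤ c ∧ m {u | c < f u} ≤ s ∧ s ≤ m {u | c ≤ f u} := by
  set S : Set ℝ := {c | 0 ≤ c ∧ m {u | c < f u} ≤ s} with hS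
  have hne : S.Nonempty := by
    -- By Chebyshev, a superlevel set at level I/s + 1 of measure above s would give I + s ≤ I,
    -- where I is the finite integral of f.
    refine ⟨((exc f 0) / s).toReal + 1, by positivity, ?_⟩
    set I := exc f 0
    have hI : I / s ≠ ∞ := (ENNReal.div_lt_top h hs.ne').ne
    have h1 := mul_meas_ge_le_lintegral (μ := m) hf.ennreal_ofReal (I / s + 1)
    have h2 : {u | (I / s).toReal + 1 < f u} ⊆ {u | I / s + 1 ≤ ENNReal.ofReal (f u)} := by
      intro u hu
      have := ENNReal.ofReal_le_ofReal (le_of_lt hu)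
      rwa [ENNReal.ofReal_add ENNReal.toReal_nonneg zero_le_one, ENNReal.ofReal_toReal hI,
        ENNReal.ofReal_one] at this
    refine (measure_mono h2).trans ?_
    by_contra! h3
    have h4 : I + s ≤ I := by
      calc I + s = (I / s + 1) * s := by
            rw [add_mul, one_mul, ENNReal.div_mul_cancel hs.ne' hs']
        _ ≤ (I / s + 1) * m {u | I / s + 1 ≤ ENNReal.ofReal (f u)} := by gcongr
        _ ≤ I := by simpa [I, exc] using h1
    exact (ENNReal.lt_add_right h hs.ne').not_ge h4
  have hbdd : BddBelow S := ⟨0, fun c hc => hc.1⟩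
  set c := sInf S
  have hc0 : 0 ≤ c := le_csInf hne fun c hc => hc.1
  have hup : ∀ d, c < d → m {u | d < f u} ≤ s := fun d hd => by
    obtain ⟨e, he, hed⟩ := (csInf_lt_iff hbdd hne).1 hd
    exact (measure_mono fun u (hu : d < f u) => hed.trans hu).trans he.2
  refine ⟨c, hc0, ?_, ?_⟩
  · obtain ⟨d, hd1, hd2, hd3⟩ := exists_seq_strictAnti_tendsto c
    have hU : {u | c < f u} = ⋃ n, {u | d n < f u} := by
      ext u
      simp only [mem_ofPred_eq, mem_iUnion]
      constructor
      · intro hu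
        exact (hd3.eventually (gt_mem_nhds hu)).exists
      · rintro ⟨n, hn⟩
        exact (hd2 n).trans hn
    have hmono : Monotone fun n => {u | d n < f u} := fun a b hab u hu =>
      (hd1.antitone hab).trans_lt hu
    rw [hU, hmono.measure_iUnion]
    exact iSup_le fun n => hup _ (hd2 n)
  · rcases hc0.eq_or_lt with hc0 | hc0
    · have : {u | c ≤ f u} = univ := by
        ext u; simp [← hc0, hf0 u]
      rw [this]; simp
    · obtain ⟨d, hd1, hd2, hd3⟩ := exists_seq_strictMono_tendsto' hc0
      have hI : {u | c ≤ f u} = ⋂ n, {u | d n < f u} := by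
        ext u
        simp only [mem_ofPred_eq, mem_iInter]
        constructor
        · intro hu n
          exact (hd2 n).2.trans_le hu
        · intro hu
          exact le_of_tendsto' hd3 fun n => (hu n).le
      have hanti : Antitone fun n => {u | d n < f u} := fun a b hab u hu =>
        (hd1.monotone hab).trans_lt hu
      rw [hI, hanti.measure_iInter (fun n => (measurableSet_lt measurable_const hf).nullMeasurableSet)
        ⟨0, ((measure_mono fun u (hu : d 0 < f u) => hu.le).trans_lt
          (meas_lt_top_of_exc hf h (hd2 0).1)).ne⟩]
      refine le_iInf fun n => ?_
      by_contra! hlt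
      exact (hd2 n).2.not_ge (csInf_le hbdd ⟨(hd2 n).1.le, hlt.le⟩)

theorem exists_topSet {f : ℝ → ℝ} (hf : Measurable f) (hf0 : ∀ u, 0 ≤ f u) (h : exc f 0 ≠ ∞)
    {s : ℝ≥0∞} (hs : 0 < s) (hs' : s ≠ ∞) : ∃ C c, IsTopSet f C c ∧ m C = s := by
  obtain ⟨c, hc, h1, h2⟩ := exists_threshold hf hf0 h hs hs'
  obtain ⟨C, hC, hPC, hCR, hmC⟩ := exists_between_measure_eq
    (measurableSet_lt measurable_const hf) (measurableSet_le measurable_const hf)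
    (fun u (hu : c < f u) => hu.le) hs' h1 h2
  exact ⟨C, c, ⟨hC, hc, fun u hu => hCR hu, fun u hu => not_lt.1 fun h' => hu (hPC h')⟩, hmC⟩

/-- Top sets can be chosen nested. The empty set is admitted separately because it is a top set only
when f is bounded. -/
theorem exists_topSet_superset {f : ℝ → ℝ} (hf : Measurable f) (hf0 : ∀ u, 0 ≤ f u)
    (h : exc f 0 ≠ ∞) {C : Set ℝ} (hC : C = ∅ ∨ ∃ c, IsTopSet f C c) {s : ℝ≥0∞}
    (hs : m C ≤ s) (hs' : s ≠ ∞) :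
    ∃ C', C ⊆ C' ∧ (C' = ∅ ∨ ∃ c, IsTopSet f C' c) ∧ m C' = s := by
  rcases hs.eq_or_lt with hs | hs
  · exact ⟨C, Subset.rfl, hC, hs⟩
  obtain ⟨c', hc', h1, h2⟩ := exists_threshold hf hf0 h (hs.trans_le' zero_le) hs'
  have hCm : MeasurableSet C := by
    rcases hC with rfl | ⟨c, hc⟩
    · exact MeasurableSet.empty
    · exact hc.meas
  -- The old threshold c is compared with the new one c'. The case c < c' cannot occur: C would
  -- contain {f ≥ c'}, whose measure is at least s > m C.
  have key : C ⊆ {u | c' ≤ f u} ∧ m ({u | c' < f u} ∪ C) ≤ s := by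
    rcases hC with rfl | ⟨c, hc⟩
    · simpa using h1
    · rcases lt_trichotomy c' c with hcc | rfl | hcc
      · have : C ⊆ {u | c' < f u} := fun u hu => hcc.trans_le (hc.ge u hu)
        exact ⟨this.trans fun u (hu : c' < f u) => hu.le, by rwa [union_eq_left.2 this]⟩
      · have : {u | c' < f u} ⊆ C := fun u hu => by
          by_contra hn
          exact (hc.le u hn).not_gt hu
        exact ⟨fun u hu => hc.ge u hu, by rw [union_eq_right.2 this]; exact hs.le⟩
      · exfalso
        have : {u | c' ≤ f u} ⊆ C := fun u (hu : c' ≤ f u) => by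
          by_contra hn
          exact ((hc.le u hn).trans_lt hcc).not_ge hu
        exact (h2.trans (measure_mono this)).not_gt hs
  obtain ⟨C', hC', hPC, hCR, hmC⟩ := exists_between_measure_eq
    ((measurableSet_lt measurable_const hf).union hCm) (measurableSet_le measurable_const hf)
    (union_subset (fun u (hu : c' < f u) => hu.le) key.1) hs' key.2 h2
  exact ⟨C', subset_union_right.trans hPC, Or.inr ⟨c', hC', hc', fun u hu => hCR hu,
    fun u hu => not_lt.1 fun h' => hu (hPC (Or.inl h'))⟩, hmC⟩

/-! ### The space `L₁ + L_∞` -/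

theorem mem_L1_iff {f : L0} : f ∈ L1 ↔ Integrable f m := by
  rw [← memLp_one_iff_integrable]
  exact ⟨fun h => ⟨AEEqFun.aestronglyMeasurable f, h⟩, fun h => h.2⟩

theorem integrableOn_of_mem_Linfty {f : L0} (hf : f ∈ Linfty) {B : Set ℝ} (hB : m B ≠ ∞) :
    IntegrableOn f B m := by
  have h : MemLp f ∞ m := ⟨AEEqFun.aestronglyMeasurable f, hf⟩
  have : IsFiniteMeasure (m.restrict B) := ⟨by simpa using hB.lt_top⟩
  exact (h.restrict B).integrable le_top

theorem exists_add_eq (f : L1Linfty) : ∃ g ∈ L1, ∃ h ∈ Linfty, g + h = (f : L0) :=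
  Submodule.mem_sup.1 f.2

theorem integrableOn_coe (f : L1Linfty) {B : Set ℝ} (hB : m B ≠ ∞) : IntegrableOn (f : L0) B m := by
  obtain ⟨g, hg, h, hh, hf⟩ := exists_add_eq f
  rw [← hf]
  have h1 : IntegrableOn g B m := (mem_L1_iff.1 hg).integrableOn
  exact (h1.add (integrableOn_of_mem_Linfty hh hB)).congr_fun_ae
    (ae_restrict_of_ae (AEEqFun.coeFn_add g h).symm)

theorem mem_L1Linfty_of_mem_L1 {f : L0} (hf : f ∈ L1) : f ∈ L1Linfty := Submodule.mem_sup_left hf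

theorem mk_mem_L1 {f : ℝ → ℝ} (hf : Integrable f m) :
    (AEEqFun.mk f hf.aestronglyMeasurable : L0) ∈ L1 :=
  mem_L1_iff.2 (hf.congr (AEEqFun.coeFn_mk f _).symm)

theorem mk_mem_Linfty {f : ℝ → ℝ} (hf : Measurable f) {C : ℝ} (h : ∀ u, |f u| ≤ C) :
    (AEEqFun.mk f hf.aestronglyMeasurable : L0) ∈ Linfty := by
  have : MemLp f ∞ m := memLp_top_of_bound hf.aestronglyMeasurable C (ae_of_all _ h)
  exact ((memLp_congr_ae (AEEqFun.coeFn_mk f hf.aestronglyMeasurable).symm).1 this).2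

/-- An integrable function as an element of `L₁ + L_∞`. -/
def ofIntegrable (f : ℝ → ℝ) (hf : Integrable f m) : L1Linfty :=
  ⟨AEEqFun.mk f hf.aestronglyMeasurable, Submodule.mem_sup_left (mk_mem_L1 hf)⟩

/-- A bounded measurable function as an element of `L₁ + L_∞`. -/
def ofBounded (f : ℝ → ℝ) (hf : Measurable f) (C : ℝ) (h : ∀ u, |f u| ≤ C) : L1Linfty :=
  ⟨AEEqFun.mk f hf.aestronglyMeasurable, Submodule.mem_sup_right (mk_mem_Linfty hf h)⟩

theorem coe_ofIntegrable (f : ℝ → ℝ) (hf : Integrable f m) :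
    ((ofIntegrable f hf : L1Linfty) : L0) =ᵐ[m] f := AEEqFun.coeFn_mk f _

theorem coe_ofBounded (f : ℝ → ℝ) (hf : Measurable f) (C : ℝ) (h : ∀ u, |f u| ≤ C) :
    ((ofBounded f hf C h : L1Linfty) : L0) =ᵐ[m] f := AEEqFun.coeFn_mk f _

/-- The indicator function of a measurable set as an element of `L₁ + L_∞`. -/
def indL (B : Set ℝ) (hB : MeasurableSet B) : L1Linfty :=
  ofBounded (B.indicator 1) (measurable_one.indicator hB) 1 fun u => by
    by_cases hu : u ∈ B <;> simp [hu]

theorem coe_indL (B : Set ℝ) (hB : MeasurableSet B) :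
    ((indL B hB : L1Linfty) : L0) =ᵐ[m] B.indicator 1 := coe_ofBounded _ _ _ _

/-- Integration over a set of finite measure, as a functional on `L₁ + L_∞`. -/
def intL (A : Set ℝ) (hA : m A ≠ ∞) : L1Linfty →ₗ[ℝ] ℝ where
  toFun f := ∫ u in A, (f : L0) u ∂m
  map_add' f g := by
    rw [← integral_add (integrableOn_coe f hA) (integrableOn_coe g hA)]
    exact integral_congr_ae (ae_restrict_of_ae (AEEqFun.coeFn_add (f : L0) (g : L0)))
  map_smul' c f := by
    rw [RingHom.id_apply, smul_eq_mul, ← integral_const_mul]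
    exact integral_congr_ae (ae_restrict_of_ae (AEEqFun.coeFn_smul c (f : L0)))

theorem coeFn_sum {ι : Type*} (s : Finset ι) (f : ι → L0) :
    ⇑(∑ i ∈ s, f i) =ᵐ[m] fun u => ∑ i ∈ s, f i u := by
  classical
  induction s using Finset.induction_on with
  | empty =>
    simp only [Finset.sum_empty]
    exact AEEqFun.coeFn_zero
  | insert a s ha ih =>
    rw [Finset.sum_insert ha]
    filter_upwards [AEEqFun.coeFn_add (f a) (∑ i ∈ s, f i), ih] with u h1 h2
    rw [h1, Pi.add_apply, h2, Finset.sum_insert ha]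

/-! ### Substochastic operators -/

theorem IsSubstochastic.mono {T : L1Linfty →ₗ[ℝ] L1Linfty} (hT : IsSubstochastic T)
    {f g : L1Linfty} (h : (f : L0) ≤ᵐ[m] (g : L0)) : (T f : L0) ≤ᵐ[m] (T g : L0) := by
  have h0 : 0 ≤ ((g - f : L1Linfty) : L0) := by
    refine nonneg_of_coe ?_
    rw [Submodule.coe_sub]
    filter_upwards [h, AEEqFun.coeFn_sub (g : L0) (f : L0)] with u h1 h2
    rw [h2]; simpa using h1
  have h1 := coe_nonneg (hT.pos _ h0)
  rw [map_sub, Submodule.coe_sub] at h1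
  filter_upwards [h1, AEEqFun.coeFn_sub (T g : L0) (T f : L0)] with u h1 h2
  rw [h2] at h1; simpa using h1

theorem IsSubstochastic.convex {T S : L1Linfty →ₗ[ℝ] L1Linfty} (hT : IsSubstochastic T)
    (hS : IsSubstochastic S) {a b : ℝ} (ha : 0 ≤ a) (hb : 0 ≤ b) (hab : a + b = 1) :
    IsSubstochastic (a • T + b • S) := by
  have hco : ∀ f, (((a • T + b • S) f : L1Linfty) : L0) = a • (T f : L0) + b • (S f : L0) :=
    fun f => rfl
  have key : ∀ (p : ℝ≥0∞), 1 ≤ p → ∀ f : L1Linfty, eLpNorm (T f : L0) p m ≤ eLpNorm (f : L0) p m →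
      eLpNorm (S f : L0) p m ≤ eLpNorm (f : L0) p m →
      eLpNorm (((a • T + b • S) f : L1Linfty) : L0) p m ≤ eLpNorm (f : L0) p m := by
    intro p hp f h1 h2
    have hae : (a • (T f : L0) + b • (S f : L0) : L0) =ᵐ[m]
        (a • ((T f : L0) : ℝ → ℝ) + b • ((S f : L0) : ℝ → ℝ)) := by
      filter_upwards [AEEqFun.coeFn_add (a • (T f : L0)) (b • (S f : L0)),
        AEEqFun.coeFn_smul a (T f : L0), AEEqFun.coeFn_smul b (S f : L0)] with u h1 h2 h3
      rw [h1, Pi.add_apply, h2, h3]; rfl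
    rw [hco, eLpNorm_congr_ae hae]
    refine (eLpNorm_add_le ((AEEqFun.aestronglyMeasurable _).const_smul _)
      ((AEEqFun.aestronglyMeasurable _).const_smul _) hp).trans ?_
    rw [eLpNorm_const_smul, eLpNorm_const_smul, Real.enorm_eq_ofReal ha, Real.enorm_eq_ofReal hb]
    calc _ ≤ ENNReal.ofReal a * eLpNorm (f : L0) p m + ENNReal.ofReal b * eLpNorm (f : L0) p m := by
          gcongr
      _ = _ := by rw [← add_mul, ← ENNReal.ofReal_add ha hb, hab, ENNReal.ofReal_one, one_mul]
  refine ⟨fun f hf => ?_, fun f => key 1 le_rfl f (hT.contr_one f) (hS.contr_one f),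
    fun f => key ∞ le_top f (hT.contr_top f) (hS.contr_top f)⟩
  rw [hco]
  refine nonneg_of_coe ?_
  filter_upwards [AEEqFun.coeFn_add (a • (T f : L0)) (b • (S f : L0)),
    AEEqFun.coeFn_smul a (T f : L0), AEEqFun.coeFn_smul b (S f : L0), coe_nonneg (hT.pos f hf),
    coe_nonneg (hS.pos f hf)] with u h1 h2 h3 h4 h5
  rw [h1, Pi.add_apply, h2, h3]
  simp only [Pi.smul_apply, smul_eq_mul, Pi.zero_apply] at *
  positivity

/-- The operator that replaces `f` on `B l` by the mean value of `f` on `A l`. -/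
def avgOp (r : ℕ) (A B : ℕ → Set ℝ) (hA : ∀ l, m (A l) ≠ ∞) (hB : ∀ l, MeasurableSet (B l)) :
    L1Linfty →ₗ[ℝ] L1Linfty :=
  ∑ l ∈ Finset.range r, ((m.real (A l))⁻¹ • intL (A l) (hA l)).smulRight (indL (B l) (hB l))

section avgOp

variable {r : ℕ} {A B : ℕ → Set ℝ} {hA : ∀ l, m (A l) ≠ ∞} {hB : ∀ l, MeasurableSet (B l)}

theorem avgOp_apply (f : L1Linfty) :
    (avgOp r A B hA hB f : L0) =ᵐ[m] fun u => ∑ l ∈ Finset.range r,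
      ((m.real (A l))⁻¹ * ∫ v in A l, (f : L0) v ∂m) * (B l).indicator 1 u := by
  have h1 : (avgOp r A B hA hB f : L0) = ∑ l ∈ Finset.range r,
      (((m.real (A l))⁻¹ * ∫ v in A l, (f : L0) v ∂m) • (indL (B l) (hB l) : L0)) := by
    rw [avgOp, LinearMap.sum_apply, Submodule.coe_sum]
    rfl
  rw [h1]
  have h2 : ∀ᵐ u ∂m, ∀ l, (((m.real (A l))⁻¹ * ∫ v in A l, (f : L0) v ∂m) •
      (indL (B l) (hB l) : L0)) u =
      ((m.real (A l))⁻¹ * ∫ v in A l, (f : L0) v ∂m) * (B l).indicator 1 u := by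
    rw [ae_all_iff]
    intro l
    filter_upwards [AEEqFun.coeFn_smul ((m.real (A l))⁻¹ * ∫ v in A l, (f : L0) v ∂m)
      (indL (B l) (hB l) : L0), coe_indL (B l) (hB l)] with u h1 h2
    rw [h1, Pi.smul_apply, h2, smul_eq_mul]
  filter_upwards [coeFn_sum (Finset.range r) fun l =>
    (((m.real (A l))⁻¹ * ∫ v in A l, (f : L0) v ∂m) • (indL (B l) (hB l) : L0)), h2] with u h3 h4
  rw [h3]
  exact Finset.sum_congr rfl fun l _ => h4 l

theorem sum_indicator_of_mem (hBd : Pairwise (Function.onFun Disjoint B)) (c : ℕ → ℝ) {l : ℕ}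
    (hl : l < r) {u : ℝ} (hu : u ∈ B l) :
    ∑ j ∈ Finset.range r, c j * (B j).indicator 1 u = c l := by
  rw [Finset.sum_eq_single l]
  · simp [hu]
  · intro j _ hj
    have : u ∉ B j := fun h => disjoint_left.1 (hBd hj) h hu
    simp [this]
  · intro h
    exact absurd (Finset.mem_range.2 hl) h

theorem sum_indicator_of_notMem (c : ℕ → ℝ) {u : ℝ} (hu : ∀ l < r, u ∉ B l) :
    ∑ j ∈ Finset.range r, c j * (B j).indicator 1 u = 0 :=
  Finset.sum_eq_zero fun j hj => by simp [hu j (Finset.mem_range.1 hj)]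

/-- In L₁ the block B l costs at most ∫|f| over A l, and the A l are disjoint. In L_∞ each mean is
at most the supremum, and disjointness of the B l leaves a single term at each point. -/
theorem isSubstochastic_avgOp (hAm : ∀ l, MeasurableSet (A l))
    (hAd : Pairwise (Function.onFun Disjoint A))
    (hBd : Pairwise (Function.onFun Disjoint B)) (hAB : ∀ l, m (A l) = m (B l)) :
    IsSubstochastic (avgOp r A B hA hB) := by
  refine ⟨fun f hf => ?_, fun f => ?_, fun f => ?_⟩
  · refine nonneg_of_coe ?_
    filter_upwards [avgOp_apply (hA := hA) (hB := hB) f] with u hu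
    rw [hu]
    refine Finset.sum_nonneg fun l _ => mul_nonneg (mul_nonneg (by positivity) ?_) ?_
    · exact setIntegral_nonneg_of_ae_restrict (ae_restrict_of_ae (coe_nonneg hf))
    · exact indicator_nonneg (fun _ _ => zero_le_one) _
  · rw [eLpNorm_one_eq_lintegral_enorm, eLpNorm_one_eq_lintegral_enorm]
    have h1 : ∀ l, ‖(m.real (A l))⁻¹ * ∫ v in A l, (f : L0) v ∂m‖ₑ * m (B l) ≤
        ∫⁻ v in A l, ‖(f : L0) v‖ₑ ∂m := by
      intro l
      rw [← hAB]
      rcases eq_or_ne (m (A l)) 0 with h0 | h0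
      · simp [h0]
      · have h2 : ‖(m.real (A l))⁻¹‖ₑ = (m (A l))⁻¹ := by
          rw [enorm_inv (show m.real (A l) ≠ 0 from (ENNReal.toReal_pos h0 (hA l)).ne'), Real.enorm_eq_ofReal (by positivity),
            ofReal_measureReal (hA l)]
        rw [enorm_mul, h2, mul_right_comm, ENNReal.inv_mul_cancel h0 (hA l), one_mul]
        exact enorm_integral_le_lintegral_enorm _
    calc ∫⁻ u, ‖(avgOp r A B hA hB f : L0) u‖ₑ ∂m
        ≤ ∫⁻ u, ∑ l ∈ Finset.range r, ‖(m.real (A l))⁻¹ * ∫ v in A l, (f : L0) v ∂m‖ₑ *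
            (B l).indicator 1 u ∂m := by
          refine lintegral_mono_ae ?_
          filter_upwards [avgOp_apply (hA := hA) (hB := hB) f] with u hu
          rw [hu]
          refine (enorm_sum_le _ _).trans (Finset.sum_le_sum fun l _ => ?_)
          rw [enorm_mul]
          gcongr
          by_cases hul : u ∈ B l <;> simp [hul]
      _ = ∑ l ∈ Finset.range r, ‖(m.real (A l))⁻¹ * ∫ v in A l, (f : L0) v ∂m‖ₑ * m (B l) := by
          rw [lintegral_finsetSum _ fun l _ =>
            (measurable_one.indicator (hB l)).const_mul _]
          refine Finset.sum_congr rfl fun l _ => ?_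
          rw [lintegral_const_mul _ (measurable_one.indicator (hB l)),
            lintegral_indicator_one (hB l)]
      _ ≤ ∑ l ∈ Finset.range r, ∫⁻ v in A l, ‖(f : L0) v‖ₑ ∂m := Finset.sum_le_sum fun l _ => h1 l
      _ = ∫⁻ v in ⋃ l ∈ Finset.range r, A l, ‖(f : L0) v‖ₑ ∂m :=
          (lintegral_biUnion_finset (fun i _ j _ hij => hAd hij) (fun l _ => hAm l) _).symm
      _ ≤ _ := setLIntegral_le_lintegral _ _
  · rcases eq_or_ne (eLpNorm (f : L0) ∞ m) ∞ with h | h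
    · rw [h]; exact le_top
    set c := (eLpNorm (f : L0) ∞ m).toReal with hc
    have hb : ∀ᵐ u ∂m, ‖(f : L0) u‖ ≤ c := by
      filter_upwards [ae_le_eLpNormEssSup (f := (f : L0)) (μ := m)] with u hu
      rw [← eLpNorm_exponent_top] at hu
      have := ENNReal.toReal_mono h hu
      rwa [toReal_enorm] at this
    have h1 : ∀ l, ‖(m.real (A l))⁻¹ * ∫ v in A l, (f : L0) v ∂m‖ ≤ c := by
      intro l
      have h2 : ‖∫ v in A l, (f : L0) v ∂m‖ ≤ c * m.real (A l) :=
        norm_setIntegral_le_of_norm_le_const_ae (hA l).lt_top (ae_restrict_of_ae hb)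
      rw [norm_mul, norm_inv, Real.norm_of_nonneg measureReal_nonneg]
      rcases eq_or_ne (m.real (A l)) 0 with h0 | h0
      · rw [h0]; simp [hc]
      · rw [inv_mul_le_iff₀ (lt_of_le_of_ne measureReal_nonneg h0.symm), mul_comm]
        exact h2
    rw [← ENNReal.ofReal_toReal h, eLpNorm_exponent_top]
    refine eLpNormEssSup_le_of_ae_bound ?_
    filter_upwards [avgOp_apply (hA := hA) (hB := hB) f] with u hu
    rw [hu]
    by_cases hex : ∃ l < r, u ∈ B l
    · obtain ⟨l, hl, hul⟩ := hex
      rw [sum_indicator_of_mem hBd _ hl hul]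
      exact h1 l
    · push Not at hex
      rw [sum_indicator_of_notMem _ hex]
      simp

theorem setIntegral_avgOp (hBd : Pairwise (Function.onFun Disjoint B))
    (hAB : ∀ l, m (A l) = m (B l)) (f : L1Linfty) {l : ℕ} (hl : l < r) :
    ∫ u in B l, (avgOp r A B hA hB f : L0) u ∂m = ∫ u in A l, (f : L0) u ∂m := by
  have h1 : ∫ u in B l, (avgOp r A B hA hB f : L0) u ∂m =
      ∫ u in B l, ((m.real (A l))⁻¹ * ∫ v in A l, (f : L0) v ∂m) ∂m := by
    refine setIntegral_congr_ae (hB l) ?_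
    filter_upwards [avgOp_apply (hA := hA) (hB := hB) f] with u hu hul
    rw [hu, sum_indicator_of_mem hBd _ hl hul]
  rw [h1, setIntegral_const, smul_eq_mul, measureReal_def, measureReal_def, ← hAB, ← mul_assoc]
  rcases eq_or_ne (m (A l)) 0 with h0 | h0
  · rw [Measure.restrict_eq_zero.2 h0]; simp
  · rw [mul_inv_cancel₀ (ENNReal.toReal_pos h0 (hA l)).ne', one_mul]

theorem avgOp_eq_zero_of_notMem (f : L1Linfty) :
    ∀ᵐ u ∂m, (∀ l < r, u ∉ B l) → (avgOp r A B hA hB f : L0) u = 0 := by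
  filter_upwards [avgOp_apply (hA := hA) (hB := hB) f] with u hu hul
  rw [hu, sum_indicator_of_notMem _ hul]

end avgOp

/-! ### Finite-dimensional approximation of majorized functions -/

theorem setIntegral_le_of_setLIntegral_le {f g : ℝ → ℝ} {C D : Set ℝ} (hf : 0 ≤ᵐ[m] f)
    (hg : 0 ≤ᵐ[m] g) (hfi : IntegrableOn f C m) (hgi : IntegrableOn g D m)
    (h : ∫⁻ u in C, ENNReal.ofReal (f u) ∂m ≤ ∫⁻ u in D, ENNReal.ofReal (g u) ∂m) :
    ∫ u in C, f u ∂m ≤ ∫ u in D, g u ∂m := by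
  rw [← ofReal_integral_eq_lintegral_ofReal hfi (ae_restrict_of_ae hf),
    ← ofReal_integral_eq_lintegral_ofReal hgi (ae_restrict_of_ae hg)] at h
  exact (ENNReal.ofReal_le_ofReal_iff (integral_nonneg_of_ae (ae_restrict_of_ae hg))).1 h

theorem exists_chain {f : ℝ → ℝ} (hf : Measurable f) (hf0 : ∀ u, 0 ≤ f u) (h : exc f 0 ≠ ∞)
    {s : ℕ → ℝ≥0∞} (hs0 : s 0 = 0) (hs : Monotone s) (hst : ∀ l, s l ≠ ∞) :
    ∃ C : ℕ → Set ℝ, C 0 = ∅ ∧ Monotone C ∧ ∀ l, (C l = ∅ ∨ ∃ c, IsTopSet f (C l) c) ∧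
      m (C l) = s l := by
  let P : ℕ → Set ℝ → Prop := fun l C => (C = ∅ ∨ ∃ c, IsTopSet f C c) ∧ m C = s l
  have hstep : ∀ l (C : {C // P l C}), ∃ C' : {C // P (l + 1) C}, C.1 ⊆ C'.1 := by
    rintro l ⟨C, hC1, hC2⟩
    obtain ⟨C', h1, h2, h3⟩ := exists_topSet_superset hf hf0 h hC1
      (hC2.le.trans (hs (Nat.le_succ l))) (hst (l + 1))
    exact ⟨⟨C', h2, h3⟩, h1⟩
  choose nxt hnxt using hstep
  let C : (l : ℕ) → {C // P l C} := fun l =>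
    Nat.rec ⟨∅, Or.inl rfl, by simp [hs0]⟩ (fun l C => nxt l C) l
  exact ⟨fun l => (C l).1, rfl, monotone_nat_of_le_succ fun l => hnxt l (C l), fun l => (C l).2⟩

/-- Choose nested top sets C l of x with m (C l) = m (D l) and send the mean of x over each layer of
C to the corresponding layer of D. Then the image has over D l the integral of x over C l, the
largest possible for that measure, and the comparison of `exc` makes it at least ∫ y over D l. -/
theorem exists_substochastic_chain {x y : L0} (hx : 0 ≤ x) (hx1 : x ∈ L1) (hy : 0 ≤ y)
    (hy1 : y ∈ L1) (hyx : ∀ c, 0 ≤ c → exc y c ≤ exc x c) {D : ℕ → Set ℝ} (hD0 : D 0 = ∅)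
    (hD : Monotone D) (hDm : ∀ l, MeasurableSet (D l)) (hDf : ∀ l, m (D l) ≠ ∞) (r : ℕ) :
    ∃ S, IsSubstochastic S ∧
      (∀ l ≤ r, ∫ u in D l, y u ∂m ≤ ∫ u in D l, (S ⟨x, mem_L1Linfty_of_mem_L1 hx1⟩ : L0) u ∂m) ∧
      ∀ᵐ u ∂m, u ∉ D r → (S ⟨x, mem_L1Linfty_of_mem_L1 hx1⟩ : L0) u = 0 := by
  obtain ⟨f, hf, hf0, hxf⟩ := exists_measurable_nonneg_rep hx
  have hfi : Integrable f m := (mem_L1_iff.1 hx1).congr hxf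
  have hexc : exc f 0 ≠ ∞ := by
    have : ∫⁻ u, ENNReal.ofReal (f u) ∂m < ∞ := hfi.lintegral_lt_top
    simpa [exc] using this.ne
  obtain ⟨C, hC0, hCmono, hC⟩ := exists_chain hf hf0 hexc (s := fun l => m (D l)) (by simp [hD0])
    (fun a b hab => measure_mono (hD hab)) hDf
  have hCm : ∀ l, MeasurableSet (C l) := fun l => by
    rcases (hC l).1 with h | ⟨c, h⟩
    · rw [h]; exact MeasurableSet.empty
    · exact h.meas
  set A : ℕ → Set ℝ := fun l => C (l + 1) \ C l
  set B : ℕ → Set ℝ := fun l => D (l + 1) \ D l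
  have hdisj : ∀ {E : ℕ → Set ℝ}, Monotone E →
      Pairwise (Function.onFun Disjoint fun l => E (l + 1) \ E l) := by
    intro E hE
    rw [pairwise_disjoint_on]
    intro i j hij
    exact disjoint_left.2 fun u hi hj => hj.2 (hE (Nat.succ_le_of_lt hij) hi.1)
  have hAm : ∀ l, MeasurableSet (A l) := fun l => (hCm _).diff (hCm _)
  have hBm : ∀ l, MeasurableSet (B l) := fun l => (hDm _).diff (hDm _)
  have hCf : ∀ l, m (C l) ≠ ∞ := fun l => by rw [(hC l).2]; exact hDf l
  have hAf : ∀ l, m (A l) ≠ ∞ := fun l => measure_ne_top_of_subset sdiff_subset (hCf _)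
  have hAB : ∀ l, m (A l) = m (B l) := fun l => by
    simp only [A, B]
    rw [measure_sdiff (hCmono l.le_succ) (hCm l).nullMeasurableSet (hCf l),
      measure_sdiff (hD l.le_succ) (hDm l).nullMeasurableSet (hDf l), (hC _).2, (hC _).2]
  set S := avgOp r A B hAf hBm
  set X : L1Linfty := ⟨x, mem_L1Linfty_of_mem_L1 hx1⟩
  have hint : ∀ l ≤ r, ∫ u in D l, (S X : L0) u ∂m = ∫ u in C l, x u ∂m := by
    intro l
    induction l with
    | zero => intro _; simp [hD0, hC0]
    | succ l ih =>
      intro hl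
      have e1 : D (l + 1) = D l ∪ B l := (union_sdiff_cancel (hD l.le_succ)).symm
      have e2 : C (l + 1) = C l ∪ A l := (union_sdiff_cancel (hCmono l.le_succ)).symm
      rw [e1, e2, setIntegral_union disjoint_sdiff_right (hBm l) (integrableOn_coe _ (hDf _))
        (integrableOn_coe _ (measure_ne_top_of_subset sdiff_subset (hDf _))),
        setIntegral_union disjoint_sdiff_right (hAm l) (mem_L1_iff.1 hx1).integrableOn
        (mem_L1_iff.1 hx1).integrableOn, ih (by omega),
        setIntegral_avgOp (hdisj hD) hAB X (by omega)]
  refine ⟨S, isSubstochastic_avgOp hAm (hdisj hCmono) (hdisj hD) hAB, fun l hl => ?_, ?_⟩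
  · rw [hint l hl]
    refine setIntegral_le_of_setLIntegral_le (coe_nonneg hy) (coe_nonneg hx)
      (mem_L1_iff.1 hy1).integrableOn (mem_L1_iff.1 hx1).integrableOn ?_
    rcases (hC l).1 with h | ⟨c, h⟩
    · have : m (D l) = 0 := by rw [← (hC l).2, h, measure_empty]
      rw [Measure.restrict_eq_zero.2 this]; simp
    · have e : ∫⁻ u in C l, ENNReal.ofReal (x u) ∂m = ∫⁻ u in C l, ENNReal.ofReal (f u) ∂m :=
        lintegral_congr_ae (ae_restrict_of_ae (hxf.mono fun u hu => by simp only [hu]))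
      rw [e, h.setLIntegral, (hC l).2]
      refine (setLIntegral_le_exc y (D l) c).trans ?_
      gcongr
      exact (hyx c h.nonneg).trans_eq (exc_congr hxf c)
  · filter_upwards [avgOp_eq_zero_of_notMem (hA := hAf) (hB := hBm) (r := r) X] with u hu hur
    exact hu fun l hl hul => hur (hD (Nat.succ_le_of_lt hl) hul.1)

theorem lintegral_mul_eq_lintegral_setLIntegral {z G : ℝ → ℝ} (hz : Measurable z)
    (hG : Measurable G) :
    ∫⁻ u, ENNReal.ofReal (z u) * ENNReal.ofReal (G u) ∂m =
      ∫⁻ c, ∫⁻ u in {u | c < G u}, ENNReal.ofReal (z u) ∂m ∂m := by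
  have h := lintegral_withDensity_eq_lintegral_mul m hz.ennreal_ofReal hG.ennreal_ofReal
  simp only [Pi.mul_apply] at h
  rw [← h, lintegral_eq_lintegral_meas_ofReal_lt _ hG.ennreal_ofReal]
  refine setLIntegral_congr_fun measurableSet_Ioi fun c (hc : 0 < c) => ?_
  have : {a | ENNReal.ofReal c < ENNReal.ofReal (G a)} = {u | c < G u} := by
    ext u
    exact ENNReal.ofReal_lt_ofReal_iff_of_nonneg hc.le
  rw [this, withDensity_apply _ (measurableSet_lt measurable_const hG)]

/-- The positive superlevel sets of a finitely valued G form a finite chain. Comparing the integrals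
over them and applying the layer-cake formula in G gives the inequality for G⁺. The image of x
vanishes where G ≤ 0, so on its side G⁺ may be replaced by G. -/
theorem exists_substochastic_integral_le {x y : L0} (hx : 0 ≤ x) (hx1 : x ∈ L1) (hy : 0 ≤ y)
    (hy1 : y ∈ L1) (hyx : ∀ c, 0 ≤ c → exc y c ≤ exc x c) {G : ℝ → ℝ} (hG : Measurable G)
    (hGf : (range G).Finite) (hGs : m {u | 0 < G u} ≠ ∞) :
    ∃ S, IsSubstochastic S ∧
      ∫ u, y u * G u ∂m ≤ ∫ u, (S ⟨x, mem_L1Linfty_of_mem_L1 hx1⟩ : L0) u * G u ∂m := by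
  classical
  set V : Finset ℝ := hGf.toFinset.filter (0 < ·)
  -- N s counts the positive values of G not exceeding s, so for s ≥ 0 the set {G > s} is the member
  -- of the chain with index r - N s.
  set N : ℝ → ℕ := fun s => (V.filter (· ≤ s)).card
  have hNmono : Monotone N := fun a b hab =>
    Finset.card_le_card fun v hv => by
      simp only [Finset.mem_filter] at hv ⊢
      exact ⟨hv.1, hv.2.trans hab⟩
  have hNle : ∀ s, N s ≤ V.card := fun s => Finset.card_filter_le _ _
  have hlevel : ∀ s, 0 ≤ s → ∀ u, s < G u ↔ N s < N (G u) := by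
    intro s hs u
    constructor
    · intro h
      refine Finset.card_lt_card ⟨fun v hv => ?_, fun hsub => ?_⟩
      · simp only [Finset.mem_filter] at hv ⊢
        exact ⟨hv.1, hv.2.trans h.le⟩
      · have : G u ∈ V.filter (· ≤ s) := hsub (by simp [V, hs.trans_lt h])
        exact h.not_ge (Finset.mem_filter.1 this).2
    · intro h
      by_contra! hle
      exact h.not_ge (hNmono hle)
  set r := V.card
  set D : ℕ → Set ℝ := fun l => {u | r < N (G u) + l}
  have hDm : ∀ l, MeasurableSet (D l) := fun l =>
    measurableSet_lt measurable_const ((hNmono.measurable.comp hG).add_const l)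
  have hN0 : N 0 = 0 := by
    refine Finset.card_eq_zero.2 (Finset.filter_eq_empty_iff.2 fun v hv => ?_)
    exact not_le.2 (Finset.mem_filter.1 hv).2
  have hDr : D r = {u | 0 < G u} := by
    ext u
    simp only [D, mem_ofPred_eq, hlevel 0 le_rfl u, hN0]
    omega
  have hlev : ∀ s, 0 ≤ s → {u | s < G u} = D (r - N s) := by
    intro s hs
    ext u
    have := hNle s
    simp only [D, mem_ofPred_eq, hlevel s hs u]
    omega
  have hD0 : D 0 = ∅ := by
    ext u
    have := hNle (G u)
    simp only [D, mem_ofPred_eq, mem_empty_iff_false, iff_false]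
    omega
  have hDmono : Monotone D := fun a b hab u (hu : r < N (G u) + a) => by
    simp only [D, mem_ofPred_eq]; omega
  -- The chain is frozen at index r, where it equals {G > 0}; the next set is the whole line and has
  -- infinite measure.
  set D' : ℕ → Set ℝ := fun l => D (min l r)
  have hD'f : ∀ l, m (D' l) ≠ ∞ := fun l =>
    measure_ne_top_of_subset (hDmono (min_le_right l r)) (hDr ▸ hGs)
  obtain ⟨S, hS, hS1, hS2⟩ := exists_substochastic_chain hx hx1 hy hy1 hyx (D := D')
    (by simp [D', hD0]) (fun a b hab => hDmono (by omega)) (fun l => hDm _) hD'f r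
  refine ⟨S, hS, ?_⟩
  set z : L0 := (S ⟨x, mem_L1Linfty_of_mem_L1 hx1⟩ : L0) with hz
  have hz0 : 0 ≤ z := hS.pos _ hx
  have hz1 : z ∈ L1 := by
    have h1 := hS.contr_one ⟨x, mem_L1Linfty_of_mem_L1 hx1⟩
    exact h1.trans_lt (show eLpNorm x 1 m < ∞ from hx1)
  obtain ⟨b, hb⟩ := (hGf.image (‖·‖)).bddAbove
  have hbG : ∀ u, ‖G u‖ ≤ b := fun u => hb (mem_image_of_mem _ (mem_range_self u))
  have hGp : ∀ u, ‖max (G u) 0‖ ≤ b := fun u => by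
    refine le_trans ?_ (hbG u)
    rw [Real.norm_eq_abs, Real.norm_eq_abs, abs_of_nonneg (le_max_right _ _)]
    exact max_le (le_abs_self _) (abs_nonneg _)
  have hi : ∀ w : L0, w ∈ L1 → Integrable (fun u => w u * max (G u) 0) m := fun w hw =>
    (mem_L1_iff.1 hw).mul_bdd (c := b) (hG.max measurable_const).aestronglyMeasurable (ae_of_all _ hGp)
  have hi' : ∀ w : L0, w ∈ L1 → Integrable (fun u => w u * G u) m := fun w hw =>
    (mem_L1_iff.1 hw).mul_bdd (c := b) hG.aestronglyMeasurable (ae_of_all _ hbG)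
  have hconv : ∀ w : L0, 0 ≤ w → w ∈ L1 → ENNReal.ofReal (∫ u, w u * max (G u) 0 ∂m) =
      ∫⁻ u, ENNReal.ofReal (w u) * ENNReal.ofReal (G u) ∂m := by
    intro w hw hw1
    rw [ofReal_integral_eq_lintegral_ofReal (hi w hw1)]
    · refine lintegral_congr_ae ((coe_nonneg hw).mono fun u hu => ?_)
      simp only
      rw [ENNReal.ofReal_mul hu]
      congr 1
      rcases le_total 0 (G u) with h | h
      · rw [max_eq_left h]
      · rw [max_eq_right h, ENNReal.ofReal_of_nonpos h, ENNReal.ofReal_zero]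
    · exact (coe_nonneg hw).mono fun u hu => mul_nonneg hu (le_max_right _ _)
  calc ∫ u, y u * G u ∂m ≤ ∫ u, y u * max (G u) 0 ∂m :=
        integral_mono_ae (hi' y hy1) (hi y hy1)
          ((coe_nonneg hy).mono fun u hu => mul_le_mul_of_nonneg_left (le_max_left _ _) hu)
    _ ≤ ∫ u, z u * max (G u) 0 ∂m := by
        have h0 : 0 ≤ ∫ u, z u * max (G u) 0 ∂m := integral_nonneg_of_ae
          ((coe_nonneg hz0).mono fun u hu => mul_nonneg hu (le_max_right _ _))
        rw [← ENNReal.ofReal_le_ofReal_iff h0, hconv y hy hy1, hconv z hz0 hz1,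
          lintegral_mul_eq_lintegral_setLIntegral (AEEqFun.measurable y) hG,
          lintegral_mul_eq_lintegral_setLIntegral (AEEqFun.measurable z) hG]
        refine setLIntegral_mono' measurableSet_Ioi fun c (hc : 0 < c) => ?_
        rw [hlev c hc.le]
        have hle := hS1 (r - N c) (Nat.sub_le _ _)
        have e : D' (r - N c) = D (r - N c) := by simp [D']
        rw [e, ← ENNReal.ofReal_le_ofReal_iff
          (integral_nonneg_of_ae (ae_restrict_of_ae (coe_nonneg hz0))),
          ofReal_integral_eq_lintegral_ofReal (mem_L1_iff.1 hy1).integrableOn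
            (ae_restrict_of_ae (coe_nonneg hy)),
          ofReal_integral_eq_lintegral_ofReal (mem_L1_iff.1 hz1).integrableOn
            (ae_restrict_of_ae (coe_nonneg hz0))] at hle
        exact hle
    _ = ∫ u, z u * G u ∂m := by
        refine integral_congr_ae ?_
        filter_upwards [hS2] with u hu
        rcases lt_or_ge 0 (G u) with h | h
        · simp only [max_eq_left h.le]
        · have : u ∉ D' r := by
            simp only [D', min_self, hDr]; exact not_lt.2 h
          rw [hu this, zero_mul, zero_mul]

/-- The vectors of integrals of Sx over the B i form a convex set. A functional separating the
vector of y from its closure is integration against a combination of the indicators of the B i,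
which the previous lemma forbids. -/
theorem exists_substochastic_approx {x y : L0} (hx : 0 ≤ x) (hx1 : x ∈ L1) (hy : 0 ≤ y)
    (hy1 : y ∈ L1) (hyx : ∀ c, 0 ≤ c → exc y c ≤ exc x c) {ι : Type*} [Fintype ι] (B : ι → Set ℝ)
    (hB : ∀ i, MeasurableSet (B i)) (hBf : ∀ i, m (B i) ≠ ∞) {ε : ℝ} (hε : 0 < ε) :
    ∃ S, IsSubstochastic S ∧ ∀ i,
      |∫ u in B i, (S ⟨x, mem_L1Linfty_of_mem_L1 hx1⟩ : L0) u ∂m - ∫ u in B i, y u ∂m| < ε := by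
  classical
  set X : L1Linfty := ⟨x, mem_L1Linfty_of_mem_L1 hx1⟩
  let J : L1Linfty →ₗ[ℝ] (ι → ℝ) := LinearMap.pi fun i => intL (B i) (hBf i)
  have hJ : ∀ f i, J f i = ∫ u in B i, (f : L0) u ∂m := fun f i => rfl
  let Y : L1Linfty := ⟨y, mem_L1Linfty_of_mem_L1 hy1⟩
  set K : Set (ι → ℝ) := {v | ∃ S, IsSubstochastic S ∧ v = J (S X)}
  have hK : Convex ℝ K := by
    rintro _ ⟨S, hS, rfl⟩ _ ⟨T, hT, rfl⟩ a b ha hb hab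
    exact ⟨a • S + b • T, hS.convex hT ha hb hab, by simp⟩
  have hmem : J Y ∈ closure K := by
    by_contra hn
    obtain ⟨F, u, hF1, hF2⟩ := geometric_hahn_banach_closed_point hK.closure isClosed_closure hn
    have hFs : ∀ v, F v = ∑ i, v i * F (Pi.single i 1) := fun v => by
      have := LinearMap.pi_apply_eq_sum_univ F.toLinearMap v
      simp only [smul_eq_mul] at this
      refine this.trans (Finset.sum_congr rfl fun i _ => ?_)
      have h1 : (fun j => if i = j then (1 : ℝ) else 0) = Pi.single i 1 := by
        ext j
        simp [Pi.single_apply, eq_comm]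
      rw [h1]; rfl
    set g : ι → ℝ := fun i => F (Pi.single i 1)
    set G : ℝ → ℝ := fun u => ∑ i, g i * (B i).indicator 1 u
    have hG : Measurable G :=
      Finset.measurable_sum _ fun i _ => (measurable_one.indicator (hB i)).const_mul _
    have hGf : (range G).Finite := by
      refine (Set.finite_range fun s : Set ι => ∑ i, g i * s.indicator 1 i).subset ?_
      rintro _ ⟨u, rfl⟩
      refine ⟨{i | u ∈ B i}, Finset.sum_congr rfl fun i _ => ?_⟩
      by_cases hi : u ∈ B i <;> simp [hi]
    have hGs : m {u | 0 < G u} ≠ ∞ := by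
      refine measure_ne_top_of_subset (t := {u | 0 < G u}) (s := ⋃ i, B i) (fun u hu => ?_) ?_
      · by_contra hn
        simp only [mem_iUnion, not_exists] at hn
        have : G u = 0 := Finset.sum_eq_zero fun i _ => by simp [hn i]
        exact (this ▸ hu : (0 : ℝ) < 0).false
      · exact ((measure_iUnion_le _).trans_lt (by
          rw [tsum_fintype]; exact ENNReal.sum_lt_top.2 fun i _ => (hBf i).lt_top)).ne
    obtain ⟨S, hS, hle⟩ := exists_substochastic_integral_le hx hx1 hy hy1 hyx hG hGf hGs
    have hI : ∀ w : L1Linfty, ∫ u, (w : L0) u * G u ∂m = F (J w) := by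
      intro w
      have e1 : ∀ u, (w : L0) u * G u = ∑ i, g i * (B i).indicator (w : L0) u := by
        intro u
        rw [Finset.mul_sum]
        refine Finset.sum_congr rfl fun i _ => ?_
        by_cases hi : u ∈ B i <;> simp [hi, mul_comm]
      simp_rw [e1]
      rw [integral_finsetSum _ fun i _ =>
        ((integrable_indicator_iff (hB i)).2 (integrableOn_coe w (hBf i))).const_mul _, hFs]
      refine Finset.sum_congr rfl fun i _ => ?_
      rw [integral_const_mul, integral_indicator (hB i), hJ, mul_comm]
    have h1 := hI Y
    have h2 := hI (S X)
    have h3 := hF1 (J (S X)) (subset_closure ⟨S, hS, rfl⟩)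
    have h4 : F (J Y) ≤ F (J (S X)) := by rw [← h1, ← h2]; exact hle
    linarith
  obtain ⟨v, ⟨S, hS, rfl⟩, hd⟩ := Metric.mem_closure_iff.1 hmem ε hε
  refine ⟨S, hS, fun i => ?_⟩
  have := (dist_le_pi_dist (J Y) (J (S X)) i).trans_lt hd
  rwa [Real.dist_eq, abs_sub_comm] at this

/-! ### Weak limits of substochastic operators -/

/-- Boundedness gives a limit of the integrals along U for each measurable set. The bound ε + C
μ(V), uniform in k, passes to the limit set function and makes it countably additive and absolutely
continuous, so Radon-Nikodym supplies the density. -/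
theorem exists_weak_limit {α K : Type*} [MeasurableSpace α] (μ : Measure α) [IsFiniteMeasure μ]
    (U : Ultrafilter K) (g : K → α → ℝ) (hg : ∀ k, Integrable (g k) μ)
    (hb : ∀ ε > 0, ∃ C, 0 ≤ C ∧ ∀ k V, MeasurableSet V → |∫ u in V, g k u ∂μ| ≤ ε + C * μ.real V) :
    ∃ g' : α → ℝ, Measurable g' ∧ Integrable g' μ ∧ ∀ V, MeasurableSet V →
      Tendsto (fun k => ∫ u in V, g k u ∂μ) U (𝓝 (∫ u in V, g' u ∂μ)) := by
  classical
  have hlim : ∀ V, ∃ l : ℝ, MeasurableSet V → Tendsto (fun k => ∫ u in V, g k u ∂μ) U (𝓝 l) := by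
    intro V
    by_cases hV : MeasurableSet V
    · obtain ⟨C, hC, h⟩ := hb 1 one_pos
      obtain ⟨l, -, hl⟩ := (isCompact_Icc (a := -(1 + C * μ.real V))
        (b := 1 + C * μ.real V)).ultrafilter_le_nhds (U.map fun k => ∫ u in V, g k u ∂μ)
        (by
          rw [le_principal_iff]
          exact Filter.mem_map.2 (Filter.univ_mem' fun k => abs_le.1 (h k V hV)))
      exact ⟨l, fun _ => hl⟩
    · exact ⟨0, fun h => absurd h hV⟩
  choose ν hν using hlim
  have hνb : ∀ ε > 0, ∃ C, 0 ≤ C ∧ ∀ V, MeasurableSet V → |ν V| ≤ ε + C * μ.real V := by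
    intro ε hε
    obtain ⟨C, hC, h⟩ := hb ε hε
    exact ⟨C, hC, fun V hV => le_of_tendsto (hν V hV).abs (Eventually.of_forall fun k => h k V hV)⟩
  have hadd : ∀ V W, MeasurableSet V → MeasurableSet W → Disjoint V W →
      ν (V ∪ W) = ν V + ν W := by
    intro V W hV hW hd
    refine tendsto_nhds_unique (hν _ (hV.union hW)) (((hν V hV).add (hν W hW)).congr fun k => ?_)
    exact (setIntegral_union hd hW (hg k).integrableOn (hg k).integrableOn).symm
  have hempty : ν ∅ = 0 := by
    have := hadd ∅ ∅ MeasurableSet.empty MeasurableSet.empty (disjoint_empty _)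
    simpa using this
  have hfin : ∀ (V : ℕ → Set α), (∀ i, MeasurableSet (V i)) → Pairwise (Function.onFun Disjoint V) →
      ∀ s : Finset ℕ, ν (⋃ i ∈ s, V i) = ∑ i ∈ s, ν (V i) := by
    intro V hV hd s
    induction s using Finset.induction_on with
    | empty => simpa using hempty
    | insert a s ha ih =>
      rw [Finset.set_biUnion_insert, hadd _ _ (hV a) (Finset.measurableSet_biUnion _ fun i _ => hV i),
        ih, Finset.sum_insert ha]
      rw [disjoint_iUnion₂_right]
      exact fun i hi => hd fun h => ha (h ▸ hi)
  let s : SignedMeasure α :=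
    { measureOf' := fun V => if MeasurableSet V then ν V else 0
      empty' := by simp [hempty]
      not_measurable' := fun V hV => by simp [hV]
      m_iUnion' := by
        intro V hV hd
        have hU : MeasurableSet (⋃ i, V i) := MeasurableSet.iUnion hV
        simp only [hV, hU, if_true]
        have hM : HasSum (fun i => μ.real (V i)) (μ.real (⋃ i, V i)) := by
          have := μ.toSignedMeasure.m_iUnion hV hd
          simpa [Measure.toSignedMeasure_apply_measurable, hV, hU] using this
        rw [HasSum, SummationFilter.unconditional_filter, Metric.tendsto_nhds]
        intro ε hε
        -- The uncovered tail of the union has measure tending to 0; half of ε pays for C times that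
        -- measure and half for the constant term of the bound.
        obtain ⟨C, hC, h⟩ := hνb (ε / 2) (by positivity)
        have h0 : Tendsto (fun s : Finset ℕ => C * (μ.real (⋃ i, V i) - ∑ i ∈ s, μ.real (V i)))
            atTop (𝓝 0) := by
          have : Tendsto (fun s : Finset ℕ => ∑ i ∈ s, μ.real (V i)) atTop
              (𝓝 (μ.real (⋃ i, V i))) := by
            simpa [HasSum, SummationFilter.unconditional_filter] using hM
          simpa using ((tendsto_const_nhds (x := μ.real (⋃ i, V i))).sub this).const_mul C
        filter_upwards [h0.eventually (gt_mem_nhds (show 0 < ε / 2 by positivity))] with s hs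
        have hSm : MeasurableSet (⋃ i ∈ s, V i) := Finset.measurableSet_biUnion _ fun i _ => hV i
        have hsub : (⋃ i ∈ s, V i) ⊆ ⋃ i, V i := iUnion₂_subset_iUnion _ _
        have e1 := hadd _ _ hSm (hU.diff hSm) disjoint_sdiff_right
        rw [union_sdiff_cancel hsub, hfin V hV hd] at e1
        have e2 : μ.real ((⋃ i, V i) \ ⋃ i ∈ s, V i) = μ.real (⋃ i, V i) - ∑ i ∈ s, μ.real (V i) := by
          rw [measureReal_sdiff hsub hSm, measureReal_biUnion_finset (fun i _ j _ hij => hd hij)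
            fun i _ => hV i]
        have := h _ (hU.diff hSm)
        rw [e2] at this
        rw [Real.dist_eq, abs_sub_comm, show ν (⋃ i, V i) - ∑ i ∈ s, ν (V i) =
          ν ((⋃ i, V i) \ ⋃ i ∈ s, V i) by linarith]
        linarith }
  have hs : ∀ V, MeasurableSet V → s V = ν V := fun V hV => if_pos hV
  have hac : s ≪ᵥ μ.toENNRealVectorMeasure := by
    refine VectorMeasure.AbsolutelyContinuous.mk fun V hV h0 => ?_
    rw [Measure.toENNRealVectorMeasure_apply_measurable hV] at h0
    rw [hs V hV, ← abs_nonpos_iff]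
    refine le_of_forall_pos_le_add fun ε hε => ?_
    obtain ⟨C, hC, h⟩ := hνb ε hε
    have := h V hV
    simpa [measureReal_def, h0] using this
  refine ⟨s.rnDeriv μ, SignedMeasure.measurable_rnDeriv _ _, SignedMeasure.integrable_rnDeriv _ _,
    fun V hV => ?_⟩
  have := hν V hV
  rwa [← hs V hV, ← SignedMeasure.withDensityᵥ_rnDeriv_eq s μ hac,
    withDensityᵥ_apply (SignedMeasure.integrable_rnDeriv _ _) hV] at this

/-- A weight that is constant on each interval `(j, j + 1]`. -/
def wt (u : ℝ) : ℝ≥0∞ := 2⁻¹ ^ ⌈u⌉₊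

/-- A finite measure with the same null sets as Lebesgue measure on the semi-axis. -/
def mw : Measure ℝ := m.withDensity wt

theorem measurable_wt : Measurable wt :=
  (measurable_of_countable (fun n : ℕ => (2⁻¹ : ℝ≥0∞) ^ n)).comp Nat.measurable_ceil

theorem wt_le_one (u : ℝ) : wt u ≤ 1 := pow_le_one₀ zero_le (by simp)

theorem mw_le : mw ≤ m := by
  have : mw ≤ m.withDensity 1 := withDensity_mono (ae_of_all _ wt_le_one)
  rwa [withDensity_one] at this

theorem mw_ac : m ≪ mw :=
  withDensity_absolutelyContinuous' measurable_wt.aemeasurable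
    (ae_of_all _ fun u => by simp [wt])

theorem mw_ac' : mw ≪ m := withDensity_absolutelyContinuous _ _

theorem Ioi_subset_iUnion : Ioi (0 : ℝ) ⊆ ⋃ j : ℕ, Ioc (j : ℝ) (j + 1) := by
  intro u (hu : 0 < u)
  rw [mem_iUnion]
  have h1 : 0 < ⌈u⌉₊ := Nat.ceil_pos.2 hu
  refine ⟨⌈u⌉₊ - 1, ?_, ?_⟩
  · have := Nat.ceil_lt_add_one hu.le
    push_cast [Nat.cast_sub (Nat.one_le_iff_ne_zero.2 h1.ne')]
    linarith
  · push_cast [Nat.cast_sub (Nat.one_le_iff_ne_zero.2 h1.ne')]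
    simpa using Nat.le_ceil u

theorem lintegral_le_tsum (f : ℝ → ℝ≥0∞) :
    ∫⁻ u, f u ∂m ≤ ∑' j : ℕ, ∫⁻ u in Ioc (j : ℝ) (j + 1), f u ∂m := by
  have h : m.restrict (⋃ j : ℕ, Ioc (j : ℝ) (j + 1)) = m := by
    rw [Measure.restrict_restrict (MeasurableSet.iUnion fun j => measurableSet_Ioc),
      inter_eq_right.2 Ioi_subset_iUnion]
  conv_lhs => rw [← h]
  exact lintegral_iUnion_le _ _

theorem wt_eq {j : ℕ} {u : ℝ} (hu : u ∈ Ioc (j : ℝ) (j + 1)) : wt u = 2⁻¹ ^ (j + 1) := by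
  rw [wt, (Nat.ceil_eq_iff (Nat.succ_ne_zero j)).2]
  simpa using hu

theorem mw_restrict {j : ℕ} {V : Set ℝ} (hV : MeasurableSet V) (hVj : V ⊆ Ioc (j : ℝ) (j + 1)) :
    mw.restrict V = (2⁻¹ ^ (j + 1) : ℝ≥0∞) • m.restrict V := by
  rw [mw, restrict_withDensity hV, ← withDensity_const]
  exact withDensity_congr_ae ((ae_restrict_iff' hV).2 (ae_of_all _ fun u hu => wt_eq (hVj hu)))

instance : IsFiniteMeasure mw := by
  constructor
  rw [mw, withDensity_apply _ MeasurableSet.univ, Measure.restrict_univ]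
  refine (lintegral_le_tsum wt).trans_lt ?_
  have h : ∀ j : ℕ, ∫⁻ u in Ioc (j : ℝ) (j + 1), wt u ∂m ≤ 2⁻¹ ^ (j + 1) := by
    intro j
    rw [setLIntegral_congr_fun measurableSet_Ioc fun u hu => wt_eq hu, setLIntegral_const]
    have : m (Ioc (j : ℝ) (j + 1)) ≤ 1 := by
      refine (Measure.restrict_apply_le _ _).trans ?_
      simp
    calc _ ≤ (2⁻¹ ^ (j + 1) : ℝ≥0∞) * 1 := by gcongr
      _ = _ := mul_one _
  refine (ENNReal.tsum_le_tsum h).trans_lt ?_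
  rw [ENNReal.tsum_geometric_add_one]
  simp [ENNReal.mul_lt_top_iff]

/-- On a unit interval the weight is constant, so weak convergence for the finite measure `mw` is
also weak convergence for `m` there. Passing to `mw` is needed because the Radon-Nikodym argument is
made for a finite measure. -/
theorem setIntegral_mw {j : ℕ} {V : Set ℝ} (hV : MeasurableSet V)
    (hVj : V ⊆ Ioc (j : ℝ) (j + 1)) (g : ℝ → ℝ) :
    ∫ u in V, g u ∂m = 2 ^ (j + 1) * ∫ u in V, g u ∂mw := by
  rw [mw_restrict hV hVj, integral_smul_measure, ENNReal.toReal_pow, ENNReal.toReal_inv, smul_eq_mul,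
    ← mul_assoc]
  simp

/-- Approximate the L₁ summand by a simple function, and add that bounded function to the L_∞
summand. -/
theorem exists_split (f : L1Linfty) {ε : ℝ≥0∞} (hε : ε ≠ 0) :
    ∃ a b : L1Linfty, f = a + b ∧ eLpNorm (a : L0) 1 m ≤ ε ∧ eLpNorm (b : L0) ∞ m < ∞ := by
  obtain ⟨g, hg, h, hh, hf⟩ := exists_add_eq f
  have hgm : MemLp g 1 m := memLp_one_iff_integrable.2 (mem_L1_iff.1 hg)
  obtain ⟨s, hs, hs1⟩ := hgm.exists_simpleFunc_eLpNorm_sub_lt ENNReal.one_ne_top hε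
  obtain ⟨C, hC⟩ := (s.finite_range.image (‖·‖)).bddAbove
  set S := ofBounded s s.measurable C fun u => hC (mem_image_of_mem _ (mem_range_self u))
  have hSc : (S : L0) =ᵐ[m] s := coe_ofBounded _ _ _ _
  refine ⟨f - (S + ⟨h, Submodule.mem_sup_right hh⟩), S + ⟨h, Submodule.mem_sup_right hh⟩, by abel,
    ?_, ?_⟩
  · have e1 : ((f - (S + ⟨h, Submodule.mem_sup_right hh⟩) : L1Linfty) : L0) = g - (S : L0) := by
      rw [Submodule.coe_sub, ← hf, Submodule.coe_add]; simp
    rw [e1]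
    have : (g - (S : L0) : L0) =ᵐ[m] (g : ℝ → ℝ) - s := by
      filter_upwards [AEEqFun.coeFn_sub g (S : L0), hSc] with u h1 h2
      rw [h1, Pi.sub_apply, h2, Pi.sub_apply]
    rw [eLpNorm_congr_ae this]
    exact hs.le
  · have : ((S + ⟨h, Submodule.mem_sup_right hh⟩ : L1Linfty) : L0) ∈ Linfty :=
      Submodule.add_mem _ (mk_mem_Linfty s.measurable fun u =>
        hC (mem_image_of_mem _ (mem_range_self u))) hh
    exact this

theorem ae_norm_le_of_eLpNorm_top {f : ℝ → ℝ} (h : eLpNorm f ∞ m ≠ ∞) :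
    ∀ᵐ u ∂m, |f u| ≤ (eLpNorm f ∞ m).toReal := by
  filter_upwards [ae_le_eLpNormEssSup (f := f) (μ := m)] with u hu
  rw [← eLpNorm_exponent_top] at hu
  have := ENNReal.toReal_mono h hu
  rwa [toReal_enorm] at this

theorem integrable_mw (f : L1Linfty) : Integrable (f : L0) mw := by
  obtain ⟨a, b, hf, ha, hb⟩ := exists_split f one_ne_zero
  have h1 : Integrable (a : L0) mw :=
    (mem_L1_iff.1 (show (a : L0) ∈ L1 from ha.trans_lt ENNReal.one_lt_top)).mono_measure mw_le
  have h2 : Integrable (b : L0) mw :=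
    Integrable.of_bound ((AEEqFun.aestronglyMeasurable (b : L0)).mono_ac mw_ac')
      _ (mw_ac'.ae_le (ae_norm_le_of_eLpNorm_top hb.ne))
  refine (h1.add h2).congr (mw_ac'.ae_le ?_)
  rw [hf, Submodule.coe_add]
  exact (AEEqFun.coeFn_add _ _).symm

/-- The right-hand side does not involve T: this is the uniform integrability of all images of f
that `exists_weak_limit` asks for. -/
theorem abs_setIntegral_mw_le {T : L1Linfty →ₗ[ℝ] L1Linfty} (hT : IsSubstochastic T)
    (f a b : L1Linfty) (hf : f = a + b) {ε : ℝ} (hε : 0 ≤ ε)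
    (ha : eLpNorm (a : L0) 1 m ≤ ENNReal.ofReal ε) (hb : eLpNorm (b : L0) ∞ m < ∞) (V : Set ℝ) :
    |∫ u in V, (T f : L0) u ∂mw| ≤ ε + (eLpNorm (b : L0) ∞ m).toReal * mw.real V := by
  have e : ∫ u in V, (T f : L0) u ∂mw = ∫ u in V, (T a : L0) u ∂mw + ∫ u in V, (T b : L0) u ∂mw := by
    rw [← integral_add (integrable_mw _).integrableOn (integrable_mw _).integrableOn, hf, map_add,
      Submodule.coe_add]
    exact integral_congr_ae (ae_restrict_of_ae (mw_ac'.ae_le (AEEqFun.coeFn_add _ _)))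
  rw [e]
  refine (abs_add_le _ _).trans (add_le_add ?_ ?_)
  · have h1 : ‖∫ u in V, (T a : L0) u ∂mw‖ₑ ≤ ENNReal.ofReal ε := by
      refine (enorm_integral_le_lintegral_enorm _).trans ?_
      refine le_trans ?_ ((hT.contr_one a).trans ha)
      rw [eLpNorm_one_eq_lintegral_enorm]
      exact lintegral_mono' (Measure.restrict_le_self.trans mw_le) le_rfl
    have := ENNReal.toReal_mono ENNReal.ofReal_ne_top h1
    rwa [toReal_enorm, ENNReal.toReal_ofReal hε] at this
  · have h2 : ∀ᵐ u ∂m, ‖(T b : L0) u‖ ≤ (eLpNorm (b : L0) ∞ m).toReal := by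
      filter_upwards [ae_norm_le_of_eLpNorm_top ((hT.contr_top b).trans_lt hb).ne] with u hu
      exact hu.trans (ENNReal.toReal_mono hb.ne (hT.contr_top b))
    exact norm_setIntegral_le_of_norm_le_const_ae (measure_lt_top mw V)
      (ae_restrict_of_ae (mw_ac'.ae_le h2))

/-- Take the weak limit of T k f for each f. Densities are determined almost everywhere by their
integrals, which gives linearity; positivity and the L_∞ bound are inequalities between integrals
over sets and survive the limit. The L₁ bound is checked on finitely many unit intervals at a time.
-/
theorem exists_limit_operator {K : Type*} (U : Ultrafilter K) (T : K → L1Linfty →ₗ[ℝ] L1Linfty)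
    (hT : ∀ k, IsSubstochastic (T k)) :
    ∃ T' : L1Linfty →ₗ[ℝ] L1Linfty, IsSubstochastic T' ∧ ∀ (f : L1Linfty) (j : ℕ) (V : Set ℝ),
      MeasurableSet V → V ⊆ Ioc (j : ℝ) (j + 1) →
      Tendsto (fun k => ∫ u in V, (T k f : L0) u ∂m) U (𝓝 (∫ u in V, (T' f : L0) u ∂m)) := by
  have hex : ∀ f : L1Linfty, ∃ g' : ℝ → ℝ, Measurable g' ∧ Integrable g' mw ∧
      ∀ V, MeasurableSet V →
      Tendsto (fun k => ∫ u in V, (T k f : L0) u ∂mw) U (𝓝 (∫ u in V, g' u ∂mw)) := by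
    intro f
    refine exists_weak_limit mw U (fun k => (T k f : L0)) (fun k => integrable_mw _) fun ε hε => ?_
    obtain ⟨a, b, hf, ha, hb⟩ := exists_split f (ε := ENNReal.ofReal ε) (by simpa using hε)
    exact ⟨_, ENNReal.toReal_nonneg, fun k V _ => abs_setIntegral_mw_le (hT k) f a b hf hε.le ha hb V⟩
  choose g hg hgi hgl using hex
  let R₀ : L1Linfty → L0 := fun f => AEEqFun.mk (g f) (hg f).aestronglyMeasurable
  have hR₀ : ∀ f, R₀ f =ᵐ[m] g f := fun f => AEEqFun.coeFn_mk _ _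
  let R : L1Linfty →ₗ[ℝ] L0 :=
    { toFun := R₀
      map_add' := fun f f' => by
        refine AEEqFun.ext ?_
        have h1 : g (f + f') =ᵐ[mw] g f + g f' := by
          refine Integrable.ae_eq_of_forall_setIntegral_eq _ _ (hgi _) ((hgi _).add (hgi _))
            fun V hV _ => ?_
          have h2 : ∫ u in V, (g f + g f') u ∂mw = ∫ u in V, g f u ∂mw + ∫ u in V, g f' u ∂mw :=
            integral_add (hgi f).integrableOn (hgi f').integrableOn
          rw [h2]
          refine tendsto_nhds_unique (hgl _ V hV) (((hgl f V hV).add (hgl f' V hV)).congr fun k => ?_)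
          rw [← integral_add (integrable_mw _).integrableOn (integrable_mw _).integrableOn, map_add,
            Submodule.coe_add]
          exact integral_congr_ae (ae_restrict_of_ae (mw_ac'.ae_le (AEEqFun.coeFn_add _ _).symm))
        filter_upwards [mw_ac.ae_le h1, hR₀ (f + f'), hR₀ f, hR₀ f',
          AEEqFun.coeFn_add (R₀ f) (R₀ f')] with u h1 h2 h3 h4 h5
        rw [h2, h1, h5, Pi.add_apply, Pi.add_apply, h3, h4]
      map_smul' := fun c f => by
        refine AEEqFun.ext ?_
        have h1 : g (c • f) =ᵐ[mw] c • g f := by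
          refine Integrable.ae_eq_of_forall_setIntegral_eq _ _ (hgi _) ((hgi _).smul c)
            fun V hV _ => ?_
          have h2 : ∫ u in V, (c • g f) u ∂mw = c • ∫ u in V, g f u ∂mw := integral_smul c _
          rw [h2]
          refine tendsto_nhds_unique (hgl _ V hV) (((hgl f V hV).const_smul c).congr fun k => ?_)
          rw [← integral_smul, map_smul, Submodule.coe_smul]
          exact integral_congr_ae (ae_restrict_of_ae (mw_ac'.ae_le
            (AEEqFun.coeFn_smul c ((T k f : L1Linfty) : L0)).symm))
        filter_upwards [mw_ac.ae_le h1, hR₀ (c • f), hR₀ f,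
          AEEqFun.coeFn_smul c (R₀ f)] with u h1 h2 h3 h5
        rw [h2, h1, RingHom.id_apply, h5, Pi.smul_apply, Pi.smul_apply, h3] }
  have hRg : ∀ f, R f =ᵐ[m] g f := hR₀
  have hloc : ∀ (f : L1Linfty) (j : ℕ) (V : Set ℝ), MeasurableSet V → V ⊆ Ioc (j : ℝ) (j + 1) →
      Tendsto (fun k => ∫ u in V, (T k f : L0) u ∂m) U (𝓝 (∫ u in V, g f u ∂m)) := by
    intro f j V hV hVj
    rw [setIntegral_mw hV hVj]
    exact ((hgl f V hV).const_mul _).congr fun k => (setIntegral_mw hV hVj _).symm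
  have hpos : ∀ f : L1Linfty, 0 ≤ (f : L0) → 0 ≤ R f := by
    intro f hf
    have h1 : 0 ≤ᵐ[mw] g f := by
      refine ae_nonneg_of_forall_setIntegral_nonneg (hgi f) fun V hV _ => ?_
      refine ge_of_tendsto' (hgl f V hV) fun k => ?_
      exact integral_nonneg_of_ae (ae_restrict_of_ae (mw_ac'.ae_le (coe_nonneg ((hT k).pos f hf))))
    refine nonneg_of_coe ?_
    filter_upwards [mw_ac.ae_le h1, hRg f] with u h1 h2
    rw [h2]; exact h1
  have htop : ∀ f : L1Linfty, eLpNorm (R f) ∞ m ≤ eLpNorm (f : L0) ∞ m := by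
    intro f
    rcases eq_or_ne (eLpNorm (f : L0) ∞ m) ∞ with h | h
    · rw [h]; exact le_top
    set c := (eLpNorm (f : L0) ∞ m).toReal
    have hk : ∀ k V, |∫ u in V, (T k f : L0) u ∂mw| ≤ c * mw.real V := fun k V => by
      have := abs_setIntegral_mw_le (hT k) f 0 f (by simp) le_rfl
        (by rw [Submodule.coe_zero, eLpNorm_congr_ae AEEqFun.coeFn_zero, eLpNorm_zero]; simp)
        h.lt_top V
      rwa [zero_add] at this
    have h1 : ∀ V, MeasurableSet V → |∫ u in V, g f u ∂mw| ≤ c * mw.real V := fun V hV =>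
      le_of_tendsto (hgl f V hV).abs (Eventually.of_forall fun k => hk k V)
    have h2 : g f ≤ᵐ[mw] fun _ => c := by
      refine ae_le_of_forall_setIntegral_le (hgi f) (integrable_const _) fun V hV _ => ?_
      rw [setIntegral_const, smul_eq_mul, mul_comm]
      exact (le_abs_self _).trans (h1 V hV)
    have h3 : (fun u => -g f u) ≤ᵐ[mw] fun _ => c := by
      refine ae_le_of_forall_setIntegral_le (hgi f).neg (integrable_const _) fun V hV _ => ?_
      rw [setIntegral_const, smul_eq_mul, mul_comm]
      refine le_trans ?_ (h1 V hV)
      rw [integral_neg]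
      exact neg_le_abs _
    rw [← ENNReal.ofReal_toReal h, eLpNorm_exponent_top]
    refine eLpNormEssSup_le_of_ae_bound ?_
    filter_upwards [mw_ac.ae_le h2, mw_ac.ae_le h3, hRg f] with u h2 h3 h4
    rw [h4, Real.norm_eq_abs, abs_le']
    exact ⟨h2, h3⟩
  have hone : ∀ f : L1Linfty, eLpNorm (R f) 1 m ≤ eLpNorm (f : L0) 1 m := by
    intro f
    rcases eq_or_ne (eLpNorm (f : L0) 1 m) ∞ with h | h
    · rw [h]; exact le_top
    set c := (eLpNorm (f : L0) 1 m).toReal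
    have hTi : ∀ k, Integrable (T k f : L0) m := fun k =>
      mem_L1_iff.1 (((hT k).contr_one f).trans_lt h.lt_top)
    have hTc : ∀ k, ∫ u, |(T k f : L0) u| ∂m ≤ c := fun k => by
      have h1 := ENNReal.toReal_mono h ((hT k).contr_one f)
      rw [eLpNorm_one_eq_lintegral_enorm, ← integral_norm_eq_lintegral_enorm
        (AEEqFun.aestronglyMeasurable _)] at h1
      exact h1
    -- Absolute values do not pass to weak limits, but ∫|g| over an interval equals the integral of
    -- g over its part in P minus that over its part off P, and those do.
    set P : Set ℝ := {u | 0 ≤ g f u}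
    have hP : MeasurableSet P := measurableSet_le measurable_const (hg f)
    set I : ℕ → Set ℝ := fun j => Ioc (j : ℝ) (j + 1)
    have hI : ∀ j, MeasurableSet (I j) := fun j => measurableSet_Ioc
    have hId : Pairwise (Function.onFun Disjoint I) := by
      rw [pairwise_disjoint_on]
      intro i j hij
      refine disjoint_left.2 fun u hi hj => ?_
      have : (i : ℝ) + 1 ≤ j := by exact_mod_cast hij
      exact (hi.2.trans this).not_gt hj.1
    have hgI : ∀ j, IntegrableOn (g f) (I j) m := fun j => by
      have h1 : IntegrableOn (g f) (I j) mw := (hgi f).integrableOn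
      rw [IntegrableOn, mw_restrict (hI j) subset_rfl, integrable_smul_measure (by simp)
        (by simp)] at h1
      exact h1
    have hsplit : ∀ j (w : ℝ → ℝ), IntegrableOn w (I j) m →
        ∫ u in I j ∩ P, w u ∂m - ∫ u in I j \ P, w u ∂m ≤ ∫ u in I j, |w u| ∂m := by
      intro j w hw
      rw [← integral_inter_add_sdiff hP hw.abs]
      have h1 := le_abs_self (∫ u in I j ∩ P, w u ∂m)
      have h2 := neg_le_abs (∫ u in I j \ P, w u ∂m)
      have h3 : |∫ u in I j ∩ P, w u ∂m| ≤ ∫ u in I j ∩ P, |w u| ∂m := abs_integral_le_integral_abs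
      have h4 : |∫ u in I j \ P, w u ∂m| ≤ ∫ u in I j \ P, |w u| ∂m := abs_integral_le_integral_abs
      linarith
    have hgabs : ∀ j, ∫ u in I j, |g f u| ∂m =
        ∫ u in I j ∩ P, g f u ∂m - ∫ u in I j \ P, g f u ∂m := by
      intro j
      rw [← integral_inter_add_sdiff hP (hgI j).abs, sub_eq_add_neg, ← integral_neg]
      congr 1
      · exact setIntegral_congr_fun ((hI j).inter hP) fun u hu => abs_of_nonneg hu.2
      · exact setIntegral_congr_fun ((hI j).diff hP) fun u hu => abs_of_neg (not_le.1 hu.2)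
    have hsum : ∀ J : ℕ, ∑ j ∈ Finset.range J, ∫ u in I j, |g f u| ∂m ≤ c := by
      intro J
      simp_rw [hgabs]
      refine le_of_tendsto (tendsto_finsetSum (Finset.range J) fun j _ =>
        (hloc f j (I j ∩ P) ((hI j).inter hP) inter_subset_left).sub
        (hloc f j (I j \ P) ((hI j).diff hP) sdiff_subset)) (Eventually.of_forall fun k => ?_)
      calc _ ≤ ∑ j ∈ Finset.range J, ∫ u in I j, |(T k f : L0) u| ∂m :=
            Finset.sum_le_sum fun j _ => hsplit j _ (hTi k).integrableOn
        _ = ∫ u in ⋃ j ∈ Finset.range J, I j, |(T k f : L0) u| ∂m :=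
            (integral_biUnion_finset _ (fun j _ => hI j) (fun i _ j _ hij => hId hij)
              fun j _ => (hTi k).abs.integrableOn).symm
        _ ≤ ∫ u, |(T k f : L0) u| ∂m :=
            setIntegral_le_integral (hTi k).abs (ae_of_all _ fun u => abs_nonneg _)
        _ ≤ c := hTc k
    rw [eLpNorm_one_eq_lintegral_enorm, ← ENNReal.ofReal_toReal h]
    refine (lintegral_le_tsum _).trans (ENNReal.tsum_le_of_sum_range_le fun J => ?_)
    refine le_trans (le_of_eq ?_) (ENNReal.ofReal_le_ofReal (hsum J))
    rw [ENNReal.ofReal_sum_of_nonneg fun j _ => integral_nonneg fun u => abs_nonneg _]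
    refine Finset.sum_congr rfl fun j _ => ?_
    have h1 : ∫ u in I j, |g f u| ∂m = ∫ u in I j, ‖g f u‖ ∂m := rfl
    rw [h1, ofReal_integral_norm_eq_lintegral_enorm (hgI j)]
    exact lintegral_congr_ae (ae_restrict_of_ae ((hRg f).mono fun u hu => by simp only [hu]))
  have hmem : ∀ f, R f ∈ L1Linfty := by
    intro f
    obtain ⟨a, b, hf, ha, hb⟩ := exists_split f one_ne_zero
    rw [hf, map_add]
    exact Submodule.add_mem_sup (show eLpNorm _ 1 m < ∞ from
      (hone a).trans_lt (ha.trans_lt ENNReal.one_lt_top))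
      (show eLpNorm _ ∞ m < ∞ from (htop b).trans_lt hb)
  refine ⟨R.codRestrict L1Linfty hmem, ⟨hpos, hone, htop⟩, fun f j V hV hVj => ?_⟩
  have e : ∫ u in V, ((R.codRestrict L1Linfty hmem f : L1Linfty) : L0) u ∂m = ∫ u in V, g f u ∂m :=
    integral_congr_ae (ae_restrict_of_ae (hRg f))
  rw [e]
  exact hloc f j V hV hVj

/-! ### Description of the orbit -/

theorem m_restrict_iUnion : m.restrict (⋃ j : ℕ, Ioc (j : ℝ) (j + 1)) = m := by
  rw [Measure.restrict_restrict (MeasurableSet.iUnion fun j => measurableSet_Ioc),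
    inter_eq_right.2 Ioi_subset_iUnion]

/-- Write f = (f - c)⁺ + min(f, c). The image of the bounded part stays below c, so (Tf - c)⁺ is at
most |T((f - c)⁺)|, and T contracts the L₁ norm. -/
theorem exc_apply_le {T : L1Linfty →ₗ[ℝ] L1Linfty} (hT : IsSubstochastic T) {f : L1Linfty}
    (hf : 0 ≤ (f : L0)) (hf1 : (f : L0) ∈ L1) {c : ℝ} (hc : 0 ≤ c) :
    exc (T f : L0) c ≤ exc (f : L0) c := by
  obtain ⟨g, hg, hg0, hfg⟩ := exists_measurable_nonneg_rep hf
  have hgi : Integrable g m := (mem_L1_iff.1 hf1).congr hfg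
  have hai : Integrable (fun u => max (g u - c) 0) m := by
    refine hgi.mono' ((hg.sub_const c).max measurable_const).aestronglyMeasurable
      (ae_of_all _ fun u => ?_)
    rw [Real.norm_of_nonneg (le_max_right _ _)]
    exact max_le (by linarith) (hg0 u)
  have hbm : ∀ u, |min (g u) c| ≤ c := fun u => by
    rw [abs_of_nonneg (le_min (hg0 u) hc)]
    exact min_le_right _ _
  set a := ofIntegrable _ hai
  set b := ofBounded (fun u => min (g u) c) (hg.min measurable_const) c hbm
  have ha : (a : L0) =ᵐ[m] fun u => max (g u - c) 0 := coe_ofIntegrable _ _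
  have hb : (b : L0) =ᵐ[m] fun u => min (g u) c := coe_ofBounded _ _ _ _
  have hfab : f = a + b := by
    refine Subtype.ext (AEEqFun.ext ?_)
    rw [Submodule.coe_add]
    filter_upwards [ha, hb, hfg, AEEqFun.coeFn_add (a : L0) (b : L0)] with u h1 h2 h3 h4
    rw [h4, Pi.add_apply, h1, h2, h3]
    rcases le_total (g u) c with h | h
    · rw [max_eq_right (by linarith), min_eq_left h, zero_add]
    · rw [max_eq_left (by linarith), min_eq_right h, sub_add_cancel]
  have hTb : ∀ᵐ u ∂m, (T b : L0) u ≤ c := by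
    have h1 : eLpNorm (b : L0) ∞ m ≤ ENNReal.ofReal c := by
      rw [eLpNorm_exponent_top]
      refine eLpNormEssSup_le_of_ae_bound ?_
      filter_upwards [hb] with u hu
      rw [hu]; exact hbm u
    have h2 := (hT.contr_top b).trans h1
    filter_upwards [ae_norm_le_of_eLpNorm_top (h2.trans_lt ENNReal.ofReal_lt_top).ne] with u hu
    refine (le_abs_self _).trans (hu.trans ?_)
    have := ENNReal.toReal_mono ENNReal.ofReal_ne_top h2
    rwa [ENNReal.toReal_ofReal hc] at this
  calc exc (T f : L0) c ≤ ∫⁻ u, ‖(T a : L0) u‖ₑ ∂m := by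
        refine lintegral_mono_ae ?_
        rw [hfab, map_add, Submodule.coe_add]
        filter_upwards [hTb, AEEqFun.coeFn_add (T a : L0) (T b : L0)] with u h1 h2
        rw [h2, Pi.add_apply]
        refine le_trans (ENNReal.ofReal_le_ofReal ?_) (Real.ofReal_le_enorm ((T a : L0) u))
        linarith
    _ ≤ ∫⁻ u, ‖(a : L0) u‖ₑ ∂m := by
        have := hT.contr_one a
        rwa [eLpNorm_one_eq_lintegral_enorm, eLpNorm_one_eq_lintegral_enorm] at this
    _ = exc (f : L0) c := by
        refine lintegral_congr_ae ?_
        filter_upwards [ha, hfg] with u h1 h2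
        rw [h1, h2, Real.enorm_eq_ofReal (le_max_right _ _)]
        rcases le_total (g u - c) 0 with h | h
        · rw [max_eq_right h, ENNReal.ofReal_zero, ENNReal.ofReal_of_nonpos h]
        · rw [max_eq_left h]

/-- The approximate solutions are indexed by a finite family of sets of finite measure together with
a tolerance 1/(n + 1). Along an ultrafilter finer than `atTop` every set of finite measure is
eventually in the family, so the limit operator gives x the same integrals as y on pieces of unit
intervals. -/
theorem exists_substochastic_eq {x y : L0} (hx : 0 ≤ x) (hx1 : x ∈ L1) (hy : 0 ≤ y)
    (hy1 : y ∈ L1) (hyx : ∀ c, 0 ≤ c → exc y c ≤ exc x c) :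
    ∃ T, IsSubstochastic T ∧ (T ⟨x, mem_L1Linfty_of_mem_L1 hx1⟩ : L0) = y := by
  classical
  set X : L1Linfty := ⟨x, mem_L1Linfty_of_mem_L1 hx1⟩
  let Fam := {B : Set ℝ // MeasurableSet B ∧ m B ≠ ∞}
  have happ : ∀ k : Finset Fam × ℕ, ∃ S, IsSubstochastic S ∧ ∀ i : k.1,
      |∫ u in i.1.1, (S X : L0) u ∂m - ∫ u in i.1.1, y u ∂m| < 1 / ((k.2 : ℝ) + 1) := fun k =>
    exists_substochastic_approx hx hx1 hy hy1 hyx (fun i : k.1 => i.1.1) (fun i => i.1.2.1)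
      (fun i => i.1.2.2) (by positivity)
  choose S hS hSy using happ
  obtain ⟨T, hT, hTl⟩ := exists_limit_operator (Ultrafilter.of atTop) S hS
  refine ⟨T, hT, AEEqFun.ext ?_⟩
  have hTi : Integrable (T X : L0) m := mem_L1_iff.1 ((hT.contr_one X).trans_lt
    (show eLpNorm x 1 m < ∞ from hx1))
  have hset : ∀ (j : ℕ) (V : Set ℝ), MeasurableSet V → V ⊆ Ioc (j : ℝ) (j + 1) →
      ∫ u in V, (T X : L0) u ∂m = ∫ u in V, y u ∂m := by
    intro j V hV hVj
    have hVf : m V ≠ ∞ := by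
      refine ((measure_mono hVj).trans_lt ((Measure.restrict_apply_le _ _).trans_lt ?_)).ne
      simp
    refine tendsto_nhds_unique (hTl X j V hV hVj) ?_
    refine Tendsto.mono_left ?_ (Ultrafilter.of_le (atTop : Filter (Finset Fam × ℕ)))
    rw [Metric.tendsto_nhds]
    intro ε hε
    obtain ⟨n, hn⟩ := exists_nat_one_div_lt hε
    filter_upwards [Ici_mem_atTop (({⟨V, hV, hVf⟩}, n) : Finset Fam × ℕ)] with k hk
    have hmem : (⟨V, hV, hVf⟩ : Fam) ∈ k.1 := hk.1 (Finset.mem_singleton_self _)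
    refine (hSy k ⟨_, hmem⟩).trans (lt_of_le_of_lt ?_ hn)
    have : (n : ℝ) ≤ k.2 := Nat.cast_le.2 hk.2
    exact one_div_le_one_div_of_le (by positivity) (by linarith)
  have hj : ∀ j : ℕ, ∀ᵐ u ∂m.restrict (Ioc (j : ℝ) (j + 1)), (T X : L0) u = y u := by
    intro j
    refine Integrable.ae_eq_of_forall_setIntegral_eq _ _ hTi.integrableOn
      (mem_L1_iff.1 hy1).integrableOn fun V hV _ => ?_
    rw [Measure.restrict_restrict hV]
    exact hset j _ (hV.inter measurableSet_Ioc) inter_subset_right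
  have := (ae_restrict_iUnion_iff _ _).2 hj
  rwa [m_restrict_iUnion] at this

theorem mem_OmegaPlus_iff {x y : L0} (hx : 0 ≤ x) (hx1 : x ∈ L1) :
    y ∈ OmegaPlus x ↔ 0 ≤ y ∧ y ∈ L1 ∧ ∀ c, 0 ≤ c → exc y c ≤ exc x c := by
  constructor
  · rintro ⟨T, hT, f, rfl, rfl⟩
    exact ⟨hT.pos f hx, (hT.contr_one f).trans_lt hx1, fun c hc => exc_apply_le hT hx hx1 hc⟩
  · rintro ⟨hy, hy1, hyx⟩
    obtain ⟨T, hT, h⟩ := exists_substochastic_eq hx hx1 hy hy1 hyx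
    exact ⟨T, hT, _, rfl, h.symm⟩

/-! ### Extreme points of the orbit -/

/-- The real-valued version of `exc`. -/
def excR (f : ℝ → ℝ) (c : ℝ) : ℝ := ∫ u, max (f u - c) 0 ∂m

theorem integrable_max_sub {f : ℝ → ℝ} (hf : Integrable f m) {c : ℝ} (hc : 0 ≤ c) :
    Integrable (fun u => max (f u - c) 0) m := by
  refine hf.mono ((hf.aestronglyMeasurable.sub aestronglyMeasurable_const).sup
    aestronglyMeasurable_const) (ae_of_all _ fun u => ?_)
  rw [Real.norm_of_nonneg (le_max_right _ _), Real.norm_eq_abs]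
  exact max_le (by linarith [le_abs_self (f u)]) (abs_nonneg _)

theorem excR_nonneg (f : ℝ → ℝ) (c : ℝ) : 0 ≤ excR f c :=
  integral_nonneg fun _ => le_max_right _ _

theorem exc_eq_ofReal_excR {f : ℝ → ℝ} (hf : Integrable f m) {c : ℝ} (hc : 0 ≤ c) :
    exc f c = ENNReal.ofReal (excR f c) := by
  rw [excR, ofReal_integral_eq_lintegral_ofReal (integrable_max_sub hf hc)
    (ae_of_all _ fun _ => le_max_right _ _)]
  refine lintegral_congr fun u => ?_
  rcases le_total (f u - c) 0 with h | h
  · rw [max_eq_right h, ENNReal.ofReal_zero, ENNReal.ofReal_of_nonpos h]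
  · rw [max_eq_left h]

theorem mem_OmegaPlus_iff_excR {x y : L0} (hx : 0 ≤ x) (hx1 : x ∈ L1) :
    y ∈ OmegaPlus x ↔ 0 ≤ᵐ[m] y ∧ Integrable y m ∧ ∀ c, 0 ≤ c → excR y c ≤ excR x c := by
  rw [mem_OmegaPlus_iff hx hx1, mem_L1_iff]
  refine ⟨fun ⟨h0, h1, h⟩ => ⟨coe_nonneg h0, h1, fun c hc => ?_⟩,
    fun ⟨h0, h1, h⟩ => ⟨nonneg_of_coe h0, h1, fun c hc => ?_⟩⟩
  · have := h c hc
    rwa [exc_eq_ofReal_excR h1 hc, exc_eq_ofReal_excR (mem_L1_iff.1 hx1) hc,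
      ENNReal.ofReal_le_ofReal_iff (excR_nonneg _ _)] at this
  · rw [exc_eq_ofReal_excR h1 hc, exc_eq_ofReal_excR (mem_L1_iff.1 hx1) hc]
    exact ENNReal.ofReal_le_ofReal (h c hc)

theorem excR_congr {f g : ℝ → ℝ} (h : f =ᵐ[m] g) (c : ℝ) : excR f c = excR g c :=
  integral_congr_ae (h.mono fun u hu => by simp only [hu])

/-! ### A sufficient condition for extremality -/

theorem max_convex_le {a b α β c : ℝ} (ha : 0 ≤ a) (hb : 0 ≤ b) (hab : a + b = 1) :
    max (a * α + b * β - c) 0 ≤ a * max (α - c) 0 + b * max (β - c) 0 := by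
  refine max_le ?_ (by positivity)
  have h : a * α + b * β - c = a * (α - c) + b * (β - c) := by
    linear_combination c * hab
  rw [h]
  gcongr <;> exact le_max_left _ _

/-- The convexity inequality for t ↦ (t - c)⁺ is strict when c lies strictly between α and β.
Equality at all levels q + r therefore leaves no room for a level above q between them. -/
theorem le_of_max_convex_eq {a b α β q : ℝ} (ha : 0 < a) (hb : 0 < b) (hab : a + b = 1)
    (h : ∀ r : ℚ, 0 ≤ r → max (a * α + b * β - (q + r)) 0 =
      a * max (α - (q + r)) 0 + b * max (β - (q + r)) 0) (hlt : α < β) : β ≤ q := by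
  by_contra! hq
  obtain ⟨r, hr1, hr2⟩ := exists_rat_btwn (show max α q - q < β - q by
    simpa using ⟨hlt, hq⟩)
  have h1 : α < q + r := by linarith [le_max_left α q]
  have h2 : 0 < (r : ℝ) := by linarith [le_max_right α q]
  have h3 := h r (by exact_mod_cast h2.le)
  rw [max_eq_right (a := α - (q + r)) (by linarith), max_eq_left (a := β - (q + r)) (by linarith),
    mul_zero, zero_add] at h3
  rcases max_choice (a * α + b * β - (q + r)) 0 with h4 | h4
  · rw [h4] at h3
    have : a * (α - (q + r)) = 0 := by linear_combination h3 - (q + r) * hab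
    rcases mul_eq_zero.1 this with h5 | h5 <;> linarith
  · have h6 : a * α + b * β - (q + r) ≤ 0 := by rw [← h4]; exact le_max_left _ _
    rw [h4] at h3
    rcases mul_eq_zero.1 h3.symm with h5 | h5
    · linarith
    · linarith

/-- If α ≠ β, both are at most q. A mean equal to 0 forces both to be 0, and a mean at least q
forces both to be q. -/
theorem eq_of_max_convex_eq {a b α β q : ℝ} (ha : 0 < a) (hb : 0 < b) (hab : a + b = 1)
    (hα : 0 ≤ α) (hβ : 0 ≤ β) (hz : a * α + b * β = 0 ∨ q ≤ a * α + b * β)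
    (h : ∀ r : ℚ, 0 ≤ r → max (a * α + b * β - (q + r)) 0 =
      a * max (α - (q + r)) 0 + b * max (β - (q + r)) 0) : α = β := by
  by_contra hne
  have hle : α ≤ q ∧ β ≤ q := by
    rcases lt_or_gt_of_ne hne with hlt | hlt
    · have := le_of_max_convex_eq ha hb hab h hlt
      exact ⟨hlt.le.trans this, this⟩
    · have := le_of_max_convex_eq hb ha (by linarith)
        (fun r hr => by rw [add_comm (b * β), h r hr, add_comm]) hlt
      exact ⟨this, hlt.le.trans this⟩
  refine hne ?_
  rcases hz with hz | hz
  · have h1 : 0 ≤ a * α := by positivity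
    have h2 : 0 ≤ b * β := by positivity
    have h3 : a * α = 0 := by linarith
    have h4 : b * β = 0 := by linarith
    rw [(mul_eq_zero.1 h3).resolve_left ha.ne', (mul_eq_zero.1 h4).resolve_left hb.ne']
  · have h1 : a * α ≤ a * q := by gcongr; exact hle.1
    have h2 : b * β ≤ b * q := by gcongr; exact hle.2
    have h3 : a * q + b * q = q := by rw [← add_mul, hab, one_mul]
    have h4 : a * α = a * q := by linarith
    have h5 : b * β = b * q := by linarith
    rw [mul_left_cancel₀ ha.ne' h4, mul_left_cancel₀ hb.ne' h5]

/-- If z = a z₁ + b z₂, then for c ≥ q the value exc x(c) = exc z(c) is at most a exc z₁(c) + b exc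
z₂(c), which is at most exc x(c). So the pointwise convexity inequality is an equality almost
everywhere, and the preceding lemma gives z₁ = z₂ pointwise. -/
theorem mem_extremePoints_OmegaPlus {x z : L0} (hx : 0 ≤ x) (hx1 : x ∈ L1)
    (hz : z ∈ OmegaPlus x) {q : ℝ} (hq : 0 ≤ q) (heq : ∀ c, q ≤ c → excR z c = excR x c)
    (hzq : ∀ᵐ u ∂m, z u = 0 ∨ q ≤ z u) : z ∈ extremePoints ℝ (OmegaPlus x) := by
  refine mem_extremePoints_iff_left.2 ⟨hz, ?_⟩
  rintro z₁ hz₁ z₂ hz₂ ⟨a, b, ha, hb, hab, rfl⟩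
  rw [mem_OmegaPlus_iff_excR hx hx1] at hz hz₁ hz₂
  have hcoe : ((a • z₁ + b • z₂ : L0) : ℝ → ℝ) =ᵐ[m] fun u => a * z₁ u + b * z₂ u := by
    filter_upwards [AEEqFun.coeFn_add (a • z₁) (b • z₂), AEEqFun.coeFn_smul a z₁,
      AEEqFun.coeFn_smul b z₂] with u h1 h2 h3
    rw [h1, Pi.add_apply, h2, h3]; rfl
  -- Rational shifts keep the union of the exceptional null sets countable.
  have hall : ∀ᵐ u ∂m, ∀ r : ℚ, 0 ≤ r → max (a * z₁ u + b * z₂ u - (q + r)) 0 =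
      a * max (z₁ u - (q + r)) 0 + b * max (z₂ u - (q + r)) 0 := by
    refine ae_all_iff.2 fun r => ?_
    by_cases hr : 0 ≤ r
    swap
    · exact ae_of_all _ fun u h => absurd h hr
    have hr' : (0 : ℝ) ≤ r := by exact_mod_cast hr
    have hc : 0 ≤ q + r := by linarith
    have hi := integrable_max_sub (hz.2.1.congr hcoe) hc
    have hi1 := (integrable_max_sub hz₁.2.1 hc).const_mul a
    have hi2 := (integrable_max_sub hz₂.2.1 hc).const_mul b
    have hle : (fun u => max (a * z₁ u + b * z₂ u - (q + r)) 0) ≤ᵐ[m]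
        fun u => a * max (z₁ u - (q + r)) 0 + b * max (z₂ u - (q + r)) 0 :=
      ae_of_all _ fun u => max_convex_le ha.le hb.le hab
    have h := (integral_eq_iff_of_ae_le hi (hi1.add hi2) hle).1 (le_antisymm
      (integral_mono_ae hi (hi1.add hi2) hle) ?_)
    · filter_upwards [h] with u hu _ using hu
    · have e1 : ∫ u, max (a * z₁ u + b * z₂ u - (q + r)) 0 ∂m = excR x (q + r) := by
        rw [← heq _ (by linarith)]
        exact (excR_congr hcoe _).symm
      have e2 := integral_add hi1 hi2
      simp only [Pi.add_apply]
      rw [e1, e2, integral_const_mul, integral_const_mul]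
      have h1 : a * excR z₁ (q + r) ≤ a * excR x (q + r) := by gcongr; exact hz₁.2.2 _ hc
      have h2 : b * excR z₂ (q + r) ≤ b * excR x (q + r) := by gcongr; exact hz₂.2.2 _ hc
      have h3 : a * excR x (q + r) + b * excR x (q + r) = excR x (q + r) := by
        rw [← add_mul, hab, one_mul]
      simp only [excR] at h1 h2 h3 ⊢
      linarith
  refine AEEqFun.ext ?_
  filter_upwards [hall, hcoe, hzq, hz₁.1, hz₂.1] with u h1 h2 h3 h4 h5
  rw [h2] at h3 ⊢
  have := eq_of_max_convex_eq ha hb hab h4 h5 h3 h1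
  rw [← this, ← add_mul, hab, one_mul]

theorem zero_mem_OmegaPlus {x : L0} (hx : 0 ≤ x) (hx1 : x ∈ L1) : 0 ∈ OmegaPlus x := by
  rw [mem_OmegaPlus_iff_excR hx hx1]
  have h0 := AEEqFun.coeFn_zero (α := ℝ) (β := ℝ) (μ := m)
  refine ⟨coe_nonneg le_rfl, (integrable_zero _ _ _).congr h0.symm, fun c hc => ?_⟩
  rw [excR_congr h0]
  refine le_of_eq_of_le ?_ (excR_nonneg _ _)
  rw [excR]
  simp [hc]

theorem zero_mem_extremePoints_OmegaPlus {x : L0} (hx : 0 ≤ x) (hx1 : x ∈ L1) :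
    0 ∈ extremePoints ℝ (OmegaPlus x) := by
  refine mem_extremePoints_iff_left.2 ⟨zero_mem_OmegaPlus hx hx1, ?_⟩
  rintro z₁ hz₁ z₂ hz₂ ⟨a, b, ha, hb, hab, h⟩
  rw [mem_OmegaPlus_iff hx hx1] at hz₁ hz₂
  refine AEEqFun.ext ?_
  filter_upwards [AEEqFun.coeFn_add (a • z₁) (b • z₂), AEEqFun.coeFn_smul a z₁,
    AEEqFun.coeFn_smul b z₂, coe_nonneg hz₁.1, coe_nonneg hz₂.1,
    AEEqFun.coeFn_zero (α := ℝ) (β := ℝ) (μ := m)] with u h1 h2 h3 h4 h5 h6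
  rw [h, Pi.add_apply, h2, h3, h6] at h1
  rw [h6]
  simp only [Pi.smul_apply, smul_eq_mul, Pi.zero_apply] at *
  have := mul_nonneg ha.le h4
  have := mul_nonneg hb.le h5
  have h7 : a * z₁ u = 0 := by linarith
  exact (mul_eq_zero.1 h7).resolve_left ha.ne'

/-! ### A necessary condition for extremality -/

theorem continuousOn_excR {f : ℝ → ℝ} (hf : Integrable f m) : ContinuousOn (excR f) (Ici 0) := by
  refine continuousOn_of_dominated (bound := fun u => |f u|) (fun c hc => ?_) (fun c hc => ?_)
    hf.abs (ae_of_all _ fun u => by fun_prop)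
  · exact (integrable_max_sub hf hc).aestronglyMeasurable
  · refine ae_of_all _ fun u => ?_
    have hc' : (0 : ℝ) ≤ c := hc
    rw [Real.norm_of_nonneg (le_max_right _ _)]
    exact max_le (by linarith [le_abs_self (f u)]) (abs_nonneg _)

theorem meas_le_ne_top {f : ℝ → ℝ} (hf : Integrable f m) {p : ℝ} (hp : 0 < p) :
    m {u | p ≤ f u} ≠ ∞ := by
  refine measure_ne_top_of_subset (fun u hu => ?_) (hf.measure_norm_ge_lt_top hp).ne
  have hu' : p ≤ f u := hu
  exact hu'.trans (le_abs_self _)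

/-- Where the constraint exc z ≤ exc x is slack, z can be perturbed: if its values lay in (p, q) on
a set of positive measure, then z ± w with a small w of integral 0 supported there would both stay
in the orbit, and z is their midpoint. -/
theorem measure_Ioo_preimage_eq_zero {x z : L0} (hx : 0 ≤ x) (hx1 : x ∈ L1)
    (hz : z ∈ extremePoints ℝ (OmegaPlus x)) {p q : ℝ} (hp : 0 < p)
    (hlt : ∀ c ∈ Icc p q, excR z c < excR x c) : m {u | p < z u ∧ z u < q} = 0 := by
  have hzΩ := (mem_OmegaPlus_iff_excR hx hx1).1 hz.1
  have hxi := mem_L1_iff.1 hx1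
  have hzm : Measurable z := AEEqFun.measurable z
  have hU : {u | p < z u ∧ z u < q} ⊆
      ⋃ n : ℕ, {u | p + 1 / ((n : ℝ) + 1) ≤ z u ∧ z u ≤ q - 1 / ((n : ℝ) + 1)} := by
    rintro u ⟨h1, h2⟩
    obtain ⟨n, hn⟩ := exists_nat_one_div_lt (show 0 < min (z u - p) (q - z u) from
      lt_min (by linarith) (by linarith))
    have := lt_min_iff.1 hn
    exact mem_iUnion.2 ⟨n, by linarith, by linarith⟩
  refine measure_mono_null hU (measure_iUnion_null fun n => ?_)
  set η := 1 / ((n : ℝ) + 1) with hη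
  have hη0 : 0 < η := by positivity
  set D := {u | p + η ≤ z u ∧ z u ≤ q - η} with hD
  by_contra hD0
  have hDm : MeasurableSet D :=
    (measurableSet_le measurable_const hzm).inter (measurableSet_le hzm measurable_const)
  have hDf : m D ≠ ∞ := measure_ne_top_of_subset (fun u hu => by
    have := hu.1; simp only [mem_ofPred_eq]; linarith) (meas_le_ne_top hzΩ.2.1 hp)
  have hpq : p ≤ q := by
    obtain ⟨u, hu⟩ := nonempty_of_measure_ne_zero hD0
    linarith [hu.1, hu.2]
  obtain ⟨c₀, hc₀, hmin⟩ := (isCompact_Icc (a := p) (b := q)).exists_isMinOn (nonempty_Icc.2 hpq)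
    (f := fun c => excR x c - excR z c) (((continuousOn_excR hxi).sub
      (continuousOn_excR hzΩ.2.1)).mono fun c hc => hp.le.trans hc.1)
  set δ := excR x c₀ - excR z c₀ with hδ
  have hδ0 : 0 < δ := sub_pos.2 (hlt c₀ hc₀)
  have hD0' : 0 < m.real D := ENNReal.toReal_pos hD0 hDf
  -- Half of D is raised by ε and the other half lowered by ε.
  obtain ⟨C, hC, -, hCD, hCm⟩ := exists_between_measure_eq MeasurableSet.empty hDm
    (empty_subset D) (s := m D / 2) (ENNReal.div_ne_top hDf (by simp)) (by simp)
    ENNReal.half_le_self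
  -- The bound η keeps the perturbed values on D inside [p, q], so `excR` is unchanged at levels
  -- below p and above q. The bound δ / m(D) keeps the change at levels in between below the
  -- smallest gap δ.
  set ε := min η (δ / m.real D) with hε
  have hε0 : 0 < ε := lt_min hη0 (by positivity)
  set w : ℝ → ℝ := fun u => C.indicator (fun _ => ε) u - (D \ C).indicator (fun _ => ε) u with hw
  have hCf : m C ≠ ∞ := measure_ne_top_of_subset hCD hDf
  have hi1 : Integrable (C.indicator fun _ => ε) m := (integrable_indicator_iff hC).2
    (integrableOn_const hCf)
  have hi2 : Integrable ((D \ C).indicator fun _ => ε) m :=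
    (integrable_indicator_iff (hDm.diff hC)).2
      (integrableOn_const (measure_ne_top_of_subset sdiff_subset hDf))
  have hwi : Integrable w m := hi1.sub hi2
  have hCr : m.real C = m.real D / 2 := by
    simp only [Measure.real, hCm, ENNReal.toReal_div, ENNReal.toReal_ofNat]
  have hw0 : ∫ u, w u ∂m = 0 := by
    rw [hw, integral_sub hi1 hi2, integral_indicator hC, integral_indicator (hDm.diff hC),
      setIntegral_const, setIntegral_const, measureReal_sdiff hCD hC hDf, hCr]
    simp only [smul_eq_mul]; ring
  have hwD : ∀ u ∉ D, w u = 0 := fun u hu => by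
    simp [hw, hu, show u ∉ C from fun h => hu (hCD h)]
  have hwC : ∀ u ∈ C, w u = ε := fun u hu => by simp [hw, hu]
  have hwε : ∀ u ∈ D, |w u| = ε := fun u hu => by
    by_cases h : u ∈ C
    · simp [hw, hu, h, hε0.le]
    · simp [hw, hu, h, hε0.le]
  have hwabs : ∫ u, |w u| ∂m ≤ δ := by
    have : (fun u => |w u|) = D.indicator fun _ => ε := by
      ext u
      by_cases h : u ∈ D
      · rw [indicator_of_mem h, hwε u h]
      · rw [indicator_of_notMem h, hwD u h, abs_zero]
    rw [this, integral_indicator hDm, setIntegral_const, smul_eq_mul]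
    calc m.real D * ε ≤ m.real D * (δ / m.real D) := by gcongr; exact min_le_right _ _
      _ = δ := by field_simp
  have key : ∀ σ : ℝ, |σ| = 1 → AEEqFun.mk (fun u => z u + σ * w u)
      (hzΩ.2.1.add (hwi.const_mul σ)).aestronglyMeasurable ∈ OmegaPlus x := by
    intro σ hσ
    have hσi := hwi.const_mul σ
    have hc' := AEEqFun.coeFn_mk (fun u => z u + σ * w u) (hzΩ.2.1.add hσi).aestronglyMeasurable
    have hb : ∀ u ∈ D, |σ * w u| ≤ η := fun u hu => by
      rw [abs_mul, hσ, one_mul, hwε u hu]; exact min_le_left _ _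
    rw [mem_OmegaPlus_iff_excR hx hx1]
    refine ⟨?_, (hzΩ.2.1.add hσi).congr hc'.symm, fun c hc => ?_⟩
    · filter_upwards [hc', hzΩ.1] with u h1 h2
      rw [h1]
      by_cases hu : u ∈ D
      · have := abs_le.1 (hb u hu)
        have := hu.1
        simp only [Pi.zero_apply]; linarith
      · simpa [hwD u hu] using h2
    · rw [excR_congr hc']
      rcases le_total c p with hcp | hcp
      · have : excR (fun u => z u + σ * w u) c = excR z c := by
          have h1 : ∀ u, max (z u + σ * w u - c) 0 = max (z u - c) 0 + σ * w u := fun u => by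
            by_cases hu : u ∈ D
            · have := abs_le.1 (hb u hu)
              have := hu.1
              rw [max_eq_left (by linarith), max_eq_left (by linarith)]; ring
            · simp [hwD u hu]
          simp only [excR, h1]
          rw [integral_add (integrable_max_sub hzΩ.2.1 hc) hσi, integral_const_mul, hw0, mul_zero,
            add_zero]
        rw [this]; exact hzΩ.2.2 c hc
      rcases le_total q c with hcq | hcq
      · have : excR (fun u => z u + σ * w u) c = excR z c := by
          refine integral_congr_ae (ae_of_all _ fun u => ?_)
          by_cases hu : u ∈ D
          · have := abs_le.1 (hb u hu)
            have := hu.2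
            simp only
            rw [max_eq_right (by linarith), max_eq_right (by linarith)]
          · simp [hwD u hu]
        rw [this]; exact hzΩ.2.2 c hc
      · have h1 : excR (fun u => z u + σ * w u) c ≤ excR z c + ∫ u, |w u| ∂m := by
          rw [excR, excR, ← integral_add (integrable_max_sub hzΩ.2.1 hc) hwi.abs]
          refine integral_mono (integrable_max_sub (hzΩ.2.1.add hσi) hc)
            ((integrable_max_sub hzΩ.2.1 hc).add hwi.abs) fun u => ?_
          have h2 : σ * w u ≤ |w u| := by
            have := le_abs_self (σ * w u)
            rwa [abs_mul, hσ, one_mul] at this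
          refine max_le ?_ (by positivity)
          have := le_max_left (z u - c) 0
          simp only; linarith
        have h2 : δ ≤ excR x c - excR z c := hmin ⟨hcp, hcq⟩
        linarith
  have hz1 := (mem_extremePoints_iff_left.1 hz).2 _ (key 1 (by simp)) _ (key (-1) (by simp)) ?_
  · have hc' := AEEqFun.coeFn_mk (fun u => z u + 1 * w u)
      (hzΩ.2.1.add (hwi.const_mul 1)).aestronglyMeasurable
    rw [hz1] at hc'
    have hC0 : m C = 0 := by
      refine measure_mono_null (fun u hu => ?_) hc'
      simp only [mem_compl_iff, mem_ofPred_eq, hwC u hu]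
      intro h; linarith
    rw [hCm] at hC0
    exact hD0 (by simpa using hC0)
  · refine ⟨1 / 2, 1 / 2, by norm_num, by norm_num, by norm_num, AEEqFun.ext ?_⟩
    filter_upwards [AEEqFun.coeFn_add ((1 / 2 : ℝ) • AEEqFun.mk (fun u => z u + 1 * w u)
      (hzΩ.2.1.add (hwi.const_mul 1)).aestronglyMeasurable)
        ((1 / 2 : ℝ) • AEEqFun.mk (fun u => z u + -1 * w u)
      (hzΩ.2.1.add (hwi.const_mul (-1))).aestronglyMeasurable),
      AEEqFun.coeFn_smul (1 / 2 : ℝ) (AEEqFun.mk (fun u => z u + 1 * w u)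
        (hzΩ.2.1.add (hwi.const_mul 1)).aestronglyMeasurable),
      AEEqFun.coeFn_smul (1 / 2 : ℝ) (AEEqFun.mk (fun u => z u + -1 * w u)
        (hzΩ.2.1.add (hwi.const_mul (-1))).aestronglyMeasurable),
      AEEqFun.coeFn_mk (fun u => z u + 1 * w u)
        (hzΩ.2.1.add (hwi.const_mul 1)).aestronglyMeasurable,
      AEEqFun.coeFn_mk (fun u => z u + -1 * w u)
        (hzΩ.2.1.add (hwi.const_mul (-1))).aestronglyMeasurable] with u h1 h2 h3 h4 h5
    rw [h1, Pi.add_apply, h2, h3, Pi.smul_apply, Pi.smul_apply, h4, h5]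
    simp only [smul_eq_mul]; ring

theorem measure_Ioi_preimage_eq_zero {x z : L0} (hx : 0 ≤ x) (hx1 : x ∈ L1)
    (hz : z ∈ extremePoints ℝ (OmegaPlus x)) {p : ℝ} (hp : 0 ≤ p)
    (hlt : ∀ c, p < c → excR z c < excR x c) : m {u | p < z u} = 0 := by
  have hU : {u | p < z u} ⊆
      ⋃ n : ℕ, {u | p + 1 / ((n : ℝ) + 1) < z u ∧ z u < n} := by
    intro u hu
    have hu' : 0 < z u - p := sub_pos.2 hu
    obtain ⟨n, hn⟩ := exists_nat_one_div_lt hu'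
    obtain ⟨k, hk⟩ := exists_nat_gt (z u)
    refine mem_iUnion.2 ⟨max n k, ?_, ?_⟩
    · have : (n : ℝ) ≤ (max n k : ℕ) := by exact_mod_cast le_max_left n k
      have := one_div_le_one_div_of_le (by positivity) (show (n : ℝ) + 1 ≤ (max n k : ℕ) + 1 by
        linarith)
      linarith
    · have : (k : ℝ) ≤ (max n k : ℕ) := by exact_mod_cast le_max_right n k
      linarith
  refine measure_mono_null hU (measure_iUnion_null fun n => ?_)
  have : 0 < 1 / ((n : ℝ) + 1) := by positivity
  exact measure_Ioo_preimage_eq_zero hx hx1 hz (by linarith) fun c hc => hlt c (by linarith [hc.1])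

theorem excR_le_interp {f : ℝ → ℝ} (hf : Integrable f m) {a b p q : ℝ} (ha : 0 ≤ a) (hb : 0 ≤ b)
    (hab : a + b = 1) (hp : 0 ≤ p) (hq : 0 ≤ q) :
    excR f (a * p + b * q) ≤ a * excR f p + b * excR f q := by
  rw [excR, excR, excR, ← integral_const_mul, ← integral_const_mul,
    ← integral_add ((integrable_max_sub hf hp).const_mul a) ((integrable_max_sub hf hq).const_mul b)]
  refine integral_mono (integrable_max_sub hf (by positivity))
    (((integrable_max_sub hf hp).const_mul a).add ((integrable_max_sub hf hq).const_mul b))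
    fun u => ?_
  refine max_le ?_ (by positivity)
  have h : f u - (a * p + b * q) = a * (f u - p) + b * (f u - q) := by
    linear_combination (-f u) * hab
  rw [h]
  exact add_le_add (mul_le_mul_of_nonneg_left (le_max_left _ _) ha)
    (mul_le_mul_of_nonneg_left (le_max_left _ _) hb)

/-- For a value outside (p, q) the function c ↦ (value - c)⁺ is affine on [p, q]; the preceding
convexity inequality then becomes an equality. -/
theorem excR_eq_interp {f : ℝ → ℝ} (hf : Integrable f m) {a b p q : ℝ} (ha : 0 ≤ a) (hb : 0 ≤ b)
    (hab : a + b = 1) (hp : 0 ≤ p) (hpq : p ≤ q) (h : ∀ᵐ u ∂m, f u ≤ p ∨ q ≤ f u) :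
    excR f (a * p + b * q) = a * excR f p + b * excR f q := by
  have hq := hp.trans hpq
  rw [excR, excR, excR, ← integral_const_mul, ← integral_const_mul,
    ← integral_add ((integrable_max_sub hf hp).const_mul a) ((integrable_max_sub hf hq).const_mul b)]
  refine integral_congr_ae (h.mono fun u hu => ?_)
  have h1 : p ≤ a * p + b * q := by nlinarith
  have h2 : a * p + b * q ≤ q := by nlinarith
  simp only
  rcases hu with hu | hu
  · rw [max_eq_right (by linarith), max_eq_right (by linarith), max_eq_right (by linarith)]
    ring
  · rw [max_eq_left (by linarith), max_eq_left (by linarith), max_eq_left (by linarith)]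
    linear_combination (-f u) * hab

/-- Suppose the gap excR x - excR z does not vanish on any ray. If it has no positive zero, z has no
positive values. Otherwise take a positive gap at c₀ beyond some zero and bracket c₀ by the nearest
zeros; z has no values between them, and convexity of excR x contradicts the positive gap. -/
theorem exists_excR_eq_of_mem_extremePoints {x z : L0} (hx : 0 ≤ x) (hx1 : x ∈ L1)
    (hz : z ∈ extremePoints ℝ (OmegaPlus x)) (hz0 : z ≠ 0) :
    ∃ q, 0 < q ∧ ∀ c, q ≤ c → excR z c = excR x c := by
  have hzΩ := (mem_OmegaPlus_iff_excR hx hx1).1 hz.1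
  have hxi := mem_L1_iff.1 hx1
  by_contra! hne
  have hlt : ∀ c, 0 ≤ c → excR z c ≠ excR x c → excR z c < excR x c :=
    fun c hc h => lt_of_le_of_ne (hzΩ.2.2 c hc) h
  have hcont : ContinuousOn (fun c => excR x c - excR z c) (Ici 0) :=
    (continuousOn_excR hxi).sub (continuousOn_excR hzΩ.2.1)
  by_cases hex : ∃ p, 0 < p ∧ excR z p = excR x p
  swap
  · push Not at hex
    have := measure_Ioi_preimage_eq_zero hx hx1 hz le_rfl fun c hc => hlt c hc.le (hex c hc)
    refine hz0 (AEEqFun.ext ?_)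
    filter_upwards [measure_eq_zero_iff_ae_notMem.1 this, hzΩ.1,
      AEEqFun.coeFn_zero (α := ℝ) (β := ℝ) (μ := m)] with u h1 h2 h3
    rw [h3]
    exact le_antisymm (not_lt.1 h1) h2
  obtain ⟨p₀, hp₀, hp₀e⟩ := hex
  obtain ⟨c₀, hc₀, hc₀n⟩ := hne p₀ hp₀
  have hclosed : ∀ a b, 0 < a → IsCompact {c ∈ Icc a b | excR x c - excR z c = 0} := by
    intro a b ha
    refine isCompact_Icc.of_isClosed_subset ?_ fun c hc => hc.1
    exact (hcont.mono fun c hc => ha.le.trans hc.1).preimage_isClosed_of_isClosed isClosed_Icc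
      (isClosed_singleton (x := (0 : ℝ)))
  -- p is the last zero of the gap before c₀. It exists by compactness, and p ≥ p₀ > 0.
  obtain ⟨p, hp⟩ := (hclosed p₀ c₀ hp₀).exists_isGreatest
    ⟨p₀, ⟨le_rfl, hc₀⟩, by rw [hp₀e, sub_self]⟩
  have hp0 : 0 < p := hp₀.trans_le hp.1.1.1
  have hpe : excR x p = excR z p := sub_eq_zero.1 hp.1.2
  have hpc : p < c₀ := lt_of_le_of_ne hp.1.1.2 fun h => hc₀n (by rw [← h, hpe])
  have hpos1 : ∀ c, p < c → c ≤ c₀ → excR z c < excR x c := fun c h1 h2 =>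
    hlt c (hp0.trans h1).le fun h => h1.not_ge
      (hp.2 ⟨⟨hp.1.1.1.trans h1.le, h2⟩, by rw [h, sub_self]⟩)
  by_cases hq : ∃ q, c₀ ≤ q ∧ excR z q = excR x q
  swap
  · push Not at hq
    have hpos : ∀ c, p < c → excR z c < excR x c := fun c hc => by
      rcases le_total c c₀ with h | h
      · exact hpos1 c hc h
      · exact hlt c (hp0.trans hc).le (hq c h)
    have h0 := measure_Ioi_preimage_eq_zero hx hx1 hz hp0.le hpos
    -- With no zero beyond c₀, z ≤ p almost everywhere. Hence excR x(p) = excR z(p) = 0, and excR x,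
    -- being decreasing, vanishes at c₀ too.
    have h1 : excR z p = 0 := by
      refine integral_eq_zero_of_ae ?_
      filter_upwards [measure_eq_zero_iff_ae_notMem.1 h0] with u hu
      exact max_eq_right (sub_nonpos.2 (not_lt.1 hu))
    have h2 : excR x c₀ ≤ excR x p := by
      refine integral_mono (integrable_max_sub hxi (hp0.trans hpc).le)
        (integrable_max_sub hxi hp0.le) fun u => max_le_max (by linarith) le_rfl
    linarith [hpos c₀ hpc, excR_nonneg z c₀]
  obtain ⟨q₁, hq₁, hq₁e⟩ := hq
  obtain ⟨q, hq⟩ := (hclosed c₀ q₁ (hp0.trans hpc)).exists_isLeast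
    ⟨q₁, ⟨hq₁, le_rfl⟩, by rw [hq₁e, sub_self]⟩
  have hqe : excR x q = excR z q := sub_eq_zero.1 hq.1.2
  have hcq : c₀ < q := lt_of_le_of_ne hq.1.1.1 fun h => hc₀n (by rw [h, hqe])
  have hpos : ∀ c, p < c → c < q → excR z c < excR x c := fun c h1 h2 => by
    rcases le_total c c₀ with h | h
    · exact hpos1 c h1 h
    · exact hlt c (hp0.trans h1).le fun h' => h2.not_ge
        (hq.2 ⟨⟨h, h2.le.trans hq.1.1.2⟩, by rw [h', sub_self]⟩)
  have hae : ∀ᵐ u ∂m, z u ≤ p ∨ q ≤ z u := by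
    have hU : {u | p < z u ∧ z u < q} ⊆
        ⋃ n : ℕ, {u | p + 1 / ((n : ℝ) + 1) < z u ∧ z u < q - 1 / ((n : ℝ) + 1)} := by
      rintro u ⟨h1, h2⟩
      obtain ⟨n, hn⟩ := exists_nat_one_div_lt (show 0 < min (z u - p) (q - z u) from
        lt_min (by linarith) (by linarith))
      have := lt_min_iff.1 hn
      exact mem_iUnion.2 ⟨n, by linarith, by linarith⟩
    have h0 : m {u | p < z u ∧ z u < q} = 0 := by
      refine measure_mono_null hU (measure_iUnion_null fun n => ?_)
      have : 0 < 1 / ((n : ℝ) + 1) := by positivity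
      exact measure_Ioo_preimage_eq_zero hx hx1 hz (by linarith) fun c hc =>
        hpos c (by linarith [hc.1]) (by linarith [hc.2])
    filter_upwards [measure_eq_zero_iff_ae_notMem.1 h0] with u hu
    by_contra! h
    exact hu h
  have hpq : 0 < q - p := by linarith
  -- These weights express c₀ through the zeros p and q. On [p, q] excR z is affine and excR x is
  -- convex with the same end values, so the gap at c₀ cannot be positive.
  have ha : 0 ≤ (q - c₀) / (q - p) := div_nonneg (by linarith) hpq.le
  have hb : 0 ≤ (c₀ - p) / (q - p) := div_nonneg (by linarith) hpq.le
  have hab : (q - c₀) / (q - p) + (c₀ - p) / (q - p) = 1 := by field_simp; ring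
  have hc : (q - c₀) / (q - p) * p + (c₀ - p) / (q - p) * q = c₀ := by field_simp; ring
  have h1 := excR_le_interp hxi ha hb hab hp0.le (by linarith : 0 ≤ q)
  have h2 := excR_eq_interp hzΩ.2.1 ha hb hab hp0.le (by linarith) hae
  rw [hc] at h1 h2
  rw [hpe, hqe, ← h2] at h1
  exact (hpos c₀ hpc hcq).not_ge h1

/-! ### Fully symmetric spaces -/

section FullySymmetric

variable {E : Type*} [NormedAddCommGroup E] [NormedSpace ℝ E] {ι : E →ₗ[ℝ] L0}

theorem convex_OmegaPlus (x : L0) : Convex ℝ (OmegaPlus x) := by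
  rintro _ ⟨S, hS, f, hf, rfl⟩ _ ⟨T, hT, g, hg, rfl⟩ a b ha hb hab
  have hfg : f = g := Subtype.ext (hf.trans hg.symm)
  subst hfg
  exact ⟨_, hS.convex hT ha hb hab, f, hf, by simp⟩

theorem convexHull_extremePoints_subset (x : L0) :
    convexHull ℝ (extremePoints ℝ (OmegaPlus x)) ⊆ OmegaPlus x :=
  convexHull_min extremePoints_subset (convex_OmegaPlus x)

theorem fnNorm_le {z : E} {f : L0} (h : ι z = f) : fnNorm ι f ≤ ‖z‖ₑ :=
  iInf₂_le (f := fun (w : E) (_ : ι w = f) => ‖w‖ₑ) z h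

theorem exists_norm_le_of_exc_le (hE : IsFullySymmetric ι) {x : E} (hx : 0 ≤ ι x) {y : L0}
    (hy : 0 ≤ y) (hy1 : y ∈ L1) (h : ∀ c, 0 ≤ c → exc y c ≤ exc (ι x) c) :
    ∃ z : E, ι z = y ∧ ‖z‖ ≤ ‖x‖ :=
  hE.fully x y (mem_L1Linfty_of_mem_L1 hy1) (submajorized_of_exc_le hy hx h)

/-- Some set A = {x ≥ a} has positive finite measure, and κx ≥ κa on A. A function that is at most
κa with integral at most κa m(A) is submajorized by κa times the indicator of A, hence by κx. -/
theorem exists_of_bounded (hE : IsFullySymmetric ι) (hL1 : ∀ z : E, ι z ∈ L1) {x : E}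
    (hx : 0 ≤ ι x) (hx0 : x ≠ 0) : ∃ a b : ℝ, 0 < a ∧ 0 < b ∧ ∀ κ : ℝ, 0 ≤ κ → ∀ f : L0, 0 ≤ f →
      (∀ᵐ u ∂m, f u ≤ κ * a) → exc f 0 ≤ ENNReal.ofReal (κ * b) →
      ∃ z : E, ι z = f ∧ ‖z‖ ≤ κ * ‖x‖ := by
  have hxm : Measurable (ι x) := AEEqFun.measurable _
  obtain ⟨a, ha, hA⟩ : ∃ a : ℝ, 0 < a ∧ m {u | a ≤ ι x u} ≠ 0 := by
    by_contra! hcon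
    refine hx0 (hE.injective ?_)
    rw [map_zero]
    refine AEEqFun.ext ?_
    have h : ∀ᵐ u ∂m, ∀ n : ℕ, ι x u < 1 / ((n : ℝ) + 1) := ae_all_iff.2 fun n => by
      filter_upwards [measure_eq_zero_iff_ae_notMem.1 (hcon (1 / ((n : ℝ) + 1)) (by positivity))]
        with u hu using not_le.1 hu
    filter_upwards [h, coe_nonneg hx, AEEqFun.coeFn_zero (α := ℝ) (β := ℝ) (μ := m)]
      with u h1 h2 h3
    rw [h3]
    refine le_antisymm (le_of_forall_pos_lt_add fun ε hε => ?_) h2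
    obtain ⟨n, hn⟩ := exists_nat_one_div_lt hε
    simp only [Pi.zero_apply, zero_add]
    exact (h1 n).trans hn
  have hAf := meas_le_ne_top (mem_L1_iff.1 (hL1 x)) ha
  set A := {u | a ≤ ι x u} with hAdef
  have hAm : MeasurableSet A := measurableSet_le measurable_const hxm
  have hA0 : 0 < m.real A := ENNReal.toReal_pos hA hAf
  refine ⟨a, a * m.real A, ha, by positivity, fun κ hκ f hf hfa hfb => ?_⟩
  have hf1 : f ∈ L1 := by
    refine mem_L1_iff.2 ⟨AEEqFun.aestronglyMeasurable _, ?_⟩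
    rw [HasFiniteIntegral]
    refine lt_of_eq_of_lt ?_ (hfb.trans_lt ENNReal.ofReal_lt_top)
    refine lintegral_congr_ae ((coe_nonneg hf).mono fun u hu => ?_)
    simp only [sub_zero]
    exact Real.enorm_eq_ofReal hu
  have hκx : 0 ≤ ι (κ • x) := by
    rw [map_smul]
    refine nonneg_of_coe ?_
    filter_upwards [AEEqFun.coeFn_smul κ (ι x), coe_nonneg hx] with u h1 h2
    rw [h1]
    exact mul_nonneg hκ h2
  have key : ∀ c, 0 ≤ c → exc f c ≤ exc (ι (κ • x)) c := by
    intro c hc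
    rcases le_or_gt (κ * a) c with h | h
    · refine le_of_eq_of_le ?_ zero_le
      refine (lintegral_congr_ae (hfa.mono fun u hu => ?_)).trans lintegral_zero
      exact ENNReal.ofReal_of_nonpos (by linarith)
    have hκ0 : 0 < κ := by
      rcases hκ.eq_or_lt with h' | h'
      · rw [← h', zero_mul] at h; linarith
      · exact h'
    have hr : 0 ≤ 1 - c / (κ * a) := by
      rw [sub_nonneg, div_le_one (by positivity)]; exact h.le
    -- From f ≤ κa one has cf/(κa) ≤ c, so f - c is at most (1 - c/(κa)) f.
    calc exc f c ≤ ∫⁻ u, ENNReal.ofReal (1 - c / (κ * a)) * ENNReal.ofReal (f u - 0) ∂m := by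
          refine lintegral_mono_ae ?_
          filter_upwards [hfa, coe_nonneg hf] with u h1 h2
          have h2' : 0 ≤ f u := h2
          rw [← ENNReal.ofReal_mul hr]
          refine ENNReal.ofReal_le_ofReal ?_
          have : c / (κ * a) * f u ≤ c := by
            rw [div_mul_eq_mul_div, div_le_iff₀ (by positivity)]; gcongr
          linarith
      _ = ENNReal.ofReal (1 - c / (κ * a)) * exc f 0 := by
          rw [lintegral_const_mul _ (((AEEqFun.measurable f).sub_const 0).ennreal_ofReal)]
          rfl
      _ ≤ ENNReal.ofReal (1 - c / (κ * a)) * ENNReal.ofReal (κ * (a * m.real A)) := by gcongr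
      _ = ENNReal.ofReal (κ * a - c) * m A := by
          rw [← ENNReal.ofReal_mul hr, ← ENNReal.ofReal_toReal hAf,
            ← ENNReal.ofReal_mul (by linarith)]
          congr 1
          rw [Measure.real]
          field_simp
      _ = ∫⁻ u in A, ENNReal.ofReal (κ * a - c) ∂m := by rw [setLIntegral_const]
      _ ≤ ∫⁻ u in A, ENNReal.ofReal (ι (κ • x) u - c) ∂m := by
          refine lintegral_mono_ae ?_
          filter_upwards [ae_restrict_of_ae (AEEqFun.coeFn_smul κ (ι x)), ae_restrict_mem hAm]
            with u h1 h2
          rw [map_smul, h1, Pi.smul_apply, smul_eq_mul]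
          refine ENNReal.ofReal_le_ofReal ?_
          have h2' : a ≤ ι x u := h2
          have := mul_le_mul_of_nonneg_left h2' hκ
          linarith
      _ ≤ exc (ι (κ • x)) c := setLIntegral_le_lintegral _ _
  obtain ⟨z, hz, hzn⟩ := exists_norm_le_of_exc_le hE hκx hf hf1 key
  refine ⟨z, hz, hzn.trans_eq ?_⟩
  rw [norm_smul, Real.norm_of_nonneg hκ]

/-- The mean of |v| over B times the indicator of B is submajorized by v, so its norm is at most
that of v. If the indicator of B is in E this bounds the mean; if it is not, the mean must be 0. -/
theorem exists_setLIntegral_le_norm (hE : IsFullySymmetric ι) (hL1 : ∀ z : E, ι z ∈ L1)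
    {B : Set ℝ} (hB : MeasurableSet B) (hBf : m B ≠ ∞) :
    ∃ C : ℝ, 0 ≤ C ∧ ∀ v : E, ∫⁻ u in B, ‖ι v u‖ₑ ∂m ≤ ENNReal.ofReal (C * ‖v‖) := by
  rcases eq_or_ne (m B) 0 with hB0 | hB0
  · exact ⟨0, le_rfl, fun v => by simp [Measure.restrict_eq_zero.2 hB0]⟩
  have hb : 0 < m.real B := ENNReal.toReal_pos hB0 hBf
  have hfin : ∀ v : E, ∫⁻ u in B, ‖ι v u‖ₑ ∂m ≠ ∞ := fun v =>
    ((setLIntegral_le_lintegral _ _).trans_lt (mem_L1_iff.1 (hL1 v)).2).ne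
  have hind : ∀ s : ℝ, (((s • indL B hB : L1Linfty) : L0) : ℝ → ℝ) =ᵐ[m]
      B.indicator fun _ => s := by
    intro s
    rw [Submodule.coe_smul]
    filter_upwards [AEEqFun.coeFn_smul s (indL B hB : L0), coe_indL B hB] with u h1 h2
    rw [h1, Pi.smul_apply, h2]
    by_cases hu : u ∈ B <;> simp [hu]
  have key : ∀ v : E, ∃ z : E,
      ι z = ((((∫⁻ u in B, ‖ι v u‖ₑ ∂m).toReal / m.real B) • indL B hB : L1Linfty) : L0) ∧
        ‖z‖ ≤ ‖v‖ := by
    intro v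
    refine hE.fully v _ (Subtype.prop _) (submajorized_of_forall fun c => ?_)
    set s := (∫⁻ u in B, ‖ι v u‖ₑ ∂m).toReal / m.real B with hs
    have hs0 : 0 ≤ s := by positivity
    calc ∫⁻ u, (‖((s • indL B hB : L1Linfty) : L0) u‖ₑ - c) ∂m
        = ∫⁻ u, B.indicator (fun _ => ENNReal.ofReal s - c) u ∂m := by
          refine lintegral_congr_ae ((hind s).mono fun u hu => ?_)
          simp only [hu]
          by_cases h : u ∈ B
          · simp [h, Real.enorm_eq_ofReal hs0]
          · simp [h]
      _ = (ENNReal.ofReal s - c) * m B := by rw [lintegral_indicator hB, setLIntegral_const]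
      _ = (∫⁻ u in B, ‖ι v u‖ₑ ∂m) - c * m B := by
          rw [ENNReal.sub_mul (fun _ _ => hBf)]
          congr 1
          rw [hs, ENNReal.ofReal_div_of_pos hb, ENNReal.ofReal_toReal (hfin v), Measure.real,
            ENNReal.ofReal_toReal hBf, ENNReal.div_mul_cancel hB0 hBf]
      _ ≤ ∫⁻ u in B, (‖ι v u‖ₑ - c) ∂m := by
          rw [tsub_le_iff_right, ← setLIntegral_const, ← lintegral_add_right _ measurable_const]
          exact lintegral_mono fun u => le_tsub_add
      _ ≤ _ := setLIntegral_le_lintegral _ _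
  by_cases hex : ∃ e : E, ι e = (indL B hB : L0)
  · obtain ⟨e, he⟩ := hex
    have he0 : e ≠ 0 := by
      rintro rfl
      rw [map_zero] at he
      have h1 := coe_indL B hB
      rw [← he] at h1
      refine hB0 (measure_mono_null (fun u hu => ?_)
        (h1.symm.trans (AEEqFun.coeFn_zero (α := ℝ) (β := ℝ) (μ := m))))
      simp [hu]
    have hen : 0 < ‖e‖ := norm_pos_iff.2 he0
    refine ⟨m.real B / ‖e‖, by positivity, fun v => ?_⟩
    obtain ⟨z, hz, hzn⟩ := key v
    have : z = ((∫⁻ u in B, ‖ι v u‖ₑ ∂m).toReal / m.real B) • e := hE.injective (by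
      rw [hz, map_smul, he, Submodule.coe_smul])
    rw [this, norm_smul, Real.norm_of_nonneg (by positivity)] at hzn
    rw [← ENNReal.ofReal_toReal (hfin v)]
    refine ENNReal.ofReal_le_ofReal ?_
    calc (∫⁻ u in B, ‖ι v u‖ₑ ∂m).toReal
        = m.real B / ‖e‖ * ((∫⁻ u in B, ‖ι v u‖ₑ ∂m).toReal / m.real B * ‖e‖) := by field_simp
      _ ≤ _ := by gcongr
  · refine ⟨0, le_rfl, fun v => ?_⟩
    obtain ⟨z, hz, -⟩ := key v
    have h0 : (∫⁻ u in B, ‖ι v u‖ₑ ∂m).toReal / m.real B = 0 := by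
      by_contra h
      refine hex ⟨((∫⁻ u in B, ‖ι v u‖ₑ ∂m).toReal / m.real B)⁻¹ • z, ?_⟩
      rw [map_smul, hz, Submodule.coe_smul, inv_smul_smul₀ h]
    have h1 := (div_eq_zero_iff.1 h0).resolve_right hb.ne'
    rw [((ENNReal.toReal_eq_zero_iff _).1 h1).resolve_right (hfin v)]
    exact zero_le

/-- Convergence in E implies L₁ convergence on each (0, k], so a bound on ∫φ(w)⁺ with φ 1-Lipschitz
passes to the closure, first on (0, k] and then on the whole semi-axis. The choices φ(a) = -a and
φ(a) = a - c give the two conditions describing the orbit. -/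
theorem QPlus_subset_OmegaPlus (hE : IsFullySymmetric ι) (hL1 : ∀ z : E, ι z ∈ L1) {x : E}
    (hx : 0 ≤ ι x) : QPlus ι (ι x) ⊆ OmegaPlus (ι x) := by
  rintro _ ⟨e, he, rfl⟩
  have hΩ : ∀ w ∈ ι ⁻¹' convexHull ℝ (extremePoints ℝ (OmegaPlus (ι x))),
      0 ≤ ι w ∧ ι w ∈ L1 ∧ ∀ c, 0 ≤ c → exc (ι w) c ≤ exc (ι x) c := fun w hw =>
    (mem_OmegaPlus_iff hx (hL1 x)).1 (convexHull_extremePoints_subset _ hw)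
  have hmeas : ∀ v : E, Measurable (ι v) := fun v => AEEqFun.measurable _
  have key : ∀ (φ : ℝ → ℝ), (∀ a b, φ a ≤ φ b + |a - b|) → Measurable φ → ∀ M : ℝ≥0∞,
      (∀ w ∈ ι ⁻¹' convexHull ℝ (extremePoints ℝ (OmegaPlus (ι x))),
        ∫⁻ u, ENNReal.ofReal (φ (ι w u)) ∂m ≤ M) → ∫⁻ u, ENNReal.ofReal (φ (ι e u)) ∂m ≤ M := by
    intro φ hφ hφm M hM
    have hset : ∀ k : ℕ, ∫⁻ u in Ioc 0 (k : ℝ), ENNReal.ofReal (φ (ι e u)) ∂m ≤ M := by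
      intro k
      obtain ⟨C, hC, hCb⟩ := exists_setLIntegral_le_norm hE hL1 (measurableSet_Ioc (a := (0 : ℝ))
        (b := k)) (by rw [m_Ioc]; exact ENNReal.ofReal_ne_top)
      refine ENNReal.le_of_forall_pos_le_add fun ε hε _ => ?_
      obtain ⟨w, hw, hwd⟩ := Metric.mem_closure_iff.1 he (ε / (C + 1))
        (div_pos (NNReal.coe_pos.2 hε) (by linarith))
      calc ∫⁻ u in Ioc 0 (k : ℝ), ENNReal.ofReal (φ (ι e u)) ∂m
          ≤ ∫⁻ u in Ioc 0 (k : ℝ), (ENNReal.ofReal (φ (ι w u)) + ‖ι (e - w) u‖ₑ) ∂m := by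
            refine lintegral_mono_ae (ae_restrict_of_ae ?_)
            rw [map_sub]
            filter_upwards [AEEqFun.coeFn_sub (ι e) (ι w)] with u hu
            rw [hu, Pi.sub_apply, Real.enorm_eq_ofReal_abs]
            exact (ENNReal.ofReal_le_ofReal (hφ _ _)).trans ENNReal.ofReal_add_le
        _ = ∫⁻ u in Ioc 0 (k : ℝ), ENNReal.ofReal (φ (ι w u)) ∂m +
            ∫⁻ u in Ioc 0 (k : ℝ), ‖ι (e - w) u‖ₑ ∂m :=
            lintegral_add_left ((hφm.comp (hmeas w)).ennreal_ofReal) _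
        _ ≤ M + ENNReal.ofReal (C * ‖e - w‖) :=
            add_le_add ((setLIntegral_le_lintegral _ _).trans (hM w hw)) (hCb _)
        _ ≤ M + ε := by
            gcongr
            rw [← ENNReal.ofReal_coe_nnreal]
            refine ENNReal.ofReal_le_ofReal ?_
            rw [dist_eq_norm, lt_div_iff₀ (by linarith)] at hwd
            nlinarith [norm_nonneg (e - w)]
    have hun : m.restrict (⋃ k : ℕ, Ioc 0 (k : ℝ)) = m := by
      rw [Measure.restrict_restrict (MeasurableSet.iUnion fun k => measurableSet_Ioc),
        inter_eq_right.2]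
      intro u hu
      obtain ⟨k, hk⟩ := exists_nat_ge u
      exact mem_iUnion.2 ⟨k, hu, hk⟩
    have h1 : ∫⁻ u, ENNReal.ofReal (φ (ι e u)) ∂m =
        ∫⁻ u in ⋃ k : ℕ, Ioc 0 (k : ℝ), ENNReal.ofReal (φ (ι e u)) ∂m := congrArg
      (fun μ => ∫⁻ u, ENNReal.ofReal (φ (ι e u)) ∂μ) hun.symm
    rw [h1, setLIntegral_iUnion_of_directed]
    · exact iSup_le hset
    · refine (monotone_nat_of_le_succ fun k => Ioc_subset_Ioc_right ?_).directed_le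
      simp
  rw [mem_OmegaPlus_iff hx (hL1 x)]
  refine ⟨nonneg_of_coe ?_, hL1 e, fun c hc => ?_⟩
  · have h0 := key (fun a => -a) (fun a b => by have := neg_le_abs (a - b); linarith) measurable_neg
      0 fun w hw => by
        refine le_of_eq ((lintegral_congr_ae ((coe_nonneg (hΩ w hw).1).mono fun u hu => ?_)).trans
          lintegral_zero)
        exact ENNReal.ofReal_of_nonpos (neg_nonpos.2 hu)
    have h1 := (lintegral_eq_zero_iff ((hmeas e).neg.ennreal_ofReal)).1 (le_antisymm h0 zero_le)
    filter_upwards [h1] with u hu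
    have := ENNReal.ofReal_eq_zero.1 hu
    exact neg_nonpos.1 this
  · exact key (fun a => a - c) (fun a b => by have := le_abs_self (a - b); linarith)
      (measurable_id.sub_const c) _ fun w hw => (hΩ w hw).2.2 c hc

end FullySymmetric

/-! ### The functions `σ_s(x*) χ_[0,1]` -/

theorem setLIntegral_comp_div {g : ℝ → ℝ≥0∞} (hg : Measurable g) {s : ℝ} (hs : 0 < s) (τ : ℝ) :
    ∫⁻ u in Ioc 0 τ, g (u / s) = ENNReal.ofReal s * ∫⁻ v in Ioc 0 (τ / s), g v := by
  have h1 : ∀ u, (Ioc 0 τ).indicator (fun u => g (u / s)) u =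
      (Ioc 0 (τ / s)).indicator g (s⁻¹ * u) := fun u => by
    have : s⁻¹ * u = u / s := by field_simp
    rw [this]
    by_cases hu : u ∈ Ioc 0 τ
    · rw [indicator_of_mem hu, indicator_of_mem]
      exact ⟨div_pos hu.1 hs, div_le_div_of_nonneg_right hu.2 hs.le⟩
    · rw [indicator_of_notMem hu, indicator_of_notMem]
      rintro ⟨h1, h2⟩
      exact hu ⟨(div_pos_iff_of_pos_right hs).1 h1, (div_le_div_iff_of_pos_right hs).1 h2⟩
  rw [← lintegral_indicator measurableSet_Ioc, ← lintegral_indicator measurableSet_Ioc]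
  simp_rw [h1]
  rw [← lintegral_map (f := (Ioc 0 (τ / s)).indicator g) (g := fun u => s⁻¹ * u)
    (hg.indicator measurableSet_Ioc) (measurable_const_mul _),
    Real.map_volume_mul_left (inv_ne_zero hs.ne'), lintegral_smul_measure, inv_inv, abs_of_pos hs,
    smul_eq_mul]

theorem enorm_dilatedHead {x : L0} (hx1 : x ∈ L1) {s : ℝ} (hs : 0 < s) :
    ∀ᵐ u ∂m, ‖dilatedHead s x u‖ₑ = (Ioc (0 : ℝ) 1).indicator (fun u => rearr x (u / s)) u := by
  filter_upwards [AEEqFun.coeFn_mk ((Icc (0 : ℝ) 1).indicator (dilation s (rearrReal x)))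
    (((measurable_rearrReal x).comp (measurable_id.div_const s)).indicator
      measurableSet_Icc).aestronglyMeasurable, ae_restrict_mem measurableSet_Ioi] with u h1 h2
  have h2' : 0 < u := h2
  rw [dilatedHead, h1]
  by_cases hu : u ≤ 1
  · rw [indicator_of_mem (show u ∈ Icc (0 : ℝ) 1 from ⟨h2'.le, hu⟩),
      indicator_of_mem (show u ∈ Ioc (0 : ℝ) 1 from ⟨h2', hu⟩), dilation, rearrReal,
      Real.enorm_eq_ofReal ENNReal.toReal_nonneg,
      ENNReal.ofReal_toReal (rearr_lt_top hx1 (div_pos h2' hs)).ne]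
  · rw [indicator_of_notMem (fun h => hu h.2), indicator_of_notMem (fun h => hu h.2), enorm_zero]

theorem dilatedHead_nonneg (s : ℝ) (x : L0) : 0 ≤ dilatedHead s x := by
  refine nonneg_of_coe ?_
  filter_upwards [AEEqFun.coeFn_mk ((Icc (0 : ℝ) 1).indicator (dilation s (rearrReal x)))
    (((measurable_rearrReal x).comp (measurable_id.div_const s)).indicator
      measurableSet_Icc).aestronglyMeasurable] with u h1
  rw [dilatedHead, h1]
  exact indicator_nonneg (fun u _ => ENNReal.toReal_nonneg) u

theorem setLIntegral_enorm_dilatedHead {x : L0} (hx1 : x ∈ L1) {s : ℝ} (hs : 0 < s) (t : ℝ) :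
    ∫⁻ u in Ioc 0 t, ‖dilatedHead s x u‖ₑ ∂m =
      ENNReal.ofReal s * ∫⁻ v in Ioc 0 (min t 1 / s), rearr x v := by
  rw [lintegral_congr_ae (ae_restrict_of_ae (enorm_dilatedHead hx1 hs)),
    setLIntegral_indicator measurableSet_Ioc, ← setLIntegral_comp_div (measurable_rearr x) hs,
    ← m_restrict_Ioc]
  congr 2
  ext u
  simp only [mem_inter_iff, mem_Ioc, le_min_iff]
  tauto

theorem le_setLIntegral_rearr_dilatedHead {x : L0} (hx1 : x ∈ L1) {s : ℝ} (hs : 0 < s) (t : ℝ) :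
    ENNReal.ofReal s * ∫⁻ v in Ioc 0 (min t 1 / s), rearr x v ≤
      ∫⁻ u in Ioc 0 t, rearr (dilatedHead s x) u := by
  rw [← setLIntegral_enorm_dilatedHead hx1 hs]
  exact setLIntegral_enorm_le_rearr _ (m_Ioc t).le

theorem lintegral_enorm_dilatedHead {x : L0} (hx1 : x ∈ L1) {s : ℝ} (hs : 0 < s) :
    ∫⁻ u, ‖dilatedHead s x u‖ₑ ∂m = ENNReal.ofReal s * ∫⁻ v in Ioc 0 (1 / s), rearr x v := by
  have h := setLIntegral_enorm_dilatedHead hx1 hs 1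
  rw [min_self] at h
  rw [← h, ← lintegral_indicator measurableSet_Ioc]
  refine lintegral_congr_ae ((enorm_dilatedHead hx1 hs).mono fun u hu => ?_)
  simp only
  by_cases h : u ∈ Ioc (0 : ℝ) 1
  · rw [indicator_of_mem h]
  · rw [indicator_of_notMem h, hu, indicator_of_notMem h]

theorem setLIntegral_rearr_lt_top {x : L0} (hx1 : x ∈ L1) (t : ℝ) :
    ∫⁻ v in Ioc 0 t, rearr x v < ∞ := by
  refine (setLIntegral_rearr_le x t 0).trans_lt ?_
  simp only [zero_mul, zero_add, tsub_zero]
  exact (mem_L1_iff.1 hx1).2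

theorem dilatedHead_mem_L1 {x : L0} (hx1 : x ∈ L1) {s : ℝ} (hs : 0 < s) :
    dilatedHead s x ∈ L1 := by
  refine mem_L1_iff.2 ⟨AEEqFun.aestronglyMeasurable _, ?_⟩
  rw [HasFiniteIntegral, lintegral_enorm_dilatedHead hx1 hs]
  exact ENNReal.mul_lt_top ENNReal.ofReal_lt_top (setLIntegral_rearr_lt_top hx1 _)

/-- The head is decreasing, so it is its own rearrangement. For t ≤ 1 the duality bound is used at
the level x*(t/s), which the head exceeds or equals before t and does not exceed afterwards. -/
theorem setLIntegral_rearr_dilatedHead_le {x : L0} (hx1 : x ∈ L1) {s : ℝ} (hs : 0 < s) (t : ℝ) :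
    ∫⁻ u in Ioc 0 t, rearr (dilatedHead s x) u ≤
      ENNReal.ofReal s * ∫⁻ v in Ioc 0 (min t 1 / s), rearr x v := by
  rcases le_total 1 t with h | h
  · rw [min_eq_right h, ← lintegral_enorm_dilatedHead hx1 hs]
    refine (setLIntegral_rearr_le _ t 0).trans ?_
    simp
  · refine (setLIntegral_rearr_le _ t (rearr x (t / s))).trans ?_
    rw [← setLIntegral_enorm_dilatedHead hx1 hs]
    have h0 : ∫⁻ u, (‖dilatedHead s x u‖ₑ - rearr x (t / s)) ∂m =
        ∫⁻ u in Ioc 0 t, (‖dilatedHead s x u‖ₑ - rearr x (t / s)) ∂m := by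
      rw [← lintegral_indicator measurableSet_Ioc]
      refine lintegral_congr_ae ?_
      filter_upwards [enorm_dilatedHead hx1 hs, ae_restrict_mem measurableSet_Ioi] with u hu hu0
      by_cases hut : u ∈ Ioc 0 t
      · rw [indicator_of_mem hut]
      · rw [indicator_of_notMem hut, hu]
        refine tsub_eq_zero_of_le ?_
        have hut' : t < u := not_le.1 fun h' => hut ⟨hu0, h'⟩
        refine (indicator_le_self _ _ u).trans (rearr_antitone x ?_)
        exact div_le_div_of_nonneg_right hut'.le hs.le
    rw [h0, ← m_Ioc, ← setLIntegral_const, ← lintegral_add_left measurable_const]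
    refine lintegral_mono_ae ?_
    filter_upwards [ae_restrict_of_ae (enorm_dilatedHead hx1 hs),
      ae_restrict_mem measurableSet_Ioc] with u hu hu0
    refine (add_tsub_cancel_of_le ?_).le
    rw [hu, indicator_of_mem (show u ∈ Ioc (0 : ℝ) 1 from ⟨hu0.1, hu0.2.trans h⟩)]
    exact rearr_antitone x (div_le_div_of_nonneg_right hu0.2 hs.le)

theorem rearr_smul {κ : ℝ} (hκ : 0 < κ) (f : L0) (t : ℝ) :
    rearr (κ • f) t = ENNReal.ofReal κ * rearr f t := by
  have h0 : ENNReal.ofReal κ ≠ 0 := by simpa using hκ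
  refine eq_of_forall_lt_iff fun c => ?_
  have h1 : c < ENNReal.ofReal κ * rearr f t ↔ c / ENNReal.ofReal κ < rearr f t := by
    rw [ENNReal.div_lt_iff (Or.inl h0) (Or.inl ENNReal.ofReal_ne_top), mul_comm]
  rw [h1, lt_rearr_iff, lt_rearr_iff]
  have h2 : m {u | c < ‖(κ • f) u‖ₑ} = m {u | c / ENNReal.ofReal κ < ‖f u‖ₑ} := by
    refine measure_congr ?_
    filter_upwards [AEEqFun.coeFn_smul κ f] with u hu
    have : (c < ‖(κ • f) u‖ₑ) = (c / ENNReal.ofReal κ < ‖f u‖ₑ) := by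
      rw [hu, Pi.smul_apply, enorm_smul, Real.enorm_eq_ofReal hκ.le,
        ENNReal.div_lt_iff (Or.inl h0) (Or.inl ENNReal.ofReal_ne_top), mul_comm]
    exact this
  rw [h2]

theorem setLIntegral_rearr_smul {κ : ℝ} (hκ : 0 < κ) (f : L0) (t : ℝ) :
    ∫⁻ u in Ioc 0 t, rearr (κ • f) u = ENNReal.ofReal κ * ∫⁻ u in Ioc 0 t, rearr f u := by
  simp_rw [rearr_smul hκ]
  exact lintegral_const_mul _ (measurable_rearr f)

/-! ### Necessity of the condition on `φ_fin` -/

/-- Beyond some level q the functions exc z and exc x agree. For τ < m{z > q} a top set C of z of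
measure τ has threshold c ≥ q, so the integral of z over C is cτ + exc z(c) = cτ + exc x(c), which
is at least ∫₀^τ x*. Unboundedness of x makes m{z > q} positive. -/
theorem exists_measure_eq_setLIntegral_ge {x z : L0} (hx : 0 ≤ x) (hx1 : x ∈ L1)
    (hunb : ∀ M, m {u | M < x u} ≠ 0) (hz : z ∈ extremePoints ℝ (OmegaPlus x)) (hz0 : z ≠ 0) :
    ∃ τ₀ : ℝ, 0 < τ₀ ∧ ∀ τ, 0 < τ → τ < τ₀ → ∃ C, MeasurableSet C ∧ m C = ENNReal.ofReal τ ∧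
      ∫⁻ s in Ioc 0 τ, rearr x s ≤ ∫⁻ u in C, ENNReal.ofReal (z u) ∂m := by
  obtain ⟨q, hq, heq⟩ := exists_excR_eq_of_mem_extremePoints hx hx1 hz hz0
  have hzΩ := (mem_OmegaPlus_iff_excR hx hx1).1 hz.1
  have hxi := mem_L1_iff.1 hx1
  obtain ⟨g, hg, hg0, hzg⟩ := exists_measurable_nonneg_rep (nonneg_of_coe hzΩ.1)
  have hgi : Integrable g m := hzΩ.2.1.congr hzg
  have hexc : ∀ c, q ≤ c → exc g c = exc x c := fun c hc => by
    rw [exc_eq_ofReal_excR hgi (hq.le.trans hc), exc_eq_ofReal_excR hxi (hq.le.trans hc),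
      ← heq c hc, excR_congr hzg]
  have hf : m {u | q < g u} ≠ ∞ := measure_ne_top_of_subset
    (fun u hu => le_of_lt (show q < g u from hu)) (meas_le_ne_top hgi hq)
  have h0 : m {u | q < g u} ≠ 0 := by
    intro h
    have h1 : exc g q = 0 := by
      refine (lintegral_congr_ae ?_).trans lintegral_zero
      filter_upwards [measure_eq_zero_iff_ae_notMem.1 h] with u hu
      exact ENNReal.ofReal_of_nonpos (sub_nonpos.2 (not_lt.1 hu))
    rw [hexc q le_rfl] at h1
    have h2 := (lintegral_eq_zero_iff
      ((AEEqFun.measurable x).sub_const q).ennreal_ofReal).1 h1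
    refine hunb q (measure_eq_zero_iff_ae_notMem.2 (h2.mono fun u hu hu' => ?_))
    have := ENNReal.ofReal_eq_zero.1 hu
    have hu'' : q < x u := hu'
    linarith
  refine ⟨m.real {u | q < g u}, ENNReal.toReal_pos h0 hf, fun τ hτ hτ' => ?_⟩
  have hg1 : exc g 0 ≠ ∞ := by
    rw [exc_eq_ofReal_excR hgi le_rfl]; exact ENNReal.ofReal_ne_top
  obtain ⟨C, c, hC, hmC⟩ := exists_topSet hg hg0 hg1 (s := ENNReal.ofReal τ) (by simpa using hτ)
    ENNReal.ofReal_ne_top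
  have hqc : q ≤ c := by
    by_contra! hlt
    have hsub : {u | q < g u} ⊆ C := fun u hu => by
      by_contra huC
      have := hC.le u huC
      have hu' : q < g u := hu
      linarith
    have h1 := measure_mono (μ := m) hsub
    rw [hmC, ← ENNReal.ofReal_toReal hf] at h1
    exact hτ'.not_ge ((ENNReal.ofReal_le_ofReal_iff hτ.le).1 h1)
  refine ⟨C, hC.meas, hmC, ?_⟩
  have h1 : ∫⁻ u in C, ENNReal.ofReal (z u) ∂m = ∫⁻ u in C, ENNReal.ofReal (g u) ∂m :=
    lintegral_congr_ae (ae_restrict_of_ae (hzg.mono fun u hu => by simp only [hu]))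
  rw [h1, hC.setLIntegral, hmC, hexc c hqc]
  exact setLIntegral_rearr_le_exc hx τ hC.nonneg

theorem le_setLIntegral_rearr_of_unbounded {x : L0} (hx : 0 ≤ x)
    (hunb : ∀ M, m {u | M < x u} ≠ 0) {K : ℝ} (hK : 0 ≤ K) :
    ∃ τ₀ : ℝ, 0 < τ₀ ∧ ∀ τ, 0 < τ → τ < τ₀ →
      ENNReal.ofReal (K * τ) ≤ ∫⁻ s in Ioc 0 τ, rearr x s := by
  have h : m {u | ENNReal.ofReal K < ‖x u‖ₑ} ≠ 0 := by
    have : m {u | ENNReal.ofReal K < ‖x u‖ₑ} = m {u | K < x u} := by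
      refine measure_congr ?_
      filter_upwards [coe_nonneg hx] with u hu
      have : (ENNReal.ofReal K < ‖x u‖ₑ) = (K < x u) := by
        rw [Real.enorm_eq_ofReal hu, ENNReal.ofReal_lt_ofReal_iff_of_nonneg hK]
      exact this
    rw [this]; exact hunb K
  -- The minimum with 1 gives a finite range even if the set has infinite measure.
  set M := min (m {u | ENNReal.ofReal K < ‖x u‖ₑ}) 1 with hM
  have hM0 : M ≠ 0 := by
    rw [hM]; exact (lt_min (pos_iff_ne_zero.2 h) one_pos).ne'
  have hMf : M ≠ ∞ := ((min_le_right _ _).trans_lt ENNReal.one_lt_top).ne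
  refine ⟨M.toReal, ENNReal.toReal_pos hM0 hMf, fun τ hτ hτ' => ?_⟩
  calc ENNReal.ofReal (K * τ) = ∫⁻ s in Ioc 0 τ, ENNReal.ofReal K := by
        rw [setLIntegral_const, Real.volume_Ioc, sub_zero, ENNReal.ofReal_mul hK]
    _ ≤ _ := by
        refine setLIntegral_mono' measurableSet_Ioc fun s hs => ((lt_rearr_iff x s _).2 ?_).le
        refine lt_of_lt_of_le ?_ (min_le_left _ 1)
        rw [← hM, ← ENNReal.ofReal_toReal hMf]
        exact (ENNReal.ofReal_lt_ofReal_iff (ENNReal.toReal_pos hM0 hMf)).2 (hs.2.trans_lt hτ')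

section Necessity

variable {E : Type*} [NormedAddCommGroup E] [NormedSpace ℝ E] {ι : E →ₗ[ℝ] L0}

theorem phiFinEq_zero_of_forall {x : L0} (h : ∀ ε : ℝ, 0 < ε → ∃ s₀ : ℝ, 0 < s₀ ∧ ∀ s, s₀ ≤ s →
    ∃ z : E, ι z = dilatedHead s x ∧ ‖z‖ ≤ s * ε) : PhiFinEq ι x 0 := by
  refine ENNReal.tendsto_nhds_zero.2 fun ε hε => ?_
  obtain ⟨ε', hε', hle⟩ : ∃ ε' : ℝ, 0 < ε' ∧ ENNReal.ofReal ε' ≤ ε := by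
    rcases eq_or_ne ε ∞ with rfl | h'
    · exact ⟨1, one_pos, le_top⟩
    · exact ⟨ε.toReal, ENNReal.toReal_pos hε.ne' h', (ENNReal.ofReal_toReal h').le⟩
  obtain ⟨s₀, hs₀, hs⟩ := h ε' hε'
  filter_upwards [Ici_mem_atTop s₀] with s hss
  obtain ⟨z, hz, hzn⟩ := hs s hss
  have hs0 : 0 < s := hs₀.trans_le hss
  calc ENNReal.ofReal (1 / s) * fnNorm ι (dilatedHead s x)
      ≤ ENNReal.ofReal (1 / s) * ENNReal.ofReal (s * ε') := by
        gcongr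
        refine (fnNorm_le hz).trans ?_
        rw [← ofReal_norm]
        exact ENNReal.ofReal_le_ofReal hzn
    _ = ENNReal.ofReal ε' := by
        rw [← ENNReal.ofReal_mul (by positivity)]
        congr 1; field_simp
    _ ≤ ε := hle

theorem dilatedHead_zero (s : ℝ) : dilatedHead s 0 = 0 := by
  refine AEEqFun.ext ?_
  have h0 : ∀ t, rearr 0 t = 0 := fun t => by
    by_contra h
    have h1 := (lt_rearr_iff 0 t 0).1 (pos_iff_ne_zero.2 h)
    refine h1.not_ge (le_of_eq_of_le ?_ zero_le)
    refine measure_eq_zero_iff_ae_notMem.2 ?_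
    filter_upwards [AEEqFun.coeFn_zero (α := ℝ) (β := ℝ) (μ := m)] with u hu
    simp [hu]
  filter_upwards [AEEqFun.coeFn_mk ((Icc (0 : ℝ) 1).indicator (dilation s (rearrReal 0)))
    (((measurable_rearrReal 0).comp (measurable_id.div_const s)).indicator
      measurableSet_Icc).aestronglyMeasurable,
    AEEqFun.coeFn_zero (α := ℝ) (β := ℝ) (μ := m)] with u h1 h2
  rw [dilatedHead, h1, h2]
  simp [indicator, dilation, rearrReal, h0]

/-- The heads are bounded by one constant N and live on (0, 1], so their norms are bounded
independently of s; the factor 1/s does the rest. -/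
theorem phiFinEq_zero_of_bounded (hE : IsFullySymmetric ι) (hL1 : ∀ z : E, ι z ∈ L1) {x : E}
    (hx : 0 ≤ ι x) {M : ℝ} (hM : m {u | M < ι x u} = 0) : PhiFinEq ι (ι x) 0 := by
  refine phiFinEq_zero_of_forall fun ε hε => ?_
  rcases eq_or_ne x 0 with rfl | hx0
  · refine ⟨1, one_pos, fun s hs => ⟨0, ?_, ?_⟩⟩
    · rw [map_zero, dilatedHead_zero]
    · rw [norm_zero]; positivity
  obtain ⟨a, b, ha, hb, hab⟩ := exists_of_bounded hE hL1 hx hx0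
  set N := max M 1 with hN
  have hN0 : 0 < N := lt_max_of_lt_right one_pos
  have hr : ∀ t, 0 ≤ t → rearr (ι x) t ≤ ENNReal.ofReal N := by
    intro t ht
    by_contra! hlt
    have h1 := (lt_rearr_iff _ _ _).1 hlt
    refine h1.not_ge (le_of_eq_of_le ?_ zero_le)
    refine measure_mono_null_ae ?_ hM
    filter_upwards [coe_nonneg hx] with u hu hu'
    have h2 : ENNReal.ofReal N < ‖ι x u‖ₑ := hu'
    rw [Real.enorm_eq_ofReal hu, ENNReal.ofReal_lt_ofReal_iff_of_nonneg hN0.le] at h2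
    exact (le_max_left _ _).trans_lt h2
  -- Chosen so that both κa and κb are at least N, bounding the head and its integral.
  set κ := N / a + N / b with hκ
  have hκ0 : 0 ≤ κ := by positivity
  refine ⟨κ * ‖x‖ / ε + 1, by positivity, fun s hs => ?_⟩
  have hs0 : 0 < s := lt_of_lt_of_le (by positivity) hs
  have hle : ∀ᵐ u ∂m, ‖dilatedHead s (ι x) u‖ₑ ≤
      (Ioc (0 : ℝ) 1).indicator (fun _ => ENNReal.ofReal N) u := by
    filter_upwards [enorm_dilatedHead (hL1 x) hs0] with u hu
    rw [hu]
    by_cases h : u ∈ Ioc (0 : ℝ) 1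
    · rw [indicator_of_mem h, indicator_of_mem h]
      exact hr _ (div_nonneg h.1.le hs0.le)
    · rw [indicator_of_notMem h, indicator_of_notMem h]
  have h0 := dilatedHead_nonneg s (ι x)
  have hb1 : ∀ᵐ u ∂m, dilatedHead s (ι x) u ≤ κ * a := by
    filter_upwards [hle, coe_nonneg h0] with u h1 h2
    have h3 := h1.trans (indicator_le_self' (fun _ _ => zero_le) u)
    rw [Real.enorm_eq_ofReal h2, ENNReal.ofReal_le_ofReal_iff hN0.le] at h3
    refine h3.trans ?_
    have h4 : κ * a = N + N / b * a := by rw [hκ]; field_simp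
    rw [h4]
    have : 0 ≤ N / b * a := by positivity
    linarith
  have hb2 : exc (dilatedHead s (ι x)) 0 ≤ ENNReal.ofReal (κ * b) := by
    rw [← lintegral_enorm_sub_eq_exc (coe_nonneg h0) le_rfl]
    simp only [ENNReal.ofReal_zero, tsub_zero]
    refine (lintegral_mono_ae hle).trans ?_
    rw [lintegral_indicator measurableSet_Ioc, setLIntegral_const, m_Ioc, ENNReal.ofReal_one,
      mul_one]
    refine ENNReal.ofReal_le_ofReal ?_
    have h4 : κ * b = N + N / a * b := by rw [hκ]; field_simp; ring
    rw [h4]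
    have : 0 ≤ N / a * b := by positivity
    linarith
  obtain ⟨z, hz, hzn⟩ := hab κ hκ0 (dilatedHead s (ι x)) h0 hb1 hb2
  refine ⟨z, hz, hzn.trans ?_⟩
  have : κ * ‖x‖ / ε ≤ s := by linarith
  rwa [div_le_iff₀ hε] at this

theorem ofReal_sum_smul {κ : Type*} [Fintype κ] {l : κ → ℝ} (hl : ∀ i, 0 ≤ l i)
    {z : κ → L0} (hz : ∀ i, 0 ≤ z i) : ∀ᵐ u ∂m, ENNReal.ofReal ((∑ i, l i • z i : L0) u) =
      ∑ i, ENNReal.ofReal (l i) * ENNReal.ofReal (z i u) := by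
  filter_upwards [coeFn_sum Finset.univ fun i => l i • z i,
    ae_all_iff.2 fun i => AEEqFun.coeFn_smul (l i) (z i),
    ae_all_iff.2 fun i => coe_nonneg (hz i)] with u h1 h2 h3
  rw [h1, ENNReal.ofReal_sum_of_nonneg]
  · refine Finset.sum_congr rfl fun i _ => ?_
    rw [h2, Pi.smul_apply, smul_eq_mul, ENNReal.ofReal_mul (hl i)]
  · intro i _
    rw [h2]
    exact mul_nonneg (hl i) (h3 i)

/-- The indicator of {x ≥ 1} lies in the orbit but is bounded, while every nonzero extreme point
reproduces the large values of x. A convex combination of extreme points close to this indicator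
must therefore differ from it by a fixed multiple of the head of x*, so that head has small norm
after dilation. -/
theorem phiFinEq_zero_of_unbounded (hE : IsFullySymmetric ι) (hL1 : ∀ z : E, ι z ∈ L1) {x : E}
    (hx : 0 ≤ ι x) (hunb : ∀ M, m {u | M < ι x u} ≠ 0)
    (hQ : OmegaPlus (ι x) ⊆ QPlus ι (ι x)) : PhiFinEq ι (ι x) 0 := by
  refine phiFinEq_zero_of_forall fun ε hε => ?_
  have hxi := mem_L1_iff.1 (hL1 x)
  set A := {u | 1 ≤ ι x u} with hA
  have hAm : MeasurableSet A := measurableSet_le measurable_const (AEEqFun.measurable _)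
  have hAf : m A ≠ ∞ := meas_le_ne_top hxi one_pos
  have hA0 : 0 < m.real A := by
    refine ENNReal.toReal_pos (fun h => hunb 1 (measure_mono_null (fun u hu => ?_) h)) hAf
    exact le_of_lt (show 1 < ι x u from hu)
  have hind := coe_indL A hAm
  have hyΩ : (indL A hAm : L0) ∈ OmegaPlus (ι x) := by
    rw [mem_OmegaPlus_iff hx (hL1 x)]
    have hle : (indL A hAm : L0) ≤ᵐ[m] ι x := by
      filter_upwards [hind, coe_nonneg hx] with u h1 h2
      rw [h1]
      by_cases hu : u ∈ A
      · rw [indicator_of_mem hu]; exact hu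
      · rw [indicator_of_notMem hu]; exact h2
    refine ⟨nonneg_of_coe ?_, mem_L1_iff.2 ?_, fun c _ => exc_mono hle c⟩
    · filter_upwards [hind] with u h1
      rw [h1]
      exact indicator_nonneg (fun _ _ => zero_le_one) u
    · exact ((integrable_indicator_iff hAm).2 (integrableOn_const hAf)).congr hind.symm
  obtain ⟨e, he, hey⟩ := hQ hyΩ
  obtain ⟨C, hC, hCb⟩ := exists_setLIntegral_le_norm hE hL1 hAm hAf
  set I := excR (ι x) 0 with hI
  have hI0 : 0 ≤ I := excR_nonneg _ _
  set Λ₀ := m.real A / (2 * (I + 1)) with hΛ₀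
  have hΛ₀0 : 0 < Λ₀ := by positivity
  -- The first bound makes the integral of |v| over A at most m(A)/2, which keeps the weight of the
  -- nonzero extreme points above Λ₀. The second gives (2/Λ)‖v‖ ≤ ε at the end.
  set δ := min (m.real A / (2 * (C + 1))) (ε * Λ₀ / 2) with hδ
  have hδ0 : 0 < δ := lt_min (by positivity) (by positivity)
  obtain ⟨w, hw, hwd⟩ := Metric.mem_closure_iff.1 he δ hδ0
  obtain ⟨κ, _, l, z, hl, hl1, hz, hlz⟩ := mem_convexHull_iff_exists_fintype.1 hw
  set v := w - e with hv
  have hvn : ‖v‖ < δ := by rwa [dist_comm, dist_eq_norm] at hwd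
  have hzΩ : ∀ i, 0 ≤ z i ∧ z i ∈ L1 ∧ ∀ c, 0 ≤ c → exc (z i) c ≤ exc (ι x) c :=
    fun i => (mem_OmegaPlus_iff hx (hL1 x)).1 (hz i).1
  have hcomb : ∀ᵐ u ∂m, ENNReal.ofReal (ι w u) =
      ∑ i, ENNReal.ofReal (l i) * ENNReal.ofReal (z i u) := by
    rw [← hlz]
    exact ofReal_sum_smul hl fun i => (hzΩ i).1
  have hcombi : ∀ S : Set ℝ, ∫⁻ u in S, ENNReal.ofReal (ι w u) ∂m =
      ∑ i, ENNReal.ofReal (l i) * ∫⁻ u in S, ENNReal.ofReal (z i u) ∂m := fun S => by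
    rw [lintegral_congr_ae (ae_restrict_of_ae hcomb), lintegral_finsetSum _ fun i _ =>
      (AEEqFun.measurable (z i)).ennreal_ofReal.const_mul _]
    exact Finset.sum_congr rfl fun i _ =>
      lintegral_const_mul _ (AEEqFun.measurable (z i)).ennreal_ofReal
  classical
  set Λ := ∑ i with z i ≠ 0, l i with hΛ
  have hΛsum : ∀ X : ℝ≥0∞, ENNReal.ofReal Λ * X = ∑ i with z i ≠ 0, ENNReal.ofReal (l i) * X :=
    fun X => by rw [hΛ, ENNReal.ofReal_sum_of_nonneg fun i _ => hl i, Finset.sum_mul]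
  have hΛ0 : 0 ≤ Λ := Finset.sum_nonneg fun i _ => hl i
  have hveq : ∀ᵐ u ∂m, ι v u = ι w u - A.indicator 1 u := by
    rw [hv, map_sub, hey]
    filter_upwards [AEEqFun.coeFn_sub (ι w) (indL A hAm : L0), hind] with u h1 h2
    rw [h1, Pi.sub_apply, h2]
  -- Mass on A: each extreme point has integral at most I and the zero ones contribute nothing, so
  -- m(A) ≤ ΛI + C‖v‖ ≤ ΛI + m(A)/2.
  have hΛΛ₀ : Λ₀ ≤ Λ := by
    have h1 : m A ≤ ENNReal.ofReal Λ * ENNReal.ofReal I + ENNReal.ofReal (C * ‖v‖) :=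
      calc m A = ∫⁻ u in A, 1 ∂m := by rw [setLIntegral_one]
        _ ≤ ∫⁻ u in A, (ENNReal.ofReal (ι w u) + ‖ι v u‖ₑ) ∂m := by
            refine lintegral_mono_ae ?_
            filter_upwards [ae_restrict_of_ae hveq, ae_restrict_mem hAm] with u h1 h2
            rw [indicator_of_mem h2, Pi.one_apply] at h1
            rw [← ENNReal.ofReal_one, Real.enorm_eq_ofReal_abs]
            refine le_trans (ENNReal.ofReal_le_ofReal ?_) ENNReal.ofReal_add_le
            have := neg_le_abs (ι v u)
            linarith
        _ = ∑ i, ENNReal.ofReal (l i) * ∫⁻ u in A, ENNReal.ofReal (z i u) ∂m +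
            ∫⁻ u in A, ‖ι v u‖ₑ ∂m := by
            rw [lintegral_add_left (AEEqFun.measurable _).ennreal_ofReal, hcombi]
        _ ≤ ENNReal.ofReal Λ * ENNReal.ofReal I + ENNReal.ofReal (C * ‖v‖) := by
            refine add_le_add ?_ (hCb v)
            rw [hΛsum, ← Finset.sum_filter_add_sum_filter_not Finset.univ (fun i => z i ≠ 0)]
            have h2 : ∑ i with ¬ z i ≠ 0, ENNReal.ofReal (l i) *
                ∫⁻ u in A, ENNReal.ofReal (z i u) ∂m = 0 := by
              refine Finset.sum_eq_zero fun i hi => ?_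
              have hi0 : z i = 0 := not_not.1 (Finset.mem_filter.1 hi).2
              have : ∫⁻ u in A, ENNReal.ofReal (z i u) ∂m = 0 := by
                rw [hi0]
                refine (lintegral_congr_ae (ae_restrict_of_ae ?_)).trans lintegral_zero
                filter_upwards [AEEqFun.coeFn_zero (α := ℝ) (β := ℝ) (μ := m)] with u hu
                simp [hu]
              rw [this, mul_zero]
            rw [h2, add_zero]
            refine Finset.sum_le_sum fun i _ => ?_
            gcongr
            rw [hI, ← exc_eq_ofReal_excR hxi le_rfl]
            refine (setLIntegral_le_lintegral _ _).trans (le_trans ?_ ((hzΩ i).2.2 0 le_rfl))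
            simp [exc]
    rw [← ENNReal.ofReal_mul hΛ0, ← ENNReal.ofReal_add (by positivity) (by positivity),
      ← ENNReal.ofReal_toReal hAf, ENNReal.ofReal_le_ofReal_iff (by positivity)] at h1
    have h1' : m.real A ≤ Λ * I + C * ‖v‖ := h1
    have h2 : C * ‖v‖ ≤ m.real A / 2 := by
      have h3 : ‖v‖ ≤ m.real A / (2 * (C + 1)) := hvn.le.trans (min_le_left _ _)
      calc C * ‖v‖ ≤ (C + 1) * (m.real A / (2 * (C + 1))) := by gcongr; linarith
        _ = m.real A / 2 := by field_simp
    rw [hΛ₀, div_le_iff₀ (by positivity)]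
    nlinarith
  have hΛpos : 0 < Λ := hΛ₀0.trans_le hΛΛ₀
  set N : ℝ := ((Fintype.card κ : ℕ) : ℝ) with hN
  -- There are finitely many extreme points, so one range of τ serves all of them. For a zero one
  -- any set of measure τ will do.
  have hev : ∀ᶠ τ in 𝓝[>] (0 : ℝ), ∀ i, ∃ S, MeasurableSet S ∧ m S = ENNReal.ofReal τ ∧
      (z i ≠ 0 → ∫⁻ s in Ioc 0 τ, rearr (ι x) s ≤ ∫⁻ u in S, ENNReal.ofReal (z i u) ∂m) := by
    refine eventually_all.2 fun i => ?_
    by_cases h0 : z i = 0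
    · exact Eventually.of_forall fun τ => ⟨Ioc 0 τ, measurableSet_Ioc, m_Ioc τ,
        fun h => absurd h0 h⟩
    · obtain ⟨τ₀, hτ₀, h⟩ := exists_measure_eq_setLIntegral_ge hx (hL1 x) hunb (hz i) h0
      filter_upwards [Ioo_mem_nhdsGT hτ₀] with τ hτ
      obtain ⟨S, hS, hSm, hSz⟩ := h τ hτ.1 hτ.2
      exact ⟨S, hS, hSm, fun _ => hSz⟩
  obtain ⟨τ₁, hτ₁, hsub⟩ := mem_nhdsGT_iff_exists_Ioo_subset.1 hev
  have hτ₁0 : 0 < τ₁ := hτ₁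
  -- With this K the measure Nτ of the union of the sets, which bounds the contribution of the
  -- indicator, is at most half of Λ∫₀^τ x*.
  obtain ⟨τ₂, hτ₂, hX⟩ := le_setLIntegral_rearr_of_unbounded hx hunb (K := 2 * N / Λ)
    (by positivity)
  have key : ∀ τ t : ℝ, 0 < τ → τ < τ₁ → τ < τ₂ → N * τ ≤ t →
      ENNReal.ofReal (Λ / 2) * ∫⁻ s in Ioc 0 τ, rearr (ι x) s ≤
        ∫⁻ s in Ioc 0 t, rearr (ι v) s := by
    intro τ t hτ h1 h2 hNt
    have hS' : ∀ i, ∃ S, MeasurableSet S ∧ m S = ENNReal.ofReal τ ∧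
      (z i ≠ 0 → ∫⁻ s in Ioc 0 τ, rearr (ι x) s ≤ ∫⁻ u in S, ENNReal.ofReal (z i u) ∂m) :=
      hsub ⟨hτ, h1⟩
    choose S hS hSm hSz using hS'
    set X := ∫⁻ s in Ioc 0 τ, rearr (ι x) s with hXdef
    have hXf : X ≠ ∞ := (setLIntegral_rearr_lt_top (hL1 x) τ).ne
    have hmU : m (⋃ i, S i) ≤ ENNReal.ofReal (N * τ) := by
      refine (measure_iUnion_fintype_le m S).trans ?_
      simp only [hSm, Finset.sum_const, Finset.card_univ, nsmul_eq_mul]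
      rw [hN, ENNReal.ofReal_mul (by positivity), ENNReal.ofReal_natCast]
    -- On the union of the S i, w is at most |v| + 1. The union has measure at most Nτ ≤ t, so the
    -- integral of |v| over it is at most ∫₀ᵗ v*.
    have h3 : ENNReal.ofReal Λ * X ≤
        (∫⁻ s in Ioc 0 t, rearr (ι v) s) + ENNReal.ofReal (N * τ) :=
      calc ENNReal.ofReal Λ * X
          ≤ ∑ i, ENNReal.ofReal (l i) * ∫⁻ u in ⋃ i, S i, ENNReal.ofReal (z i u) ∂m := by
            rw [hΛsum]
            refine (Finset.sum_le_sum fun i hi => ?_).trans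
              (Finset.sum_le_sum_of_subset (Finset.filter_subset _ _))
            gcongr
            exact (hSz i (Finset.mem_filter.1 hi).2).trans
              (lintegral_mono_set (subset_iUnion S i))
        _ = ∫⁻ u in ⋃ i, S i, ENNReal.ofReal (ι w u) ∂m := (hcombi _).symm
        _ ≤ ∫⁻ u in ⋃ i, S i, (‖ι v u‖ₑ + 1) ∂m := by
            refine lintegral_mono_ae (ae_restrict_of_ae (hveq.mono fun u hu => ?_))
            rw [← ENNReal.ofReal_one, Real.enorm_eq_ofReal_abs]
            refine le_trans (ENNReal.ofReal_le_ofReal ?_) ENNReal.ofReal_add_le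
            have h4 := le_abs_self (ι v u)
            have h5 : A.indicator (1 : ℝ → ℝ) u ≤ 1 :=
              indicator_le_self' (f := (1 : ℝ → ℝ)) (fun _ _ => zero_le_one) u
            linarith
        _ = ∫⁻ u in ⋃ i, S i, ‖ι v u‖ₑ ∂m + m (⋃ i, S i) := by
            rw [lintegral_add_right _ measurable_const, setLIntegral_one]
        _ ≤ _ := add_le_add (setLIntegral_enorm_le_rearr _
            (hmU.trans (ENNReal.ofReal_le_ofReal hNt))) hmU
    have h4 : ENNReal.ofReal (N * τ) ≤ ENNReal.ofReal (Λ / 2) * X := by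
      calc ENNReal.ofReal (N * τ) = ENNReal.ofReal (Λ / 2) * ENNReal.ofReal (2 * N / Λ * τ) := by
            rw [← ENNReal.ofReal_mul (by positivity)]
            congr 1; field_simp
        _ ≤ _ := by gcongr; exact hX τ hτ h2
    have h5 : ENNReal.ofReal Λ * X = ENNReal.ofReal (Λ / 2) * X + ENNReal.ofReal (Λ / 2) * X := by
      rw [← add_mul, ← ENNReal.ofReal_add (by positivity) (by positivity), add_halves]
    have h6 := h3.trans (add_le_add_right h4 _)
    rw [h5] at h6
    exact (ENNReal.add_le_add_iff_right (ENNReal.mul_ne_top ENNReal.ofReal_ne_top hXf)).1 h6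
  -- For such s the choice τ = min(t, 1)/s satisfies τ < τ₁, τ < τ₂ and Nτ ≤ t for every t > 0.
  refine ⟨1 / τ₁ + 1 / τ₂ + N + 1, by positivity, fun s hs => ?_⟩
  have hs1 : 0 < 1 / τ₁ := by positivity
  have hs2 : 0 < 1 / τ₂ := by positivity
  have hN0 : 0 ≤ N := by positivity
  have hs0 : 0 < s := by linarith
  have hκ0 : 0 < s * (2 / Λ) := by positivity
  have hsubm : Submajorized (dilatedHead s (ι x)) (ι ((s * (2 / Λ)) • v)) := by
    intro t ht
    rcases ht.eq_or_lt with rfl | ht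
    · simp
    refine (setLIntegral_rearr_dilatedHead_le (hL1 x) hs0 t).trans ?_
    rw [map_smul, setLIntegral_rearr_smul hκ0, ENNReal.ofReal_mul hs0.le, mul_assoc]
    gcongr
    set r := min t 1 with hr
    have hr0 : 0 < r := lt_min ht one_pos
    have hr1 : r ≤ 1 := min_le_right _ _
    have hlt : ∀ τ, 0 < τ → 1 / τ < s → r / s < τ := fun τ hτ h => by
      rw [div_lt_iff₀ hτ] at h
      rw [div_lt_iff₀ hs0]
      linarith
    have h1 := key (r / s) t (by positivity) (hlt τ₁ hτ₁0 (by linarith)) (hlt τ₂ hτ₂ (by linarith))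
      (by
        have : N / s ≤ 1 := by rw [div_le_one hs0]; linarith
        calc N * (r / s) = N / s * r := by ring
          _ ≤ 1 * r := by gcongr
          _ ≤ t := by rw [one_mul]; exact min_le_left _ _)
    calc ∫⁻ s in Ioc 0 (r / s), rearr (ι x) s
        = ENNReal.ofReal (2 / Λ) *
          (ENNReal.ofReal (Λ / 2) * ∫⁻ s in Ioc 0 (r / s), rearr (ι x) s) := by
          rw [← mul_assoc, ← ENNReal.ofReal_mul (by positivity)]
          have : 2 / Λ * (Λ / 2) = 1 := by field_simp
          rw [this, ENNReal.ofReal_one, one_mul]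
      _ ≤ _ := by gcongr
  obtain ⟨z', hz', hzn⟩ := hE.fully ((s * (2 / Λ)) • v) (dilatedHead s (ι x))
    (mem_L1Linfty_of_mem_L1 (dilatedHead_mem_L1 (hL1 x) hs0)) hsubm
  refine ⟨z', hz', hzn.trans ?_⟩
  rw [norm_smul, Real.norm_of_nonneg hκ0.le]
  have h1 : ‖v‖ ≤ ε * Λ₀ / 2 := hvn.le.trans (min_le_right _ _)
  calc s * (2 / Λ) * ‖v‖ ≤ s * (2 / Λ) * (ε * Λ / 2) := by
        gcongr
        refine h1.trans ?_
        gcongr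
    _ = s * ε := by field_simp

theorem phiFinEq_zero_of_subset_QPlus (hE : IsFullySymmetric ι) (hL1 : ∀ z : E, ι z ∈ L1) {x : E}
    (hx : 0 ≤ ι x) (hQ : OmegaPlus (ι x) ⊆ QPlus ι (ι x)) : PhiFinEq ι (ι x) 0 := by
  by_cases h : ∃ M, m {u | M < ι x u} = 0
  · exact phiFinEq_zero_of_bounded hE hL1 hx h.choose_spec
  · push Not at h
    exact phiFinEq_zero_of_unbounded hE hL1 hx h hQ

end Necessity

/-! ### Rotations of a decreasing function on a set of finite measure -/

/-- The map u ↦ m(B ∩ (-∞, u]) is monotone and 1-Lipschitz. For 0 ≤ a < l the preimage of (-∞, a] is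
a closed half-line whose end point is mapped to a, so it has measure a in B. -/
theorem exists_map_restrict_eq {B : Set ℝ} {l : ℝ} (hl : 0 ≤ l)
    (hBl : m B = ENNReal.ofReal l) :
    ∃ φ : ℝ → ℝ, Measurable φ ∧ Measure.map φ (m.restrict B) = volume.restrict (Ioc 0 l) := by
  have hBf : ∀ C, m.restrict B C ≠ ∞ := fun C =>
    ((measure_mono (subset_univ C)).trans_lt (by rw [Measure.restrict_apply_univ, hBl]; simp)).ne
  set μ := m.restrict B with hμ
  set φ : ℝ → ℝ := fun u => μ.real (Iic u) with hφ
  have hmono : Monotone φ := fun a b h =>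
    ENNReal.toReal_mono (hBf _) (measure_mono (Iic_subset_Iic.2 h))
  have hlip : ∀ a b, a ≤ b → φ b ≤ φ a + (b - a) := by
    intro a b h
    have h1 : μ (Iic b) ≤ μ (Iic a) + ENNReal.ofReal (b - a) := by
      rw [← Iic_union_Ioc_eq_Iic h]
      refine (measure_union_le _ _).trans (add_le_add_right ?_ _)
      refine (Measure.restrict_apply_le _ _).trans ((Measure.restrict_apply_le _ _).trans ?_)
      rw [Real.volume_Ioc]
    have h2 := ENNReal.toReal_mono (by finiteness [hBf (Iic a)]) h1
    rwa [ENNReal.toReal_add (hBf _) ENNReal.ofReal_ne_top,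
      ENNReal.toReal_ofReal (sub_nonneg.2 h)] at h2
  have hcont : Continuous φ := by
    refine (LipschitzWith.of_le_add fun a b => ?_).continuous
    rcases le_total a b with h | h
    · exact (hmono h).trans (le_add_of_nonneg_right dist_nonneg)
    · rw [Real.dist_eq, abs_of_nonneg (sub_nonneg.2 h)]
      exact hlip b a h
  have h0 : φ 0 = 0 := by
    have : μ (Iic 0) = 0 := by
      refine le_antisymm ((Measure.restrict_apply_le _ _).trans ?_) zero_le
      rw [Measure.restrict_apply measurableSet_Iic, Iic_inter_Ioi, Ioc_self, measure_empty]
    simp [hφ, Measure.real, this]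
  have hfin : IsFiniteMeasure μ := ⟨(hBf univ).lt_top⟩
  refine ⟨φ, hmono.measurable, Measure.ext_of_Iic _ _ fun a => ?_⟩
  rw [Measure.map_apply hmono.measurable measurableSet_Iic,
    Measure.restrict_apply measurableSet_Iic]
  have hφ0 : ∀ u, 0 ≤ φ u := fun u => ENNReal.toReal_nonneg
  rcases lt_or_ge a 0 with ha | ha
  · have h1 : φ ⁻¹' Iic a = ∅ := by
      ext u; simpa using ha.trans_le (hφ0 u)
    have h2 : Iic a ∩ Ioc 0 l = ∅ := by
      ext u
      simp only [mem_inter_iff, mem_Iic, mem_Ioc, mem_empty_iff_false, iff_false]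
      rintro ⟨h, h', -⟩; linarith
    rw [h1, h2, measure_empty, measure_empty]
  rcases le_or_gt l a with hla | hla
  · have h1 : φ ⁻¹' Iic a = univ := by
      refine eq_univ_of_forall fun u => le_trans ?_ hla
      have := ENNReal.toReal_mono (hBf univ) (measure_mono (μ := μ) (subset_univ (Iic u)))
      rwa [hμ, Measure.restrict_apply_univ, hBl, ENNReal.toReal_ofReal hl] at this
    have h2 : Iic a ∩ Ioc 0 l = Ioc 0 l := inter_eq_right.2 fun u hu => hu.2.trans hla
    rw [h1, h2, Real.volume_Ioc, hμ, Measure.restrict_apply_univ, hBl, sub_zero]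
  have h2 : Iic a ∩ Ioc 0 l = Ioc 0 a := by
    ext u
    simp only [mem_inter_iff, mem_Iic, mem_Ioc]
    exact ⟨fun h => ⟨h.2.1, h.1⟩, fun h => ⟨h.2, h.1, h.2.trans hla.le⟩⟩
  obtain ⟨b, hb⟩ : ∃ b, a < φ b := by
    by_contra! hcon
    have h3 : μ univ ≤ ENNReal.ofReal a := by
      have h4 : (⋃ k : ℕ, Iic (k : ℝ)) = univ := eq_univ_of_forall fun u => by
        obtain ⟨k, hk⟩ := exists_nat_ge u
        exact mem_iUnion.2 ⟨k, hk⟩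
      rw [← h4, Monotone.measure_iUnion (monotone_nat_of_le_succ fun k =>
        Iic_subset_Iic.2 (by simp))]
      refine iSup_le fun k => ?_
      rw [← ENNReal.ofReal_toReal (hBf (Iic (k : ℝ)))]
      exact ENNReal.ofReal_le_ofReal (hcon k)
    rw [hμ, Measure.restrict_apply_univ, hBl, ENNReal.ofReal_le_ofReal_iff ha] at h3
    exact h3.not_gt hla
  have hb0 : 0 ≤ b := by
    by_contra! h
    have := hmono h.le
    rw [h0] at this; linarith
  obtain ⟨c, hc, hca⟩ := intermediate_value_Icc hb0 hcont.continuousOn (show a ∈ Icc (φ 0) (φ b)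
    from ⟨by rw [h0]; exact ha, hb.le⟩)
  have hbdd : BddAbove (φ ⁻¹' Iic a) := ⟨b, fun u hu => by
    by_contra! h
    exact (hb.trans_le (hmono h.le)).not_ge hu⟩
  have hcm : c ∈ φ ⁻¹' Iic a := hca.le
  have hclosed : IsClosed (φ ⁻¹' Iic a) := isClosed_Iic.preimage hcont
  have hsup := hclosed.csSup_mem ⟨c, hcm⟩ hbdd
  have h1 : φ ⁻¹' Iic a = Iic (sSup (φ ⁻¹' Iic a)) := by
    ext u
    exact ⟨fun hu => le_csSup hbdd hu, fun hu => (hmono hu).trans hsup⟩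
  have h3 : φ (sSup (φ ⁻¹' Iic a)) = a :=
    le_antisymm hsup (hca.symm.le.trans (hmono (le_csSup hbdd hcm)))
  rw [h1, h2, Real.volume_Ioc, sub_zero, ← ENNReal.ofReal_toReal (hBf _)]
  exact congrArg ENNReal.ofReal h3

theorem disjoint_Ioc_add_mul {h : ℝ} (hh : 0 < h) (θ : ℝ) : Pairwise (Function.onFun Disjoint
    fun j : ℕ => Ioc (θ + j * h) (θ + (j + 1) * h)) := by
  have key : ∀ i j : ℕ, i < j → Disjoint (Ioc (θ + i * h) (θ + (i + 1) * h))
      (Ioc (θ + j * h) (θ + (j + 1) * h)) := fun i j hij => by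
    refine Set.disjoint_left.2 fun u hu hu' => ?_
    have : ((i : ℝ) + 1) * h ≤ j * h := by
      gcongr
      exact_mod_cast hij
    linarith [hu.2, hu'.1]
  intro i j hij
  rcases lt_or_gt_of_ne hij with h | h
  · exact key i j h
  · exact (key j i h).symm

theorem iUnion_Ioc_mul {h : ℝ} (hh : 0 < h) (n : ℕ) :
    ⋃ j ∈ Finset.range n, Ioc ((j : ℝ) * h) ((j + 1) * h) = Ioc 0 (n * h) := by
  induction n with
  | zero => simp
  | succ n ih =>
    rw [Finset.range_add_one, Finset.set_biUnion_insert, ih, union_comm, Nat.cast_succ,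
      Ioc_union_Ioc_eq_Ioc (by positivity) (by gcongr; linarith)]

/-- Each term after the first is at most the integral over the interval of length h to its left, so
a Riemann sum exceeds the integral by at most its first term. -/
theorem sum_antitone_le_lintegral {F : ℝ → ℝ≥0∞} (hF : Antitone F) {h : ℝ} (hh : 0 < h) {θ : ℝ}
    (hθ : 0 < θ) (n : ℕ) :
    ∑ j ∈ Finset.range (n + 1), ENNReal.ofReal h * F (θ + j * h) ≤
      ENNReal.ofReal h * F θ + ∫⁻ v, F v ∂m := by
  rw [Finset.sum_range_succ', add_comm]
  refine add_le_add (by simp) ?_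
  calc ∑ j ∈ Finset.range n, ENNReal.ofReal h * F (θ + (j + 1 : ℕ) * h)
      ≤ ∑ j ∈ Finset.range n, ∫⁻ v in Ioc (θ + j * h) (θ + (j + 1) * h), F v ∂m := by
        refine Finset.sum_le_sum fun j _ => ?_
        have h1 : m (Ioc (θ + j * h) (θ + (j + 1) * h)) = ENNReal.ofReal h := by
          rw [Measure.restrict_apply measurableSet_Ioc, inter_eq_left.2, Real.volume_Ioc]
          · congr 1; ring
          · intro u hu
            have : 0 ≤ (j : ℝ) * h := by positivity
            exact mem_Ioi.2 (by linarith [hu.1])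
        rw [← h1, mul_comm, ← setLIntegral_const]
        refine setLIntegral_mono' measurableSet_Ioc fun v hv => hF ?_
        push_cast
        exact hv.2
    _ = ∫⁻ v in ⋃ j ∈ Finset.range n, Ioc (θ + j * h) (θ + (j + 1) * h), F v ∂m := by
        rw [lintegral_biUnion_finset _ fun j _ => measurableSet_Ioc]
        exact fun i _ j _ hij => disjoint_Ioc_add_mul hh θ hij
    _ ≤ ∫⁻ v, F v ∂m := setLIntegral_le_lintegral _ _

/-- Each term dominates the integral over the interval to its right. As θ ≤ h, these intervals cover
everything between h and nh, so the sum falls short by at most the integral over (0, h]. -/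
theorem lintegral_le_sum_antitone {F : ℝ → ℝ≥0∞} (hF : Antitone F) {h : ℝ} (hh : 0 < h) {θ : ℝ}
    (hθ : 0 < θ) (hθh : θ ≤ h) (n : ℕ) (hF0 : ∀ v, n * h ≤ v → F v = 0) :
    ∫⁻ v, F v ∂m ≤ ∫⁻ v in Ioc 0 h, F v ∂m +
      ∑ j ∈ Finset.range n, ENNReal.ofReal h * F (θ + j * h) := by
  have hcov : ∀ v, 0 < v → F v ≤ (Ioc 0 h).indicator F v +
      ∑ j ∈ Finset.range n, (Ioc (θ + j * h) (θ + (j + 1) * h)).indicator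
        (fun _ => F (θ + j * h)) v := by
    intro v hv
    by_cases h1 : v ≤ h
    · rw [indicator_of_mem (show v ∈ Ioc 0 h from ⟨hv, h1⟩)]
      exact le_self_add
    · by_cases h2 : n * h ≤ v
      · rw [hF0 v h2]; exact zero_le
      · have h3 : v - θ ∈ ⋃ j ∈ Finset.range n, Ioc ((j : ℝ) * h) ((j + 1) * h) := by
          rw [iUnion_Ioc_mul hh]
          exact ⟨by linarith, by linarith⟩
        simp only [mem_iUnion] at h3
        obtain ⟨j, hj, hjv⟩ := h3
        have h4 : v ∈ Ioc (θ + j * h) (θ + (j + 1) * h) := ⟨by linarith [hjv.1], by linarith [hjv.2]⟩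
        refine le_trans ?_ le_add_self
        refine le_trans ?_ (Finset.single_le_sum (fun _ _ => zero_le) hj)
        rw [indicator_of_mem h4]
        exact hF h4.1.le
  calc ∫⁻ v, F v ∂m ≤ ∫⁻ v, ((Ioc 0 h).indicator F v +
      ∑ j ∈ Finset.range n, (Ioc (θ + j * h) (θ + (j + 1) * h)).indicator
        (fun _ => F (θ + j * h)) v) ∂m :=
        lintegral_mono_ae ((ae_restrict_mem measurableSet_Ioi).mono fun v hv => hcov v hv)
    _ = ∫⁻ v in Ioc 0 h, F v ∂m + ∑ j ∈ Finset.range n,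
          F (θ + j * h) * m (Ioc (θ + j * h) (θ + (j + 1) * h)) := by
        rw [lintegral_add_left (hF.measurable.indicator measurableSet_Ioc),
          lintegral_indicator measurableSet_Ioc, lintegral_finsetSum]
        · simp_rw [lintegral_indicator measurableSet_Ioc, setLIntegral_const]
        · exact fun j _ => measurable_const.indicator measurableSet_Ioc
    _ ≤ _ := by
        refine add_le_add le_rfl (Finset.sum_le_sum fun j _ => ?_)
        rw [mul_comm]
        gcongr
        refine (Measure.restrict_apply_le _ _).trans ?_
        rw [Real.volume_Ioc]
        exact ENNReal.ofReal_le_ofReal (by linarith)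

theorem lintegral_restrict_Ioc_mul {h : ℝ} (hh : 0 < h) (n : ℕ) (g : ℝ → ℝ≥0∞) :
    ∫⁻ v in Ioc 0 (n * h), g v =
      ∑ j : Fin n, ∫⁻ v in Ioc 0 h, g (v + (j : ℕ) * h) := by
  rw [← iUnion_Ioc_mul hh, lintegral_biUnion_finset _ fun j _ => measurableSet_Ioc,
    Finset.sum_range]
  · refine Finset.sum_congr rfl fun j _ => ?_
    have h1 := (measurePreserving_add_right volume ((j : ℕ) * h : ℝ)).setLIntegral_comp_preimage_emb
      (measurableEmbedding_addRight _) g (Ioc (((j : ℕ) : ℝ) * h) ((((j : ℕ) : ℝ) + 1) * h))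
    rw [← h1]
    congr 2
    ext v
    simp only [mem_preimage, mem_Ioc]
    constructor <;> rintro ⟨h1, h2⟩ <;> constructor <;> linarith
  · intro i _ j _ hij
    have := disjoint_Ioc_add_mul hh 0 hij
    simpa only [Function.onFun, zero_add] using this

/-- The function `F` on `(0, nh]`, with the intervals `(jh, (j + 1)h]` permuted cyclically. -/
def rotate (n : ℕ) (h : ℝ) (F : ℝ → ℝ≥0∞) (k : Fin n) (v : ℝ) : ℝ≥0∞ :=
  ∑ j : Fin n, (Ioc (((j : ℕ) : ℝ) * h) ((((j : ℕ) : ℝ) + 1) * h)).indicator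
    (fun v => F (v - (j : ℕ) * h + ((j + k : Fin n) : ℕ) * h)) v

theorem measurable_rotate (n : ℕ) (h : ℝ) {F : ℝ → ℝ≥0∞} (hF : Measurable F) (k : Fin n) :
    Measurable (rotate n h F k) :=
  Finset.measurable_fun_sum _ fun j _ => (hF.comp (by fun_prop)).indicator measurableSet_Ioc

theorem rotate_apply {n : ℕ} {h : ℝ} (hh : 0 < h) (F : ℝ → ℝ≥0∞) (k j : Fin n) {θ : ℝ}
    (hθ : θ ∈ Ioc 0 h) : rotate n h F k (θ + (j : ℕ) * h) =
      F (θ + ((j + k : Fin n) : ℕ) * h) := by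
  have hj : θ + (j : ℕ) * h ∈ Ioc (((j : ℕ) : ℝ) * h) ((((j : ℕ) : ℝ) + 1) * h) :=
    ⟨by linarith [hθ.1], by linarith [hθ.2]⟩
  rw [rotate, Finset.sum_eq_single j]
  · rw [indicator_of_mem hj, add_sub_cancel_right]
  · intro i _ hij
    refine indicator_of_notMem (fun hi => ?_) _
    have := disjoint_Ioc_add_mul hh 0 (fun h' => hij (Fin.ext h') : (i : ℕ) ≠ j)
    simp only [Function.onFun, zero_add] at this
    exact Set.disjoint_left.1 this hi hj
  · simp

/-- Transport the n cyclic rotations of F to B by a measure-preserving map. Each is equimeasurable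
with F. At a point whose image lies at offset θ in its interval, the n values are F(θ + kh), k < n,
in cyclic order, so their sum is a Riemann sum depending only on θ. -/
theorem exists_rotation {B : Set ℝ} {l : ℝ} (hl : 0 < l) (hBl : m B = ENNReal.ofReal l)
    {F : ℝ → ℝ≥0∞} (hF : Antitone F) (hF0 : ∀ v, l ≤ v → F v = 0) (hFi : ∫⁻ v, F v ∂m ≠ ∞)
    {n : ℕ} (hn : 0 < n) :
    ∃ Z : Fin n → ℝ → ℝ≥0∞, (∀ k, Measurable (Z k)) ∧
      (∀ k c, ∫⁻ u in B, (Z k u - c) ∂m = ∫⁻ v, (F v - c) ∂m) ∧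
      ∀ᵐ u ∂m.restrict B, (∀ k, Z k u ≠ ∞ ∧ ∃ v, Z k u = F v) ∧
        (∃ k, ENNReal.ofReal (l / n) * ∑ k, Z k u ≤
          ENNReal.ofReal (l / n) * Z k u + ∫⁻ v, F v ∂m) ∧
        ∫⁻ v, F v ∂m ≤
          ∫⁻ v in Ioc 0 (l / n), F v ∂m + ENNReal.ofReal (l / n) * ∑ k, Z k u := by
  obtain ⟨φ, hφ, hφB⟩ := exists_map_restrict_eq hl.le hBl
  have hn' : (0 : ℝ) < n := Nat.cast_pos.2 hn
  have : NeZero n := ⟨hn.ne'⟩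
  set h := l / n with hh
  have hh0 : 0 < h := by positivity
  have hnh : n * h = l := by rw [hh]; field_simp
  have hfin : ∀ v, 0 < v → F v ≠ ∞ := by
    intro v hv htop
    refine hFi (top_le_iff.1 ?_)
    calc ∞ = ∫⁻ _ in Ioc 0 v, (∞ : ℝ≥0∞) ∂m := by
          rw [setLIntegral_const, m_Ioc, ENNReal.top_mul (by simpa using hv)]
      _ ≤ ∫⁻ s in Ioc 0 v, F s ∂m := setLIntegral_mono' measurableSet_Ioc fun s hs => by
          rw [← htop]; exact hF hs.2
      _ ≤ _ := setLIntegral_le_lintegral _ _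
  refine ⟨fun k u => rotate n h F k (φ u), fun k => (measurable_rotate n h hF.measurable k).comp hφ,
    fun k c => ?_, ?_⟩
  · rw [← lintegral_map (f := fun v => rotate n h F k v - c)
      ((measurable_rotate n h hF.measurable k).sub_const c) hφ, hφB, ← hnh,
      lintegral_restrict_Ioc_mul hh0]
    have h1 : ∀ j : Fin n, ∫⁻ v in Ioc 0 h, (rotate n h F k (v + (j : ℕ) * h) - c) =
        ∫⁻ v in Ioc 0 h, (F (v + ((j + k : Fin n) : ℕ) * h) - c) := fun j =>
      setLIntegral_congr_fun measurableSet_Ioc fun v hv => by rw [rotate_apply hh0 F k j hv]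
    simp_rw [h1]
    have h2 := Equiv.sum_comp (Equiv.addRight k)
      (fun j : Fin n => ∫⁻ v in Ioc 0 h, (F (v + (j : ℕ) * h) - c))
    simp only [Equiv.coe_addRight] at h2
    rw [h2, ← lintegral_restrict_Ioc_mul hh0 n fun v => F v - c, hnh, ← m_restrict_Ioc,
      ← lintegral_indicator measurableSet_Ioc]
    refine lintegral_congr_ae ((ae_restrict_mem measurableSet_Ioi).mono fun v hv => ?_)
    by_cases hvl : v ≤ l
    · rw [indicator_of_mem (show v ∈ Ioc 0 l from ⟨hv, hvl⟩)]
    · rw [indicator_of_notMem (fun h' => hvl h'.2)]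
      simp only [hF0 v (not_le.1 hvl).le, zero_tsub]
  · have hae : ∀ᵐ u ∂m.restrict B, φ u ∈ Ioc 0 l := by
      refine ae_of_ae_map hφ.aemeasurable ?_
      rw [hφB]
      exact ae_restrict_mem measurableSet_Ioc
    filter_upwards [hae] with u hu
    have hu' : φ u ∈ ⋃ j ∈ Finset.range n, Ioc ((j : ℝ) * h) ((j + 1) * h) := by
      rw [iUnion_Ioc_mul hh0, hnh]; exact hu
    simp only [mem_iUnion] at hu'
    obtain ⟨i, hi, hui⟩ := hu'
    set j : Fin n := ⟨i, Finset.mem_range.1 hi⟩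
    obtain ⟨θ, hθ⟩ : ∃ θ, θ = φ u - i * h := ⟨_, rfl⟩
    have hθm : θ ∈ Ioc 0 h := ⟨by linarith [hui.1], by linarith [hui.2]⟩
    have hφθ : φ u = θ + (j : ℕ) * h := by simp only [hθ, j]; ring
    simp only [hφθ, rotate_apply hh0 F _ j hθm]
    have hsum : ∑ k : Fin n, F (θ + ((j + k : Fin n) : ℕ) * h) =
        ∑ k ∈ Finset.range n, F (θ + k * h) := by
      rw [Finset.sum_range]
      exact Equiv.sum_comp (Equiv.addLeft j) (fun k : Fin n => F (θ + (k : ℕ) * h))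
    rw [hsum, Finset.mul_sum]
    -- Rotation by -j brings index j to 0, so it takes the value F(θ), the first and largest term of
    -- the Riemann sum.
    refine ⟨fun k => ⟨hfin _ (add_pos_of_pos_of_nonneg hθm.1 (by positivity)), _, rfl⟩,
      ⟨-j, ?_⟩, ?_⟩
    · obtain ⟨n', rfl⟩ := Nat.exists_eq_succ_of_ne_zero hn.ne'
      simpa using sum_antitone_le_lintegral hF hh0 hθm.1 n'
    · exact lintegral_le_sum_antitone hF hh0 hθm.1 hθm.2 n fun v hv => hF0 v (by rwa [← hnh])

/-! ### Inverses of decreasing functions -/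

/-- The generalized inverse on `(0, ∞)` of a decreasing function. -/
def decInv (ρ : ℝ → ℝ≥0∞) (θ : ℝ) : ℝ≥0∞ := m {c | ENNReal.ofReal θ < ρ c}

theorem decInv_antitone (ρ : ℝ → ℝ≥0∞) : Antitone (decInv ρ) := fun _ _ h =>
  measure_mono fun _ hc => (ENNReal.ofReal_le_ofReal h).trans_lt hc

theorem decInv_eq_zero {ρ : ℝ → ℝ≥0∞} {θ : ℝ} (h : ∀ c, ρ c ≤ ENNReal.ofReal θ) :
    decInv ρ θ = 0 := by
  have : {c | ENNReal.ofReal θ < ρ c} = ∅ := by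
    ext c; simpa using h c
  rw [decInv, this, measure_empty]

/-- If ρ is constant on (0, q), a superlevel set meeting (0, ∞) contains all of (0, q). This keeps
the values of the inverse in {0} ∪ [q, ∞], as the extremality criterion requires. -/
theorem decInv_eq_zero_or {ρ : ℝ → ℝ≥0∞} (hρ : Antitone ρ) {q : ℝ}
    (hq : ∀ c ∈ Ioo 0 q, ∀ c' ∈ Ioo 0 q, ρ c = ρ c') (θ : ℝ) :
    decInv ρ θ = 0 ∨ ENNReal.ofReal q ≤ decInv ρ θ := by
  rcases eq_or_ne (decInv ρ θ) 0 with h | h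
  · exact Or.inl h
  right
  rw [decInv, Measure.restrict_apply' measurableSet_Ioi] at h
  obtain ⟨c, hc, hc0⟩ := nonempty_of_measure_ne_zero h
  have hsub : Ioo 0 q ⊆ {c | ENNReal.ofReal θ < ρ c} := fun c' hc' => by
    have hc1 : ENNReal.ofReal θ < ρ c := hc
    rcases le_total c' c with h1 | h1
    · exact hc1.trans_le (hρ h1)
    · have : ρ c' = ρ c := hq c' hc' c ⟨hc0, h1.trans_lt hc'.2⟩
      rw [mem_ofPred_eq, this]; exact hc1
  calc ENNReal.ofReal q = m (Ioo 0 q) := by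
        rw [Measure.restrict_apply measurableSet_Ioo, inter_eq_left.2 fun u hu => hu.1,
          Real.volume_Ioo, sub_zero]
    _ ≤ _ := measure_mono hsub

/-- Both sides measure the part of the region under the graph of ρ to the right of c: superlevel
sets are initial intervals, so subtracting c from their length leaves the length beyond c. -/
theorem lintegral_decInv_sub {ρ : ℝ → ℝ≥0∞} (hρ : Antitone ρ) {c : ℝ} (hc : 0 ≤ c) :
    ∫⁻ θ, (decInv ρ θ - ENNReal.ofReal c) ∂m = ∫⁻ d in Ioi c, ρ d := by
  rw [lintegral_eq_lintegral_meas_ofReal_lt _ hρ.measurable]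
  refine lintegral_congr fun θ => ?_
  set S := {d | ENNReal.ofReal θ < ρ d} with hS
  have hSm : MeasurableSet S := measurableSet_lt measurable_const hρ.measurable
  have hsplit : m S = volume (S ∩ Ioc 0 c) + volume (S ∩ Ioi c) := by
    rw [Measure.restrict_apply hSm, ← Ioc_union_Ioi_eq_Ioi hc, inter_union_distrib_left]
    refine measure_union ?_ (hSm.inter measurableSet_Ioi)
    exact Set.disjoint_left.2 fun u hu hu' => hu.2.2.not_gt hu'.2
  rw [Measure.restrict_apply hSm, decInv, hsplit]
  rcases (S ∩ Ioi c).eq_empty_or_nonempty with h | ⟨d, hd, hdc⟩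
  · rw [h, measure_empty, add_zero]
    refine tsub_eq_zero_of_le ((measure_mono inter_subset_right).trans_eq ?_)
    rw [Real.volume_Ioc, sub_zero]
  · have : S ∩ Ioc 0 c = Ioc 0 c := inter_eq_right.2 fun u hu =>
      lt_of_lt_of_le hd (hρ (hu.2.trans (le_of_lt hdc)))
    rw [this, Real.volume_Ioc, sub_zero, ENNReal.add_sub_cancel_left ENNReal.ofReal_ne_top]

theorem exc_eq_setLIntegral {g : ℝ → ℝ} (hg : Measurable g) (c : ℝ) :
    exc g c = ∫⁻ d in Ioi c, m {u | d < g u} := by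
  rw [exc, lintegral_eq_lintegral_meas_ofReal_lt m (hg.sub_const c).ennreal_ofReal]
  have h1 := (measurePreserving_add_right volume c).setLIntegral_comp_preimage_emb
    (measurableEmbedding_addRight _) (fun d => m {u | d < g u}) (Ioi c)
  rw [← h1]
  have h2 : (fun x => x + c) ⁻¹' Ioi c = Ioi 0 := by
    ext x; simp
  rw [h2]
  refine setLIntegral_congr_fun measurableSet_Ioi fun d hd => ?_
  have hd' : 0 < d := hd
  congr 1
  ext u
  simp only [mem_ofPred_eq]
  rw [ENNReal.ofReal_lt_ofReal_iff_of_nonneg hd'.le, lt_sub_iff_add_lt]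

/-! ### Images of level sets -/

section Levels

variable {T : L1Linfty →ₗ[ℝ] L1Linfty} {f : L1Linfty} {g : ℝ → ℝ} {hg : Measurable g}

theorem measurableSet_level (hg : Measurable g) (c : ℝ) : MeasurableSet {u | c < g u} :=
  measurableSet_lt measurable_const hg

/-- The integral over `B` of the image of the indicator function of `{g > c}`. -/
def levelInt (T : L1Linfty →ₗ[ℝ] L1Linfty) (hg : Measurable g) (B : Set ℝ) (c : ℝ) : ℝ≥0∞ :=
  ∫⁻ u in B, ENNReal.ofReal ((T (indL _ (measurableSet_level hg c)) : L0) u) ∂m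

theorem indL_nonneg {S : Set ℝ} (hS : MeasurableSet S) : 0 ≤ ((indL S hS : L1Linfty) : L0) := by
  refine nonneg_of_coe ((coe_indL S hS).mono fun u hu => ?_)
  rw [hu]
  exact indicator_nonneg (fun _ _ => zero_le_one) u

theorem levelInt_antitone (hT : IsSubstochastic T) (B : Set ℝ) :
    Antitone (levelInt T hg B) := by
  intro c d h
  refine lintegral_mono_ae (ae_restrict_of_ae ?_)
  refine (hT.mono ?_).mono fun u hu => ENNReal.ofReal_le_ofReal hu
  filter_upwards [coe_indL _ (measurableSet_level hg c), coe_indL _ (measurableSet_level hg d)]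
    with u h1 h2
  rw [h1, h2]
  exact indicator_le_indicator_of_subset (fun u hu => h.trans_lt hu) (fun _ => zero_le_one) u

theorem levelInt_le (hT : IsSubstochastic T) (B : Set ℝ) (c : ℝ) : levelInt T hg B c ≤ m B := by
  have h1 : eLpNorm ((indL _ (measurableSet_level hg c) : L1Linfty) : L0) ∞ m ≤
      ENNReal.ofReal 1 := by
    rw [eLpNorm_exponent_top]
    refine eLpNormEssSup_le_of_ae_bound ?_
    filter_upwards [coe_indL _ (measurableSet_level hg c)] with u hu
    rw [hu]
    by_cases h : u ∈ {u | c < g u} <;> simp [h]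
  have h2 := (hT.contr_top _).trans h1
  rw [← setLIntegral_one]
  refine lintegral_mono_ae (ae_restrict_of_ae ?_)
  filter_upwards [ae_norm_le_of_eLpNorm_top (h2.trans_lt ENNReal.ofReal_lt_top).ne] with u hu
  have h3 := ENNReal.toReal_mono ENNReal.ofReal_ne_top h2
  rw [ENNReal.toReal_ofReal zero_le_one] at h3
  exact ENNReal.ofReal_le_one.2 ((le_abs_self _).trans (hu.trans h3))

theorem levelInt_eq {q : ℝ} (hgq : ∀ u, g u ≤ 0 ∨ q ≤ g u) (B : Set ℝ) :
    ∀ c ∈ Ioo 0 q, ∀ c' ∈ Ioo 0 q, levelInt T hg B c = levelInt T hg B c' := by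
  intro c hc c' hc'
  have key : ∀ d ∈ Ioo 0 q, {u | d < g u} = {u | q ≤ g u} := fun d hd => by
    ext u
    simp only [mem_ofPred_eq]
    refine ⟨fun h => (hgq u).resolve_left fun h' => ?_, fun h => hd.2.trans_le h⟩
    linarith [hd.1]
  have : indL _ (measurableSet_level hg c) = indL _ (measurableSet_level hg c') := by
    congr 1
    rw [key c hc, key c' hc']
  rw [levelInt, levelInt, this]

theorem sum_indicator_le {h : ℝ} (hh : 0 ≤ h) {a : ℝ} (ha : 0 ≤ a) (J : ℕ) :
    ∑ j ∈ Finset.range J, h * (if ((j : ℝ) + 1) * h < a then 1 else 0) ≤ min a (J * h) := by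
  induction J with
  | zero => simp [ha]
  | succ J ih =>
    rw [Finset.sum_range_succ]
    have h1 := le_min_iff.1 ih
    push_cast
    split_ifs with h2
    · refine le_min ?_ ?_ <;> nlinarith
    · refine le_min ?_ ?_ <;> nlinarith

theorem iUnion_Ioc_nat {h : ℝ} (hh : 0 < h) :
    Ioi h ⊆ ⋃ j : ℕ, Ioc (((j : ℝ) + 1) * h) (((j : ℝ) + 1) * h + h) := by
  intro u hu
  have hu' : h < u := hu
  obtain ⟨n, hn⟩ := exists_nat_ge (u / h)
  have hn' : u ≤ n * h := by rwa [div_le_iff₀ hh] at hn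
  have hmem : u - h ∈ ⋃ j ∈ Finset.range n, Ioc ((j : ℝ) * h) ((j + 1) * h) := by
    rw [iUnion_Ioc_mul hh]
    exact ⟨by linarith, by linarith⟩
  simp only [mem_iUnion] at hmem
  obtain ⟨j, -, hj⟩ := hmem
  exact mem_iUnion.2 ⟨j, by linarith [hj.1], by linarith [hj.2]⟩

/-- The finite sums of h times the indicators of {g > (j + 1)h} stay below g, so by positivity their
images stay below Tf. They dominate ∫ of the level integrals from h to infinity; then h tends to 0.
-/
theorem setLIntegral_levelInt_le (hT : IsSubstochastic T) (hg0 : ∀ u, 0 ≤ g u)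
    (hfg : (f : L0) =ᵐ[m] g) (B : Set ℝ) :
    ∫⁻ c in Ioi 0, levelInt T hg B c ≤ ∫⁻ u in B, ENNReal.ofReal ((T f : L0) u) ∂m := by
  have hanti := levelInt_antitone (hg := hg) hT B
  have key : ∀ h : ℝ, 0 < h → ∫⁻ c in Ioi h, levelInt T hg B c ≤
      ∫⁻ u in B, ENNReal.ofReal ((T f : L0) u) ∂m := by
    intro h hh
    refine (lintegral_mono_set (iUnion_Ioc_nat hh)).trans ((lintegral_iUnion_le _ _).trans ?_)
    refine ENNReal.tsum_le_of_sum_range_le fun J => ?_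
    calc ∑ j ∈ Finset.range J, ∫⁻ c in Ioc (((j : ℝ) + 1) * h) (((j : ℝ) + 1) * h + h),
          levelInt T hg B c
        ≤ ∑ j ∈ Finset.range J, ENNReal.ofReal h * levelInt T hg B (((j : ℝ) + 1) * h) := by
          refine Finset.sum_le_sum fun j _ => ?_
          have h1 : volume (Ioc (((j : ℝ) + 1) * h) (((j : ℝ) + 1) * h + h)) =
            ENNReal.ofReal h := by rw [Real.volume_Ioc, add_sub_cancel_left]
          rw [← h1, mul_comm (volume _), ← setLIntegral_const]
          exact setLIntegral_mono' measurableSet_Ioc fun c hc => hanti hc.1.le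
      _ = ∑ j : Fin J, ENNReal.ofReal h * levelInt T hg B ((((j : ℕ) : ℝ) + 1) * h) := by
          rw [Finset.sum_range]
      _ = ∫⁻ u in B, ∑ j : Fin J, ENNReal.ofReal h * ENNReal.ofReal
            ((T (indL _ (measurableSet_level hg ((((j : ℕ) : ℝ) + 1) * h))) : L0) u) ∂m := by
          rw [lintegral_finsetSum _ fun j _ =>
            (AEEqFun.measurable _).ennreal_ofReal.const_mul _]
          refine Finset.sum_congr rfl fun j _ => ?_
          rw [lintegral_const_mul _ (AEEqFun.measurable _).ennreal_ofReal, levelInt]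
      _ ≤ ∫⁻ u in B, ENNReal.ofReal ((T f : L0) u) ∂m := by
          refine lintegral_mono_ae (ae_restrict_of_ae ?_)
          have h2 := ofReal_sum_smul (l := fun _ : Fin J => h) (fun _ => hh.le)
            (z := fun j => (T (indL _ (measurableSet_level hg ((((j : ℕ) : ℝ) + 1) * h))) : L0))
            fun j => hT.pos _ (indL_nonneg _)
          have h3 : (T (∑ j : Fin J, h • indL _ (measurableSet_level hg ((((j : ℕ) : ℝ) + 1) * h)))
              : L0) ≤ᵐ[m] (T f : L0) := by
            refine hT.mono ?_
            rw [Submodule.coe_sum]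
            filter_upwards [hfg, coeFn_sum Finset.univ fun j : Fin J =>
                ((h • indL _ (measurableSet_level hg ((((j : ℕ) : ℝ) + 1) * h)) : L1Linfty) : L0),
              ae_all_iff.2 fun j : Fin J => AEEqFun.coeFn_smul h
                (indL _ (measurableSet_level hg ((((j : ℕ) : ℝ) + 1) * h)) : L0),
              ae_all_iff.2 fun j : Fin J =>
                coe_indL _ (measurableSet_level hg ((((j : ℕ) : ℝ) + 1) * h))]
              with u h4 h5 h6 h7
            rw [h4, h5]
            have h8 := (le_min_iff.1 (sum_indicator_le hh.le (hg0 u) J)).1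
            rw [Finset.sum_range] at h8
            refine le_trans (le_of_eq (Finset.sum_congr rfl fun j _ => ?_)) h8
            rw [Submodule.coe_smul, h6, Pi.smul_apply, h7, smul_eq_mul]
            simp [indicator]
          have h9 : (T (∑ j : Fin J, h • indL _ (measurableSet_level hg ((((j : ℕ) : ℝ) + 1) * h)))
              : L0) = ∑ j : Fin J, h •
              (T (indL _ (measurableSet_level hg ((((j : ℕ) : ℝ) + 1) * h))) : L0) := by
            rw [map_sum, Submodule.coe_sum]
            simp only [map_smul, Submodule.coe_smul]
          rw [h9] at h3
          filter_upwards [h2, h3] with u h4 h5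
          rw [← h4]
          exact ENNReal.ofReal_le_ofReal h5
  have hU : Ioi (0 : ℝ) = ⋃ k : ℕ, Ioi (1 / ((k : ℝ) + 1)) := by
    ext u
    simp only [mem_Ioi, mem_iUnion]
    refine ⟨fun hu => exists_nat_one_div_lt hu, fun ⟨k, hk⟩ => lt_trans (by positivity) hk⟩
  rw [hU, setLIntegral_iUnion_of_directed]
  · exact iSup_le fun k => key _ (by positivity)
  · refine (monotone_nat_of_le_succ fun k => Ioi_subset_Ioi ?_).directed_le
    exact one_div_le_one_div_of_le (by positivity) (by push_cast; linarith)

theorem lintegral_ofReal_apply_le (hT : IsSubstochastic T) {f : L1Linfty} (hf : 0 ≤ (f : L0)) :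
    ∫⁻ u, ENNReal.ofReal ((T f : L0) u) ∂m ≤ ∫⁻ u, ENNReal.ofReal ((f : L0) u) ∂m := by
  have h := hT.contr_one f
  rw [eLpNorm_one_eq_lintegral_enorm, eLpNorm_one_eq_lintegral_enorm] at h
  have h1 : ∀ {z : L0}, 0 ≤ z → ∫⁻ u, ‖z u‖ₑ ∂m = ∫⁻ u, ENNReal.ofReal (z u) ∂m := fun hz =>
    lintegral_congr_ae ((coe_nonneg hz).mono fun u hu => Real.enorm_eq_ofReal hu)
  rwa [h1 hf, h1 (hT.pos f hf)] at h

/-- T preserves the integral of f, and f is the sum of c times the indicator of {g > c} and a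
nonnegative remainder. T cannot increase either integral, so it preserves both. The image of the
indicator is dominated by Tf/c and hence vanishes off the blocks. -/
theorem tsum_levelInt (hT : IsSubstochastic T) (hg0 : ∀ u, 0 ≤ g u)
    (hfg : (f : L0) =ᵐ[m] g) {B : ℕ → Set ℝ} (hB : ∀ i, MeasurableSet (B i))
    (hBd : Pairwise (Function.onFun Disjoint B))
    (hfi : ∫⁻ u, ENNReal.ofReal ((f : L0) u) ∂m ≠ ∞)
    (hTf : ∫⁻ u, ENNReal.ofReal ((T f : L0) u) ∂m = ∫⁻ u, ENNReal.ofReal ((f : L0) u) ∂m)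
    (hTB : ∀ᵐ u ∂m, u ∉ ⋃ i, B i → (T f : L0) u = 0) {c : ℝ} (hc : 0 < c) :
    ∑' i, levelInt T hg (B i) c = m {u | c < g u} := by
  set S := {u | c < g u} with hS
  have hSm : MeasurableSet S := measurableSet_level hg c
  set s := indL S hSm with hs
  have hsS : (s : L0) =ᵐ[m] S.indicator 1 := coe_indL S hSm
  have hc0 : ENNReal.ofReal c ≠ 0 := by simpa using hc
  have hle : ((c • s : L1Linfty) : L0) ≤ᵐ[m] (f : L0) := by
    rw [Submodule.coe_smul]
    filter_upwards [hsS, AEEqFun.coeFn_smul c (s : L0), hfg] with u h1 h2 h3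
    rw [h2, Pi.smul_apply, h1, h3]
    by_cases hu : u ∈ S
    · rw [indicator_of_mem hu]; simpa using le_of_lt hu
    · rw [indicator_of_notMem hu]; simpa using hg0 u
  have hr : 0 ≤ ((f - c • s : L1Linfty) : L0) := by
    rw [Submodule.coe_sub]
    refine nonneg_of_coe ?_
    filter_upwards [hle, AEEqFun.coeFn_sub (f : L0) ((c • s : L1Linfty) : L0)] with u h1 h2
    rw [h2]; simpa using h1
  have hTs := hT.pos s (indL_nonneg hSm)
  have hsplit : ∀ {a b : L0}, 0 ≤ a → 0 ≤ b → ∫⁻ u, ENNReal.ofReal ((c • a + b : L0) u) ∂m =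
      ENNReal.ofReal c * ∫⁻ u, ENNReal.ofReal (a u) ∂m + ∫⁻ u, ENNReal.ofReal (b u) ∂m := by
    intro a b ha hb
    rw [← lintegral_const_mul _ (AEEqFun.measurable a).ennreal_ofReal,
      ← lintegral_add_left ((AEEqFun.measurable a).ennreal_ofReal.const_mul _)]
    refine lintegral_congr_ae ?_
    filter_upwards [AEEqFun.coeFn_add (c • a) b, AEEqFun.coeFn_smul c a, coe_nonneg ha,
      coe_nonneg hb] with u h1 h2 h3 h4
    rw [h1, Pi.add_apply, h2, Pi.smul_apply, smul_eq_mul,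
      ENNReal.ofReal_add (mul_nonneg hc.le h3) h4, ENNReal.ofReal_mul hc.le]
  have hzero : ∀ᵐ u ∂m, u ∉ ⋃ i, B i → (T s : L0) u = 0 := by
    have h1 := hT.mono hle
    rw [map_smul, Submodule.coe_smul] at h1
    filter_upwards [h1, hTB, AEEqFun.coeFn_smul c (T s : L0), coe_nonneg hTs] with u h2 h3 h4 h5 h6
    rw [h4, h3 h6, Pi.smul_apply, smul_eq_mul] at h2
    exact le_antisymm (nonpos_of_mul_nonpos_right h2 hc) h5
  have hsum : ∑' i, levelInt T hg (B i) c = ∫⁻ u, ENNReal.ofReal ((T s : L0) u) ∂m := by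
    rw [← lintegral_add_compl _ (MeasurableSet.iUnion hB), lintegral_iUnion hB hBd]
    have : ∫⁻ u in (⋃ i, B i)ᶜ, ENNReal.ofReal ((T s : L0) u) ∂m = 0 := by
      refine (lintegral_congr_ae ?_).trans lintegral_zero
      filter_upwards [ae_restrict_of_ae hzero, ae_restrict_mem (MeasurableSet.iUnion hB).compl]
        with u h1 h2
      rw [h1 h2, ENNReal.ofReal_zero]
    rw [this, add_zero]
    rfl
  have hsS' : ∫⁻ u, ENNReal.ofReal ((s : L0) u) ∂m = m S := by
    rw [← lintegral_indicator_one hSm]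
    refine lintegral_congr_ae (hsS.mono fun u hu => ?_)
    simp only [hu]
    by_cases h : u ∈ S <;> simp [h]
  rw [hsum]
  refine le_antisymm ((lintegral_ofReal_apply_le hT (indL_nonneg hSm)).trans_eq hsS') ?_
  have e1 : (f : L0) = c • (s : L0) + ((f - c • s : L1Linfty) : L0) := by
    rw [Submodule.coe_sub, Submodule.coe_smul]; abel
  have e2 : (T f : L0) = c • (T s : L0) + (T (f - c • s) : L0) := by
    rw [map_sub, map_smul, Submodule.coe_sub, Submodule.coe_smul]; abel
  have h1 := hsplit (indL_nonneg hSm) hr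
  have h2 := hsplit hTs (hT.pos _ hr)
  rw [← e1, hsS'] at h1
  rw [← e2, hTf, h1] at h2
  have h3 : ∫⁻ u, ENNReal.ofReal (((f - c • s : L1Linfty) : L0) u) ∂m ≠ ∞ := fun h => by
    rw [h, add_top] at h1
    exact hfi h1
  have h4 := h2.le.trans (add_le_add_right (lintegral_ofReal_apply_le hT hr) _)
  rw [ENNReal.add_le_add_iff_right h3] at h4
  exact (ENNReal.mul_le_mul_iff_right hc0 ENNReal.ofReal_ne_top).1 h4

end Levels

/-! ### Truncations with prescribed integral -/

theorem lintegral_eq_iSup_Ioc (f : ℝ → ℝ≥0∞) :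
    ∫⁻ u, f u ∂m = ⨆ k : ℕ, ∫⁻ u in Ioc 0 (k : ℝ), f u ∂m := by
  have hun : m.restrict (⋃ k : ℕ, Ioc 0 (k : ℝ)) = m := by
    rw [Measure.restrict_restrict (MeasurableSet.iUnion fun k => measurableSet_Ioc),
      inter_eq_right.2]
    intro u hu
    obtain ⟨k, hk⟩ := exists_nat_ge u
    exact mem_iUnion.2 ⟨k, hu, hk⟩
  rw [← setLIntegral_iUnion_of_directed, hun]
  exact (monotone_nat_of_le_succ fun k => Ioc_subset_Ioc_right (by simp)).directed_le

theorem exists_setLIntegral_rearr_eq {x : L0} (hx1 : x ∈ L1) {I : ℝ≥0∞} (hI0 : I ≠ 0)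
    (hI : I < ∫⁻ u, ‖x u‖ₑ ∂m) : ∃ s : ℝ, 0 < s ∧ ∫⁻ v in Ioc 0 s, rearr x v = I := by
  rw [lintegral_eq_iSup_Ioc] at hI
  obtain ⟨k, hk⟩ := lt_iSup_iff.1 hI
  have hk' : I < ∫⁻ v in Ioc 0 (k : ℝ), rearr x v :=
    hk.trans_le (setLIntegral_enorm_le_rearr x (m_Ioc _).le)
  have hfin := setLIntegral_rearr_lt_top hx1 (k : ℝ)
  have hi : IntegrableOn (rearrReal x) (Icc 0 (k : ℝ)) := by
    rw [integrableOn_Icc_iff_integrableOn_Ioc]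
    exact integrable_toReal_of_lintegral_ne_top (measurable_rearr x).aemeasurable hfin.ne
  have hX : ∀ s : ℝ, s ≤ k → ∫⁻ v in Ioc 0 s, rearr x v =
      ENNReal.ofReal (∫ v in Ioc 0 s, rearrReal x v) := by
    intro s hs
    have h1 : ∫⁻ v in Ioc 0 s, rearr x v ≠ ∞ := (setLIntegral_rearr_lt_top hx1 s).ne
    rw [← ENNReal.ofReal_toReal h1]
    congr 1
    refine (integral_toReal (measurable_rearr x).aemeasurable ?_).symm
    exact ae_lt_top (measurable_rearr x) h1
  have hc := intervalIntegral.continuousOn_primitive hi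
  have hIf : I ≠ ∞ := (hk'.trans hfin).ne
  have hmem : I.toReal ∈ Icc (∫ v in Ioc (0 : ℝ) 0, rearrReal x v)
      (∫ v in Ioc 0 (k : ℝ), rearrReal x v) := by
    refine ⟨by simp, ?_⟩
    rw [hX k le_rfl] at hk'
    have := ENNReal.toReal_mono ENNReal.ofReal_ne_top hk'.le
    have h0 : 0 ≤ ∫ v in Ioc 0 (k : ℝ), rearrReal x v :=
      integral_nonneg fun _ => ENNReal.toReal_nonneg
    rwa [ENNReal.toReal_ofReal h0] at this
  obtain ⟨s, hs, hsI⟩ := intermediate_value_Icc (Nat.cast_nonneg k) hc hmem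
  have hsI' : ∫⁻ v in Ioc 0 s, rearr x v = I := by
    rw [hX s hs.2]
    simp only at hsI
    rw [hsI, ENNReal.ofReal_toReal hIf]
  refine ⟨s, lt_of_le_of_ne hs.1 fun h => hI0 ?_, hsI'⟩
  rw [← hsI', ← h]
  simp

/-- As g has no values in (0, q), exc g is affine on [0, q], while exc y is convex. The inequality
at the two ends therefore extends to the whole interval. -/
theorem exc_le_of_exc_le_of_le {y g : ℝ → ℝ} (hy : Integrable y m)
    (hg : Integrable g m) {q : ℝ} (hgq : ∀ u, g u = 0 ∨ q ≤ g u) (h0 : exc y 0 = exc g 0)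
    (h : ∀ c, q ≤ c → exc y c ≤ exc g c) {c : ℝ} (hc : 0 ≤ c) : exc y c ≤ exc g c := by
  rcases le_or_gt q c with hqc | hqc
  · exact h c hqc
  have hq : 0 < q := hc.trans_lt hqc
  have hle : ∀ d, 0 ≤ d → exc y d ≤ exc g d → excR y d ≤ excR g d := fun d hd hle => by
    rwa [exc_eq_ofReal_excR hy hd, exc_eq_ofReal_excR hg hd,
      ENNReal.ofReal_le_ofReal_iff (excR_nonneg _ _)] at hle
  rw [exc_eq_ofReal_excR hy hc, exc_eq_ofReal_excR hg hc]
  refine ENNReal.ofReal_le_ofReal ?_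
  have ha : 0 ≤ 1 - c / q := sub_nonneg.2 ((div_le_one hq).2 hqc.le)
  have hb : 0 ≤ c / q := by positivity
  have hcq : (1 - c / q) * 0 + c / q * q = c := by field_simp; ring
  have h1 := excR_le_interp hy ha hb (by ring) le_rfl hq.le
  have h2 := excR_eq_interp hg ha hb (by ring) le_rfl hq.le
    (ae_of_all _ fun u => (hgq u).imp (fun h => h.le) id)
  rw [hcq] at h1 h2
  rw [h2]
  refine h1.trans ?_
  gcongr
  · exact hle 0 le_rfl h0.le
  · exact hle q hq.le (h q le_rfl)

/-- Restrict x to a top set of measure s, where ∫₀ˢ x* equals the integral of y; if the integrals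
already agree, keep x and take q = 0. Equality of integrals makes an operator sending g to y
preserve the integral of g. -/
theorem exists_truncation {x y : L0} (hx : 0 ≤ x) (hx1 : x ∈ L1) (hy1 : y ∈ L1)
    (hyx : ∀ c, 0 ≤ c → exc y c ≤ exc x c) (hy0 : exc y 0 ≠ 0) :
    ∃ (g : ℝ → ℝ) (q : ℝ), Measurable g ∧ (∀ u, 0 ≤ g u) ∧ Integrable g m ∧ 0 ≤ q ∧
      (∀ u, g u = 0 ∨ q ≤ g u) ∧ exc g 0 = exc y 0 ∧ (∀ c, q ≤ c → exc g c = exc x c) ∧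
      (∀ c, 0 ≤ c → exc y c ≤ exc g c) ∧ ∀ c, 0 ≤ c → exc g c ≤ exc x c := by
  obtain ⟨f, hf, hf0, hxf⟩ := exists_measurable_nonneg_rep hx
  have hfi : Integrable f m := (mem_L1_iff.1 hx1).congr hxf
  have hxm : ∫⁻ u, ‖x u‖ₑ ∂m = exc x 0 := by
    rw [← lintegral_enorm_sub_eq_exc (coe_nonneg hx) le_rfl]
    simp
  rcases (hyx 0 le_rfl).eq_or_lt with heq | hlt
  · exact ⟨f, 0, hf, hf0, hfi, le_rfl, fun u => Or.inr (hf0 u),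
      by rw [heq, exc_congr hxf], fun c _ => (exc_congr hxf c).symm,
      fun c hc => by rw [← exc_congr hxf]; exact hyx c hc, fun c _ => (exc_congr hxf c).ge⟩
  rw [← hxm] at hlt
  obtain ⟨s, hs, hsI⟩ := exists_setLIntegral_rearr_eq hx1 hy0 hlt
  have hf1 : exc f 0 ≠ ∞ := by rw [exc_eq_ofReal_excR hfi le_rfl]; exact ENNReal.ofReal_ne_top
  obtain ⟨C, q, hC, hCs⟩ := exists_topSet hf hf0 hf1 (s := ENNReal.ofReal s) (by simpa using hs)
    ENNReal.ofReal_ne_top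
  have hgm : Measurable (C.indicator f) := hf.indicator hC.meas
  have hgi : Integrable (C.indicator f) m := hfi.indicator hC.meas
  have hgq : ∀ u, C.indicator f u = 0 ∨ q ≤ C.indicator f u := fun u => by
    by_cases hu : u ∈ C
    · rw [indicator_of_mem hu]; exact Or.inr (hC.ge u hu)
    · exact Or.inl (indicator_of_notMem hu _)
  have hI : exc (C.indicator f) 0 = exc y 0 := by
    have h1 : exc (C.indicator f) 0 = ∫⁻ u in C, ENNReal.ofReal (f u) ∂m := by
      rw [← lintegral_indicator hC.meas]
      refine lintegral_congr fun u => ?_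
      by_cases hu : u ∈ C <;> simp [hu]
    rw [h1, ← hsI]
    refine le_antisymm ?_ ?_
    · refine le_trans (lintegral_mono_ae (ae_restrict_of_ae (hxf.mono fun u hu => ?_)))
        (setLIntegral_enorm_le_rearr x hCs.le)
      rw [hu]
      exact Real.ofReal_le_enorm _
    · rw [hC.setLIntegral, hCs, ← exc_congr hxf]
      exact setLIntegral_rearr_le_exc hx s hC.nonneg
  have hge : ∀ c, q ≤ c → exc (C.indicator f) c = exc x c := fun c hc => by
    rw [exc_congr hxf]
    refine lintegral_congr fun u => ?_
    by_cases hu : u ∈ C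
    · rw [indicator_of_mem hu]
    · rw [indicator_of_notMem hu, ENNReal.ofReal_of_nonpos (by linarith [hC.nonneg]),
        ENNReal.ofReal_of_nonpos (by linarith [hC.le u hu])]
  refine ⟨C.indicator f, q, hgm, fun u => indicator_nonneg (fun u _ => hf0 u) u, hgi, hC.nonneg,
    hgq, hI, hge, fun c hc => ?_, fun c _ => ?_⟩
  · refine exc_le_of_exc_le_of_le (mem_L1_iff.1 hy1) hgi hgq hI.symm (fun d hd => ?_) hc
    rw [hge d hd]
    exact hyx d (hC.nonneg.trans hd)
  · rw [exc_congr hxf]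
    exact exc_mono (ae_of_all _ fun u => indicator_le_self' (fun u _ => hf0 u) u) c

/-! ### Functions with values in `[0, ∞]` -/

/-- The class of an almost everywhere finite function. -/
def ofENNReal (G : ℝ → ℝ≥0∞) (hG : Measurable G) : L0 :=
  AEEqFun.mk (fun u => (G u).toReal) hG.ennreal_toReal.aestronglyMeasurable

section ofENNReal

variable {G : ℝ → ℝ≥0∞} {hG : Measurable G}

theorem coe_ofENNReal : (ofENNReal G hG : ℝ → ℝ) =ᵐ[m] fun u => (G u).toReal :=
  AEEqFun.coeFn_mk _ _

theorem ofENNReal_nonneg : 0 ≤ ofENNReal G hG :=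
  nonneg_of_coe (coe_ofENNReal.mono fun u hu => by
    rw [hu]; exact ENNReal.toReal_nonneg)

theorem exc_ofENNReal (hGi : ∫⁻ u, G u ∂m ≠ ∞) {c : ℝ} (hc : 0 ≤ c) :
    exc (ofENNReal G hG) c = ∫⁻ u, (G u - ENNReal.ofReal c) ∂m := by
  rw [exc_congr coe_ofENNReal]
  refine lintegral_congr_ae ?_
  filter_upwards [ae_lt_top hG hGi] with u hu
  rw [ENNReal.ofReal_sub _ hc, ENNReal.ofReal_toReal hu.ne]

theorem ofENNReal_mem_L1 (hGi : ∫⁻ u, G u ∂m ≠ ∞) : ofENNReal G hG ∈ L1 :=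
  mem_L1_iff.2 ((integrable_toReal_of_lintegral_ne_top hG.aemeasurable hGi).congr
    coe_ofENNReal.symm)

end ofENNReal

/-- The function equal to `G i` on `B i`, and to `0` outside of the sets `B i`. -/
def glue (B : ℕ → Set ℝ) (G : ℕ → ℝ → ℝ≥0∞) (u : ℝ) : ℝ≥0∞ := ∑' i, (B i).indicator (G i) u

section glue

variable {B : ℕ → Set ℝ} {G : ℕ → ℝ → ℝ≥0∞}

theorem measurable_glue (hB : ∀ i, MeasurableSet (B i)) (hG : ∀ i, Measurable (G i)) :
    Measurable (glue B G) := Measurable.tsum fun i => (hG i).indicator (hB i)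

theorem glue_of_mem (hBd : Pairwise (Function.onFun Disjoint B)) {i : ℕ} {u : ℝ} (hu : u ∈ B i) :
    glue B G u = G i u := by
  rw [glue, tsum_eq_single i, indicator_of_mem hu]
  exact fun j hj => indicator_of_notMem (fun h => Set.disjoint_left.1 (hBd hj) h hu) _

theorem glue_of_notMem {u : ℝ} (hu : u ∉ ⋃ i, B i) : glue B G u = 0 :=
  ENNReal.tsum_eq_zero.2 fun i => indicator_of_notMem (fun h => hu (mem_iUnion.2 ⟨i, h⟩)) _

theorem lintegral_glue_sub (hB : ∀ i, MeasurableSet (B i))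
    (hBd : Pairwise (Function.onFun Disjoint B)) (c : ℝ≥0∞) :
    ∫⁻ u, (glue B G u - c) ∂m = ∑' i, ∫⁻ u in B i, (G i u - c) ∂m := by
  rw [← lintegral_add_compl _ (MeasurableSet.iUnion hB), lintegral_iUnion hB hBd]
  have h0 : ∫⁻ u in (⋃ i, B i)ᶜ, (glue B G u - c) ∂m = 0 :=
    (setLIntegral_congr_fun (MeasurableSet.iUnion hB).compl fun u hu => by
      rw [glue_of_notMem hu, zero_tsub]).trans lintegral_zero
  rw [h0, add_zero]
  exact tsum_congr fun i => setLIntegral_congr_fun (hB i) fun u hu => by rw [glue_of_mem hBd hu]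

end glue

/-- The rotation estimates divided by the step m(B)/n. The constant b is the integral of F over the
first step divided by m(B), and (b - c) m(B) compares with ∫(F - nc)⁺ because nc times the step is c
m(B). -/
theorem exists_rotation_of_mean {B : Set ℝ} (hBf : m B ≠ ∞) {F : ℝ → ℝ≥0∞} (hF : Antitone F)
    (hF0 : ∀ v, m B ≤ ENNReal.ofReal v → F v = 0) {a : ℝ≥0∞} (ha : a ≠ ∞)
    (hFa : ∫⁻ v, F v ∂m = a * m B) {n : ℕ} (hn : 0 < n) :
    ∃ (Z : Fin n → ℝ → ℝ≥0∞) (b : ℝ≥0∞), (∀ k, Measurable (Z k)) ∧ b ≠ ∞ ∧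
      (∀ k c, ∫⁻ u in B, (Z k u - c) ∂m = ∫⁻ v, (F v - c) ∂m) ∧
      (∀ c, (b - c) * m B ≤ ∫⁻ v, (F v - n * c) ∂m) ∧
      ∀ᵐ u ∂m.restrict B, (∀ k, Z k u ≠ ∞ ∧ ∃ v, Z k u = F v) ∧
        (∃ k, ∑ k, Z k u ≤ Z k u + n * a) ∧ n * a ≤ n * b + ∑ k, Z k u := by
  have hFi : ∫⁻ v, F v ∂m ≠ ∞ := by rw [hFa]; exact ENNReal.mul_ne_top ha hBf
  rcases eq_or_ne (m B) 0 with hB0 | hB0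
  · refine ⟨fun _ _ => 0, 0, fun _ => measurable_const, ENNReal.zero_ne_top, fun k c => ?_,
      fun c => ?_, ?_⟩
    · rw [hB0, mul_zero] at hFa
      simp only [Measure.restrict_eq_zero.2 hB0, lintegral_zero_measure]
      exact (le_antisymm ((lintegral_mono fun v => tsub_le_self).trans hFa.le) zero_le).symm
    · rw [hB0, mul_zero]; exact zero_le
    · rw [Measure.restrict_eq_zero.2 hB0]; simp
  set l := m.real B with hl
  have hl0 : 0 < l := ENNReal.toReal_pos hB0 hBf
  have hBl : m B = ENNReal.ofReal l := (ENNReal.ofReal_toReal hBf).symm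
  obtain ⟨Z, hZ, hZd, hZae⟩ := exists_rotation hl0 hBl hF
    (fun v hv => hF0 v (by rw [hBl]; exact ENNReal.ofReal_le_ofReal hv)) hFi hn
  have hn' : (0 : ℝ) < n := Nat.cast_pos.2 hn
  have hh0 : ENNReal.ofReal (l / n) ≠ 0 := by
    have : 0 < l / n := by positivity
    simpa using this
  have hlh : m B = n * ENNReal.ofReal (l / n) := by
    rw [hBl, ← ENNReal.ofReal_natCast, ← ENNReal.ofReal_mul hn'.le]
    congr 1; field_simp
  have hJf : ∫⁻ v in Ioc 0 (l / n), F v ∂m ≠ ∞ :=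
    ((setLIntegral_le_lintegral _ _).trans_lt hFi.lt_top).ne
  set b := (∫⁻ v in Ioc 0 (l / n), F v ∂m) / m B with hb
  have hbB : b * m B = ∫⁻ v in Ioc 0 (l / n), F v ∂m := ENNReal.div_mul_cancel hB0 hBf
  refine ⟨Z, b, hZ, ENNReal.div_ne_top hJf hB0, hZd, fun c => ?_, ?_⟩
  · rw [ENNReal.sub_mul (fun _ _ => hBf), hbB, tsub_le_iff_right]
    calc ∫⁻ v in Ioc 0 (l / n), F v ∂m
        ≤ ∫⁻ v in Ioc 0 (l / n), ((F v - n * c) + n * c) ∂m :=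
          lintegral_mono fun v => le_tsub_add
      _ = ∫⁻ v in Ioc 0 (l / n), (F v - n * c) ∂m + n * c * ENNReal.ofReal (l / n) := by
          rw [lintegral_add_right _ measurable_const, setLIntegral_const, m_Ioc]
      _ ≤ _ := by
          refine add_le_add (setLIntegral_le_lintegral _ _) (le_of_eq ?_)
          rw [hlh]; ring
  · filter_upwards [hZae] with u hu
    obtain ⟨h1, ⟨k, h2⟩, h3⟩ := hu
    refine ⟨h1, ⟨k, ?_⟩, ?_⟩
    · rw [hFa, hlh] at h2
      refine (ENNReal.mul_le_mul_iff_right hh0 ENNReal.ofReal_ne_top).1 (h2.trans_eq ?_)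
      ring
    · rw [hFa, ← hbB, hlh] at h3
      refine (ENNReal.mul_le_mul_iff_right hh0 ENNReal.ofReal_ne_top).1 ?_
      calc _ = a * (n * ENNReal.ofReal (l / n)) := by ring
        _ ≤ _ := h3
        _ = _ := by ring

/-! ### Averages of extreme points -/

theorem excR_eq_of_exc_eq {f g : ℝ → ℝ} (hf : Integrable f m) (hg : Integrable g m) {c : ℝ}
    (hc : 0 ≤ c) (h : exc f c = exc g c) : excR f c = excR g c := by
  rwa [exc_eq_ofReal_excR hf hc, exc_eq_ofReal_excR hg hc,
    ENNReal.ofReal_eq_ofReal_iff (excR_nonneg _ _) (excR_nonneg _ _)] at h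

/-- T sends a level set {g > c} to a function whose integral over B i is the share of that level set
assigned to the block. These shares decrease in c and sum over i to m{g > c}, so their inverses F i
are together equimeasurable with g. -/
theorem exists_block_functions {x y : L0} (hx : 0 ≤ x) (hx1 : x ∈ L1) (hy : 0 ≤ y) (hy1 : y ∈ L1)
    (hyx : ∀ c, 0 ≤ c → exc y c ≤ exc x c) (hy0 : exc y 0 ≠ 0) {B : ℕ → Set ℝ}
    (hB : ∀ i, MeasurableSet (B i)) (hBd : Pairwise (Function.onFun Disjoint B))
    {v : ℕ → ℝ} (hyv : ∀ i, ∀ᵐ u ∂m.restrict (B i), y u = v i)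
    (hyB : ∀ᵐ u ∂m, u ∉ ⋃ i, B i → y u = 0) :
    ∃ (g : ℝ → ℝ) (q : ℝ) (F : ℕ → ℝ → ℝ≥0∞), 0 ≤ q ∧ exc g 0 ≠ ∞ ∧
      (∀ c, q ≤ c → exc g c = exc x c) ∧ (∀ c, 0 ≤ c → exc g c ≤ exc x c) ∧
      (∀ i, Antitone (F i)) ∧ (∀ i t, m (B i) ≤ ENNReal.ofReal t → F i t = 0) ∧
      (∀ i, ∫⁻ t, F i t ∂m = ENNReal.ofReal (v i) * m (B i)) ∧
      (∀ i t, F i t = 0 ∨ ENNReal.ofReal q ≤ F i t) ∧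
      ∀ c, 0 ≤ c → ∑' i, ∫⁻ t, (F i t - ENNReal.ofReal c) ∂m = exc g c := by
  obtain ⟨g, q, hg, hg0, hgi, hq, hgq, hgI, hgx, hyg, hgle⟩ :=
    exists_truncation hx hx1 hy1 hyx hy0
  set f := ofIntegrable g hgi with hf
  have hfg : (f : L0) =ᵐ[m] g := coe_ofIntegrable g hgi
  have hf0 : 0 ≤ (f : L0) := nonneg_of_coe (hfg.mono fun u hu => by rw [hu]; exact hg0 u)
  have hf1 : (f : L0) ∈ L1 := mem_L1_iff.2 (hgi.congr hfg.symm)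
  obtain ⟨T, hT, hTf⟩ := exists_substochastic_eq hf0 hf1 hy hy1 fun c hc => by
    rw [exc_congr hfg]; exact hyg c hc
  have hTf' : (T f : L0) = y := hTf
  have hgfin : exc g 0 ≠ ∞ := by rw [exc_eq_ofReal_excR hgi le_rfl]; exact ENNReal.ofReal_ne_top
  have hexc0 : ∀ h : ℝ → ℝ, exc h 0 = ∫⁻ u, ENNReal.ofReal (h u) ∂m := fun h => by simp [exc]
  have hfI : ∫⁻ u, ENNReal.ofReal ((f : L0) u) ∂m = exc g 0 := by
    rw [← hexc0, exc_congr hfg]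
  have hanti : ∀ i, Antitone (levelInt T hg (B i)) := fun i => levelInt_antitone hT (B i)
  have hsum : ∀ c, 0 ≤ c → ∑' i, ∫⁻ d in Ioi c, levelInt T hg (B i) d = exc g c := by
    intro c hc
    rw [exc_eq_setLIntegral hg, ← lintegral_tsum fun i => (hanti i).measurable.aemeasurable]
    refine setLIntegral_congr_fun measurableSet_Ioi fun d hd => ?_
    refine tsum_levelInt hT hg0 hfg hB hBd (by rwa [hfI]) ?_ ?_ (hc.trans_lt hd)
    · rw [hTf', hfI, hgI, hexc0]
    · rw [hTf']; exact hyB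
  have hle : ∀ i, ∫⁻ c in Ioi 0, levelInt T hg (B i) c ≤
      ∫⁻ u in B i, ENNReal.ofReal (y u) ∂m := fun i => by
    have := setLIntegral_levelInt_le (hg := hg) hT hg0 hfg (B i)
    rwa [hTf'] at this
  have htot : ∑' i, ∫⁻ u in B i, ENNReal.ofReal (y u) ∂m = exc g 0 := by
    rw [hgI, hexc0, ← lintegral_add_compl _ (MeasurableSet.iUnion hB), lintegral_iUnion hB hBd]
    have : ∫⁻ u in (⋃ i, B i)ᶜ, ENNReal.ofReal (y u) ∂m = 0 := by
      refine (lintegral_congr_ae ?_).trans lintegral_zero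
      filter_upwards [ae_restrict_of_ae hyB, ae_restrict_mem (MeasurableSet.iUnion hB).compl]
        with u h1 h2
      rw [h1 h2, ENNReal.ofReal_zero]
    rw [this, add_zero]
  -- The inequality holds block by block and the finite totals agree, so equality holds in every
  -- block.
  have heq : ∀ i, ∫⁻ c in Ioi 0, levelInt T hg (B i) c =
      ∫⁻ u in B i, ENNReal.ofReal (y u) ∂m := by
    intro i
    by_contra hne
    have h1 := ENNReal.tsum_lt_tsum (by rwa [hsum 0 le_rfl]) hle (lt_of_le_of_ne (hle i) hne)
    rw [hsum 0 le_rfl, htot] at h1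
    exact lt_irrefl _ h1
  refine ⟨g, q, fun i => decInv (levelInt T hg (B i)), hq, hgfin, hgx, hgle,
    fun i => decInv_antitone _, fun i t ht => decInv_eq_zero fun c => (levelInt_le hT _ c).trans ht,
    fun i => ?_, fun i t => decInv_eq_zero_or (hanti i)
      (levelInt_eq (fun u => (hgq u).imp (fun h => h.le) id) (B i)) t, fun c hc => ?_⟩
  · have h1 := lintegral_decInv_sub (hanti i) le_rfl
    simp only [ENNReal.ofReal_zero, tsub_zero] at h1
    rw [h1, heq i, ← setLIntegral_const]
    exact lintegral_congr_ae ((hyv i).mono fun u hu => by simp only [hu])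
  · simp_rw [lintegral_decInv_sub (hanti _) hc]
    exact hsum c hc

/-- The k-th rotations on all blocks glue to a function equimeasurable with g, which is extreme by
its range and by exc g = exc x beyond q. The average over k misses y from above by at most one
rotated value over n, and from below by at most the block constant b i. -/
theorem exists_extremePoints_average {x y : L0} (hx : 0 ≤ x) (hx1 : x ∈ L1) (hy : 0 ≤ y)
    (hy1 : y ∈ L1) (hyx : ∀ c, 0 ≤ c → exc y c ≤ exc x c) (hy0 : exc y 0 ≠ 0) {B : ℕ → Set ℝ}
    (hB : ∀ i, MeasurableSet (B i)) (hBd : Pairwise (Function.onFun Disjoint B))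
    (hBf : ∀ i, m (B i) ≠ ∞) {v : ℕ → ℝ} (hv : ∀ i, 0 ≤ v i)
    (hyv : ∀ i, ∀ᵐ u ∂m.restrict (B i), y u = v i)
    (hyB : ∀ᵐ u ∂m, u ∉ ⋃ i, B i → y u = 0) {n : ℕ} (hn : 0 < n) :
    ∃ (z : Fin n → L0) (e : Fin 2 → L0), (∀ k, z k ∈ extremePoints ℝ (OmegaPlus x)) ∧
      (∀ j, 0 ≤ e j ∧ e j ∈ L1 ∧ (∀ᵐ u ∂m, u ∉ ⋃ i, B i → e j u = 0) ∧
        ∀ c, 0 ≤ c → exc (e j) c ≤ exc x (n * c)) ∧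
      ∀ᵐ u ∂m, |∑ k, (n : ℝ)⁻¹ * z k u - y u| ≤ e 0 u + e 1 u := by
  obtain ⟨g, q, F, hq, hgfin, hgx, hgle, hF, hF0, hFv, hFq, hFsum⟩ :=
    exists_block_functions hx hx1 hy hy1 hyx hy0 hB hBd hyv hyB
  have hrot := fun i => exists_rotation_of_mean (hBf i) (hF i) (hF0 i) ENNReal.ofReal_ne_top
    (hFv i) hn
  choose Z b hZ hb hZd hbd hZae using hrot
  have hn0 : (n : ℝ≥0∞) ≠ 0 := by exact_mod_cast hn.ne'
  have hnt : (n : ℝ≥0∞) ≠ ∞ := ENNReal.natCast_ne_top n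
  have hn' : (0 : ℝ) < n := Nat.cast_pos.2 hn
  have hnc : ∀ {c : ℝ}, ENNReal.ofReal (n * c) = n * ENNReal.ofReal c := fun {c} => by
    rw [ENNReal.ofReal_mul hn'.le, ENNReal.ofReal_natCast]
  set G : Fin n → ℝ → ℝ≥0∞ := fun k => glue B fun i => Z i k with hG
  have hGm : ∀ k, Measurable (G k) := fun k => measurable_glue hB fun i => hZ i k
  have hGd : ∀ k c, 0 ≤ c → ∫⁻ u, (G k u - ENNReal.ofReal c) ∂m = exc g c := fun k c hc => by
    rw [hG, lintegral_glue_sub hB hBd]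
    simp_rw [hZd]
    exact hFsum c hc
  have hGi : ∀ k, ∫⁻ u, G k u ∂m ≠ ∞ := fun k => by
    have := hGd k 0 le_rfl
    simp only [ENNReal.ofReal_zero, tsub_zero] at this
    rwa [this]
  set H : ℝ → ℝ≥0∞ := fun u => ⨆ k, G k u / n with hH
  have hHm : Measurable H := Measurable.iSup fun k => (hGm k).div_const _
  -- The maximum is bounded by the sum: (max_k G k / n - c)⁺ is at most the average of the (G k -
  -- nc)⁺, each of which has integral exc g(nc).
  have hHd : ∀ c, 0 ≤ c → ∫⁻ u, (H u - ENNReal.ofReal c) ∂m ≤ exc g (n * c) := fun c hc => by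
    calc ∫⁻ u, (H u - ENNReal.ofReal c) ∂m
        ≤ ∫⁻ u, ∑ k, (G k u - ENNReal.ofReal (n * c)) * (n : ℝ≥0∞)⁻¹ ∂m := by
          refine lintegral_mono fun u => ?_
          simp only [hH]
          rw [ENNReal.iSup_sub]
          refine iSup_le fun k => le_trans (le_of_eq ?_) (Finset.single_le_sum
            (f := fun k => (G k u - ENNReal.ofReal (n * c)) * (n : ℝ≥0∞)⁻¹)
            (fun _ _ => zero_le) (Finset.mem_univ k))
          rw [ENNReal.sub_mul (fun _ _ => ENNReal.inv_ne_top.2 hn0), hnc, div_eq_mul_inv,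
            mul_comm (n : ℝ≥0∞), mul_assoc, ENNReal.mul_inv_cancel hn0 hnt, mul_one]
      _ = ∑ k : Fin n, exc g (n * c) * (n : ℝ≥0∞)⁻¹ := by
          rw [lintegral_finsetSum _ fun k _ => ((hGm k).sub_const _).mul_const _]
          refine Finset.sum_congr rfl fun k _ => ?_
          rw [lintegral_mul_const _ ((hGm k).sub_const _), hGd k _ (by positivity)]
      _ = exc g (n * c) := by
          rw [Finset.sum_const, Finset.card_univ, Fintype.card_fin, nsmul_eq_mul, mul_comm,
            mul_assoc, ENNReal.inv_mul_cancel hn0 hnt, mul_one]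
  have hHi : ∫⁻ u, H u ∂m ≠ ∞ := by
    have := hHd 0 le_rfl
    simp only [ENNReal.ofReal_zero, tsub_zero, mul_zero] at this
    exact (this.trans_lt hgfin.lt_top).ne
  set K : ℝ → ℝ≥0∞ := glue B fun i _ => b i with hK
  have hKm : Measurable K := measurable_glue hB fun i => measurable_const
  have hKd : ∀ c, 0 ≤ c → ∫⁻ u, (K u - ENNReal.ofReal c) ∂m ≤ exc g (n * c) := fun c hc => by
    rw [hK, lintegral_glue_sub hB hBd, ← hFsum _ (by positivity)]
    refine ENNReal.tsum_le_tsum fun i => ?_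
    rw [setLIntegral_const, hnc]
    exact hbd i _
  have hKi : ∫⁻ u, K u ∂m ≠ ∞ := by
    have := hKd 0 le_rfl
    simp only [ENNReal.ofReal_zero, tsub_zero, mul_zero] at this
    exact (this.trans_lt hgfin.lt_top).ne
  have hblock : ∀ᵐ u ∂m, ∀ i, u ∈ B i → (∀ k, Z i k u ≠ ∞ ∧ ∃ t, Z i k u = F i t) ∧
      (∃ k, ∑ k, Z i k u ≤ Z i k u + n * ENNReal.ofReal (v i)) ∧
        n * ENNReal.ofReal (v i) ≤ n * b i + ∑ k, Z i k u :=
    ae_all_iff.2 fun i => (ae_restrict_iff' (hB i)).1 (hZae i)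
  have hyv' : ∀ᵐ u ∂m, ∀ i, u ∈ B i → y u = v i :=
    ae_all_iff.2 fun i => (ae_restrict_iff' (hB i)).1 (hyv i)
  have hzc : ∀ k, (ofENNReal (G k) (hGm k) : ℝ → ℝ) =ᵐ[m] fun u => (G k u).toReal :=
    fun k => coe_ofENNReal
  have hxi := mem_L1_iff.1 hx1
  refine ⟨fun k => ofENNReal (G k) (hGm k), ![ofENNReal H hHm, ofENNReal K hKm], fun k => ?_,
    fun j => ?_, ?_⟩
  · have hexc : ∀ c, 0 ≤ c → exc (ofENNReal (G k) (hGm k)) c = exc g c := fun c hc => by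
      rw [exc_ofENNReal (hGi k) hc, hGd k c hc]
    have hzi := mem_L1_iff.1 (ofENNReal_mem_L1 (hG := hGm k) (hGi k))
    refine mem_extremePoints_OmegaPlus hx hx1 ((mem_OmegaPlus_iff hx hx1).2
      ⟨ofENNReal_nonneg, ofENNReal_mem_L1 (hGi k), fun c hc => ?_⟩) hq (fun c hc => ?_) ?_
    · rw [hexc c hc]; exact hgle c hc
    · refine excR_eq_of_exc_eq hzi hxi (hq.trans hc) ?_
      rw [hexc c (hq.trans hc), hgx c hc]
    · filter_upwards [hzc k, hblock] with u h1 h2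
      rw [h1]
      by_cases hu : u ∈ ⋃ i, B i
      · obtain ⟨i, hi⟩ := mem_iUnion.1 hu
        have h3 : G k u = Z i k u := glue_of_mem hBd hi
        obtain ⟨h4, t, h5⟩ := (h2 i hi).1 k
        rw [h3]
        refine ((hFq i t).imp (fun h => ?_) fun h => ?_)
        · rw [h5, h, ENNReal.toReal_zero]
        · rw [← h5] at h
          have := ENNReal.toReal_mono h4 h
          rwa [ENNReal.toReal_ofReal hq] at this
      · left
        have h3 : G k u = 0 := glue_of_notMem hu
        rw [h3, ENNReal.toReal_zero]
  · have key : ∀ {D : ℝ → ℝ≥0∞} (hD : Measurable D), ∫⁻ u, D u ∂m ≠ ∞ →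
        (∀ u ∉ ⋃ i, B i, D u = 0) →
        (∀ c, 0 ≤ c → ∫⁻ u, (D u - ENNReal.ofReal c) ∂m ≤ exc g (n * c)) →
        0 ≤ ofENNReal D hD ∧ ofENNReal D hD ∈ L1 ∧
        (∀ᵐ u ∂m, u ∉ ⋃ i, B i → ofENNReal D hD u = 0) ∧
        ∀ c, 0 ≤ c → exc (ofENNReal D hD) c ≤ exc x (n * c) := by
      intro D hD hDi hDB hDd
      refine ⟨ofENNReal_nonneg, ofENNReal_mem_L1 hDi, ?_, fun c hc => ?_⟩
      · filter_upwards [coe_ofENNReal (hG := hD)] with u hu hu'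
        rw [hu, hDB u hu', ENNReal.toReal_zero]
      · rw [exc_ofENNReal hDi hc]
        exact (hDd c hc).trans (hgle _ (by positivity))
    fin_cases j
    · refine key hHm hHi (fun u hu => ?_) hHd
      have h3 : ∀ k, G k u = 0 := fun k => glue_of_notMem hu
      simp [hH, h3]
    · exact key hKm hKi (fun u hu => glue_of_notMem hu) hKd
  · filter_upwards [ae_all_iff.2 hzc, coe_ofENNReal (hG := hHm), coe_ofENNReal (hG := hKm), hblock,
      hyv', hyB, ae_lt_top hHm hHi] with u h1 h2 h3 h4 h5 h6 h7
    simp only [Matrix.cons_val_zero, Matrix.cons_val_one]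
    rw [h2, h3]
    simp_rw [h1]
    by_cases hu : u ∈ ⋃ i, B i
    · obtain ⟨i, hi⟩ := mem_iUnion.1 hu
      have hGZ : ∀ k, G k u = Z i k u := fun k => glue_of_mem hBd hi
      have hKb : K u = b i := glue_of_mem hBd hi
      obtain ⟨h8, ⟨k, h9⟩, h10⟩ := h4 i hi
      rw [h5 i hi, hKb]
      simp_rw [hGZ]
      have hfin : ∀ k, Z i k u ≠ ∞ := fun k => (h8 k).1
      have hsumt : (∑ k, Z i k u).toReal = ∑ k, (Z i k u).toReal :=
        ENNReal.toReal_sum fun k _ => hfin k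
      have hsumf : ∑ k, Z i k u ≠ ∞ := ENNReal.sum_ne_top.2 fun k _ => hfin k
      have hnv : (n * ENNReal.ofReal (v i)).toReal = n * v i := by
        rw [ENNReal.toReal_mul, ENNReal.toReal_natCast, ENNReal.toReal_ofReal (hv i)]
      have hnvf : n * ENNReal.ofReal (v i) ≠ ∞ := ENNReal.mul_ne_top hnt ENNReal.ofReal_ne_top
      have e1 := ENNReal.toReal_mono (ENNReal.add_ne_top.2 ⟨hfin k, hnvf⟩) h9
      rw [ENNReal.toReal_add (hfin k) hnvf, hsumt, hnv] at e1
      have e2 := ENNReal.toReal_mono (ENNReal.add_ne_top.2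
        ⟨ENNReal.mul_ne_top hnt (hb i), hsumf⟩) h10
      rw [ENNReal.toReal_add (ENNReal.mul_ne_top hnt (hb i)) hsumf, hsumt, hnv, ENNReal.toReal_mul,
        ENNReal.toReal_natCast] at e2
      have e3 : (Z i k u).toReal ≤ n * (H u).toReal := by
        have h11 : Z i k u / n ≤ H u := by
          rw [← hGZ k]
          exact le_iSup (fun k => G k u / n) k
        have h12 := ENNReal.toReal_mono h7.ne h11
        rw [ENNReal.toReal_div, ENNReal.toReal_natCast, div_le_iff₀ hn'] at h12
        linarith
      rw [← Finset.mul_sum]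
      have hinv : (n : ℝ)⁻¹ * ∑ k, (Z i k u).toReal - v i =
          (∑ k, (Z i k u).toReal - n * v i) / n := by field_simp
      rw [hinv, abs_le, le_div_iff₀ hn', div_le_iff₀ hn']
      have e4 : 0 ≤ n * (H u).toReal := by positivity
      have e5 : 0 ≤ n * (b i).toReal := by positivity
      constructor <;> nlinarith
    · have hGZ : ∀ k, G k u = 0 := fun k => glue_of_notMem hu
      rw [h6 hu]
      simp_rw [hGZ]
      simp only [ENNReal.toReal_zero, mul_zero, Finset.sum_const_zero, sub_zero, abs_zero]
      positivity

/-! ### Sufficiency of the condition on `φ_fin` -/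

/-- Concavity of a ↦ ∫₀ᵃ x*: substitute v = Lu and use that x*(Lu) ≤ x*(u). -/
theorem setLIntegral_rearr_mul_le (x : L0) {L : ℝ} (hL : 1 ≤ L) (a : ℝ) :
    ∫⁻ v in Ioc 0 (L * a), rearr x v ≤ ENNReal.ofReal L * ∫⁻ v in Ioc 0 a, rearr x v := by
  have hL0 : 0 < L := by linarith
  have h := setLIntegral_comp_div (measurable_rearr x) (inv_pos.2 hL0) a
  rw [div_inv_eq_mul, mul_comm a] at h
  have h1 : ENNReal.ofReal L * ENNReal.ofReal L⁻¹ = 1 := by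
    rw [← ENNReal.ofReal_mul hL0.le, mul_inv_cancel₀ hL0.ne', ENNReal.ofReal_one]
  calc ∫⁻ v in Ioc 0 (L * a), rearr x v
      = ENNReal.ofReal L * ∫⁻ u in Ioc 0 a, rearr x (u / L⁻¹) := by
        rw [h, ← mul_assoc, h1, one_mul]
    _ ≤ _ := by
        gcongr ENNReal.ofReal L * ?_
        refine setLIntegral_mono' measurableSet_Ioc fun u hu => rearr_antitone x ?_
        rw [div_inv_eq_mul]
        nlinarith [hu.1]

section Sufficiency

variable {E : Type*} [NormedAddCommGroup E] [NormedSpace ℝ E] {ι : E →ₗ[ℝ] L0}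

/-- The condition on `exc` says that e is submajorized by x*(u/n)/n. Since e lives on a set of
measure at most L, only the part of that function on (0, L] counts, and concavity replaces L by 1 at
the cost of a factor L. -/
theorem exists_norm_le_dilatedHead (hE : IsFullySymmetric ι) (hL1 : ∀ z : E, ι z ∈ L1) {x : E}
    (hx : 0 ≤ ι x) {n : ℝ} (hn : 0 < n) {w : E} (hw : ι w = dilatedHead n (ι x)) {W : Set ℝ}
    (hWm : MeasurableSet W) {L : ℝ} (hL : 1 ≤ L) (hW : m W ≤ ENNReal.ofReal L) {e : L0}
    (he : 0 ≤ e) (he1 : e ∈ L1) (heW : ∀ᵐ u ∂m, u ∉ W → e u = 0)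
    (h : ∀ c, 0 ≤ c → exc e c ≤ exc (ι x) (n * c)) :
    ∃ z : E, ι z = e ∧ ‖z‖ ≤ L / n * ‖w‖ := by
  have hL0 : 0 < L := by linarith
  have hLn : 0 < L / n := by positivity
  have hsub : Submajorized e (ι ((L / n) • w)) := by
    intro t ht
    rcases ht.eq_or_lt with rfl | ht
    · simp
    set τ := min t L with hτ
    have hτ0 : 0 < τ := lt_min ht hL0
    -- r is the optimal level in the duality for x at τ/n; the matching level for e is r/n.
    set r := rearrReal (ι x) (τ / n) with hr
    have hr0 : 0 ≤ r := ENNReal.toReal_nonneg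
    have hc0 : 0 ≤ r / n := by positivity
    have h1 : ∫⁻ s in Ioc 0 t, rearr e s ≤
        ENNReal.ofReal (r / n) * ENNReal.ofReal τ + exc e (r / n) := by
      rcases le_total t L with htL | htL
      · rw [hτ, min_eq_left htL]
        exact setLIntegral_rearr_le_exc he t hc0
      · have h2 := setLIntegral_rearr_le_exc he t le_rfl
        rw [ENNReal.ofReal_zero, zero_mul, zero_add] at h2
        refine h2.trans ?_
        have h3 : exc e 0 = ∫⁻ u in W, ENNReal.ofReal (e u) ∂m := by
          rw [exc, ← lintegral_indicator hWm]
          refine lintegral_congr_ae (heW.mono fun u hu => ?_)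
          by_cases huW : u ∈ W
          · simp [huW]
          · simp [huW, hu huW]
        rw [h3]
        refine (setLIntegral_le_exc e W (r / n)).trans ?_
        rw [hτ, min_eq_right htL]
        gcongr
    have h2 : ENNReal.ofReal (r / n) * ENNReal.ofReal τ + exc e (r / n) ≤
        ∫⁻ s in Ioc 0 (τ / n), rearr (ι x) s := by
      refine le_trans ?_ (le_setLIntegral_rearr_exc hx (hL1 x) (div_pos hτ0 hn))
      refine add_le_add (le_of_eq ?_) ?_
      · rw [← ENNReal.ofReal_mul hc0, ← ENNReal.ofReal_mul hr0]
        congr 1; ring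
      · refine (h _ hc0).trans (le_of_eq ?_)
        rw [mul_div_cancel₀ _ hn.ne']
    have h3 : ∫⁻ s in Ioc 0 (τ / n), rearr (ι x) s ≤
        ∫⁻ s in Ioc 0 (L * (min t 1 / n)), rearr (ι x) s := by
      refine lintegral_mono_set (Ioc_subset_Ioc_right ?_)
      rw [← mul_div_assoc]
      refine div_le_div_of_nonneg_right ?_ hn.le
      rw [mul_min_of_nonneg _ _ hL0.le, mul_one]
      exact min_le_min_right _ (by nlinarith)
    refine (h1.trans (h2.trans (h3.trans (setLIntegral_rearr_mul_le _ hL _)))).trans ?_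
    rw [map_smul, setLIntegral_rearr_smul hLn, hw]
    calc ENNReal.ofReal L * ∫⁻ v in Ioc 0 (min t 1 / n), rearr (ι x) v
        = ENNReal.ofReal (L / n) *
          (ENNReal.ofReal n * ∫⁻ v in Ioc 0 (min t 1 / n), rearr (ι x) v) := by
          rw [← mul_assoc, ← ENNReal.ofReal_mul hLn.le, div_mul_cancel₀ _ hn.ne']
      _ ≤ _ := by
          gcongr
          exact le_setLIntegral_rearr_dilatedHead (hL1 x) hn t
  obtain ⟨z, hz, hzn⟩ := hE.fully _ e (mem_L1Linfty_of_mem_L1 he1) hsub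
  refine ⟨z, hz, hzn.trans_eq ?_⟩
  rw [norm_smul, Real.norm_of_nonneg hLn.le]

theorem PhiFinEq.exists_norm_le {x : L0} (h : PhiFinEq ι x 0) {L ε : ℝ} (hL : 0 < L)
    (hε : 0 < ε) : ∃ (n : ℕ) (w : E), 0 < n ∧ ι w = dilatedHead n x ∧ L / n * ‖w‖ ≤ ε := by
  have h1 : 0 < ENNReal.ofReal (ε / L) := by
    rw [ENNReal.ofReal_pos]; positivity
  have h2 := (h.comp tendsto_natCast_atTop_atTop).eventually_lt_const h1
  obtain ⟨n, hn, hn0⟩ := (h2.and (eventually_gt_atTop 0)).exists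
  have hn' : (0 : ℝ) < n := Nat.cast_pos.2 hn0
  have hn1 : 0 < 1 / (n : ℝ) := by positivity
  simp only [Function.comp_apply] at hn
  rw [mul_comm, ← ENNReal.lt_div_iff_mul_lt (Or.inl (by simpa using hn0.ne'))
    (Or.inl ENNReal.ofReal_ne_top), ← ENNReal.ofReal_div_of_pos hn1, fnNorm, iInf_lt_iff] at hn
  obtain ⟨w, hw⟩ := hn
  rw [iInf_lt_iff] at hw
  obtain ⟨hw, hwn⟩ := hw
  refine ⟨n, w, hn0, hw, ?_⟩
  rw [← ofReal_norm, ENNReal.ofReal_lt_ofReal_iff (by positivity)] at hwn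
  calc L / n * ‖w‖ ≤ L / n * (ε / L / (1 / n)) := by gcongr
    _ = ε := by field_simp

theorem norm_le_of_abs_le (hE : IsFullySymmetric ι) {v w : E}
    (h : ∀ᵐ u ∂m, |ι v u| ≤ ι w u) : ‖v‖ ≤ ‖w‖ := by
  obtain ⟨z, hz, hzn⟩ := hE.solid w (ι v) (AEEqFun.coeFn_le.1 (by
    filter_upwards [AEEqFun.coeFn_abs (ι v), AEEqFun.coeFn_abs (ι w), h] with u h1 h2 h3
    rw [h1, h2]
    exact h3.trans (le_abs_self _)))
  rwa [hE.injective hz] at hzn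

/-! ### Reduction to step functions and conclusion of the sufficiency -/

theorem tendsto_setLIntegral_lt {g : ℝ → ℝ} (hg : Measurable g) (hg0 : ∀ u, 0 ≤ g u)
    (hgi : ∫⁻ u, ENNReal.ofReal (g u) ∂m ≠ ∞) :
    Tendsto (fun k : ℕ => ∫⁻ u, {u | g u < 1 / ((k : ℝ) + 1)}.indicator
      (fun u => ENNReal.ofReal (g u)) u ∂m) atTop (𝓝 0) := by
  have h := tendsto_lintegral_of_dominated_convergence (μ := m)
    (F := fun (k : ℕ) u => {u | g u < 1 / ((k : ℝ) + 1)}.indicator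
      (fun u => ENNReal.ofReal (g u)) u) (f := fun _ => 0) (fun u => ENNReal.ofReal (g u))
    (fun k => hg.ennreal_ofReal.indicator (measurableSet_lt hg measurable_const))
    (fun k => ae_of_all _ fun u => indicator_le_self _ _ u) hgi (ae_of_all _ fun u => ?_)
  · simpa using h
  · refine tendsto_const_nhds.congr' ?_
    rcases (hg0 u).eq_or_lt with h0 | h0
    · refine Eventually.of_forall fun k => ?_
      by_cases hu : u ∈ {u | g u < 1 / ((k : ℝ) + 1)}
      · simp only [indicator_of_mem hu, ← h0, ENNReal.ofReal_zero]
      · simp only [indicator_of_notMem hu]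
    · filter_upwards [(tendsto_one_div_add_atTop_nhds_zero_nat (𝕜 := ℝ)).eventually_lt_const h0]
        with k hk
      refine (indicator_of_notMem (fun hu => ?_) _).symm
      have : g u < 1 / ((k : ℝ) + 1) := hu
      exact this.not_gt hk

/-- Round y down to a geometric grid η(1 + κ)^i, and to 0 below η. The rounding error is at most κy
plus the part of y below η, which is bounded by η and has small integral, hence small norm in E.
Rounding down stays in the orbit. -/
theorem exists_step_approx (hE : IsFullySymmetric ι) (hL1 : ∀ z : E, ι z ∈ L1) {x : E}
    (hx : 0 ≤ ι x) (hx0 : x ≠ 0) {y : L0} (hy : y ∈ OmegaPlus (ι x)) {ε : ℝ} (hε : 0 < ε) :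
    ∃ (e e' : E) (B : ℕ → Set ℝ) (v : ℕ → ℝ), ι e = y ∧ ι e' ∈ OmegaPlus (ι x) ∧
      ‖e - e'‖ ≤ ε ∧ (∀ i, MeasurableSet (B i)) ∧ Pairwise (Function.onFun Disjoint B) ∧
      m (⋃ i, B i) ≠ ∞ ∧ (∀ i, 0 ≤ v i) ∧ (∀ i, ∀ᵐ u ∂m.restrict (B i), ι e' u = v i) ∧
      ∀ᵐ u ∂m, u ∉ ⋃ i, B i → ι e' u = 0 := by
  have hyΩ := (mem_OmegaPlus_iff hx (hL1 x)).1 hy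
  obtain ⟨e, he, hen⟩ := exists_norm_le_of_exc_le hE hx hyΩ.1 hyΩ.2.1 hyΩ.2.2
  obtain ⟨g, hg, hg0, hyg⟩ := exists_measurable_nonneg_rep hyΩ.1
  have hgi : Integrable g m := (mem_L1_iff.1 hyΩ.2.1).congr hyg
  have hgl : ∫⁻ u, ENNReal.ofReal (g u) ∂m ≠ ∞ := by
    rw [← ofReal_integral_eq_lintegral_ofReal hgi (ae_of_all _ hg0)]
    exact ENNReal.ofReal_ne_top
  obtain ⟨a, b, ha, hb, hab⟩ := exists_of_bounded hE hL1 hx hx0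
  have hxn : 0 < ‖x‖ := norm_pos_iff.2 hx0
  -- Each of the two errors then has norm at most κ‖x‖ = ε/2.
  set κ := ε / (2 * ‖x‖) with hκ
  have hκ0 : 0 < κ := by positivity
  obtain ⟨k, hk1, hk2⟩ := (((tendsto_one_div_add_atTop_nhds_zero_nat (𝕜 := ℝ)).eventually_lt_const
    (show 0 < κ * a by positivity)).and ((tendsto_setLIntegral_lt hg hg0 hgl).eventually_lt_const
      (show 0 < ENNReal.ofReal (κ * b) from ENNReal.ofReal_pos.2 (by positivity)))).exists
  set η := 1 / ((k : ℝ) + 1) with hη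
  have hη0 : 0 < η := by positivity
  set B : ℕ → Set ℝ := fun i => {u | η * (1 + κ) ^ i ≤ g u ∧ g u < η * (1 + κ) ^ (i + 1)} with hBdef
  have hB : ∀ i, MeasurableSet (B i) := fun i =>
    (measurableSet_le measurable_const hg).inter (measurableSet_lt hg measurable_const)
  have hpow : ∀ i j : ℕ, i ≤ j → η * (1 + κ) ^ i ≤ η * (1 + κ) ^ j := fun i j hij => by
    gcongr
    linarith
  have hBd : Pairwise (Function.onFun Disjoint B) := by
    have key : ∀ i j : ℕ, i < j → Disjoint (B i) (B j) := fun i j hij =>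
      Set.disjoint_left.2 fun u hu hu' => by
        have := hpow (i + 1) j hij
        linarith [hu.2, hu'.1]
    intro i j hij
    rcases lt_or_gt_of_ne hij with h | h
    · exact key i j h
    · exact (key j i h).symm
  have hU : ⋃ i, B i = {u | η ≤ g u} := by
    ext u
    simp only [mem_iUnion, mem_ofPred_eq]
    constructor
    · rintro ⟨i, hi, -⟩
      have := hpow 0 i (Nat.zero_le i)
      rw [pow_zero, mul_one] at this
      exact this.trans hi
    · intro hu
      obtain ⟨i, h1, h2⟩ := exists_nat_pow_near ((one_le_div hη0).2 hu)
        (show 1 < 1 + κ by linarith)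
      rw [le_div_iff₀ hη0, mul_comm] at h1
      rw [div_lt_iff₀ hη0, mul_comm] at h2
      exact ⟨i, h1, h2⟩
  set v : ℕ → ℝ := fun i => η * (1 + κ) ^ i with hv
  have hv0 : ∀ i, 0 ≤ v i := fun i => by positivity
  set G : ℝ → ℝ≥0∞ := glue B fun i _ => ENNReal.ofReal (v i) with hG
  have hGm : Measurable G := measurable_glue hB fun i => measurable_const
  have hGB : ∀ i, ∀ u ∈ B i, (G u).toReal = v i := fun i u hu => by
    have : G u = ENNReal.ofReal (v i) := glue_of_mem hBd hu
    rw [this, ENNReal.toReal_ofReal (hv0 i)]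
  have hG0 : ∀ u ∉ ⋃ i, B i, (G u).toReal = 0 := fun u hu => by
    have : G u = 0 := glue_of_notMem hu
    rw [this, ENNReal.toReal_zero]
  have hcases : ∀ u, (G u).toReal ≤ g u ∧
      g u - (G u).toReal ≤ κ * g u + {u | g u < η}.indicator g u := by
    intro u
    by_cases hu : u ∈ ⋃ i, B i
    · obtain ⟨i, hi⟩ := mem_iUnion.1 hu
      rw [hGB i u hi]
      have h1 : v i ≤ g u := hi.1
      have h2 : g u < v i * (1 + κ) := by
        have := hi.2
        rwa [pow_succ, ← mul_assoc] at this
      have h3 : 0 ≤ {u | g u < η}.indicator g u := indicator_nonneg (fun u _ => hg0 u) u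
      refine ⟨h1, ?_⟩
      nlinarith
    · rw [hG0 u hu]
      have hu' : u ∈ {u | g u < η} := by
        rw [hU, mem_ofPred_eq] at hu
        exact not_le.1 hu
      rw [indicator_of_mem hu', sub_zero]
      refine ⟨hg0 u, le_add_of_nonneg_left (mul_nonneg hκ0.le (hg0 u))⟩
  have hy2c := coe_ofENNReal (hG := hGm)
  have hy2le : (ofENNReal G hGm : ℝ → ℝ) ≤ᵐ[m] y := by
    filter_upwards [hy2c, hyg] with u h1 h2
    rw [h1, h2]; exact (hcases u).1
  have hy2i : Integrable (ofENNReal G hGm) m := by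
    refine hgi.mono' (AEEqFun.aestronglyMeasurable _) ?_
    filter_upwards [hy2c] with u h1
    rw [h1, Real.norm_of_nonneg ENNReal.toReal_nonneg]
    exact (hcases u).1
  have hy2Ω : ofENNReal G hGm ∈ OmegaPlus (ι x) := (mem_OmegaPlus_iff hx (hL1 x)).2
    ⟨ofENNReal_nonneg, mem_L1_iff.2 hy2i, fun c hc => (exc_mono hy2le c).trans (hyΩ.2.2 c hc)⟩
  obtain ⟨e', he', -⟩ := exists_norm_le_of_exc_le hE hx ofENNReal_nonneg (mem_L1_iff.2 hy2i)
    fun c hc => (exc_mono hy2le c).trans (hyΩ.2.2 c hc)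
  have htm : Measurable ({u | g u < η}.indicator g) :=
    hg.indicator (measurableSet_lt hg measurable_const)
  set t : L0 := AEEqFun.mk ({u | g u < η}.indicator g) htm.aestronglyMeasurable with ht
  have htc : (t : ℝ → ℝ) =ᵐ[m] {u | g u < η}.indicator g := AEEqFun.coeFn_mk _ _
  have ht0 : 0 ≤ t := nonneg_of_coe (htc.mono fun u hu => by
    rw [hu]; exact indicator_nonneg (fun u _ => hg0 u) u)
  have ht1 : ∀ᵐ u ∂m, t u ≤ κ * a := htc.mono fun u hu => by
    rw [hu]
    by_cases h : u ∈ {u | g u < η}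
    · rw [indicator_of_mem h]
      exact (le_of_lt h).trans hk1.le
    · rw [indicator_of_notMem h]; positivity
  have ht2 : exc t 0 ≤ ENNReal.ofReal (κ * b) := by
    refine le_trans (le_of_eq ?_) hk2.le
    refine lintegral_congr_ae (htc.mono fun u hu => ?_)
    simp only [hu, sub_zero]
    by_cases h : u ∈ {u | g u < η}
    · rw [indicator_of_mem h, indicator_of_mem h]
    · rw [indicator_of_notMem h, indicator_of_notMem h, ENNReal.ofReal_zero]
  obtain ⟨w, hw, hwn⟩ := hab κ hκ0.le t ht0 ht1 ht2
  refine ⟨e, e', B, v, he, by rw [he']; exact hy2Ω, ?_, hB, hBd, ?_, hv0, fun i => ?_, ?_⟩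
  · have h1 : ‖e - e'‖ ≤ ‖κ • e + w‖ := by
      refine norm_le_of_abs_le hE ?_
      rw [map_sub, map_add, map_smul, he, he', hw]
      filter_upwards [AEEqFun.coeFn_sub y (ofENNReal G hGm), AEEqFun.coeFn_add (κ • y) t,
        AEEqFun.coeFn_smul κ y, htc, hyg, hy2c] with u h1 h2 h3 h4 h5 h6
      rw [h1, h2, Pi.sub_apply, Pi.add_apply, h3, Pi.smul_apply, smul_eq_mul, h4, h5, h6,
        abs_of_nonneg (sub_nonneg.2 (hcases u).1)]
      exact (hcases u).2
    calc ‖e - e'‖ ≤ ‖κ • e + w‖ := h1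
      _ ≤ κ * ‖e‖ + ‖w‖ := by
          refine (norm_add_le _ _).trans ?_
          rw [norm_smul, Real.norm_of_nonneg hκ0.le]
      _ ≤ κ * ‖x‖ + κ * ‖x‖ := by gcongr
      _ = ε := by rw [hκ]; field_simp; ring
  · rw [hU]; exact meas_le_ne_top hgi hη0
  · rw [he']
    filter_upwards [ae_restrict_of_ae hy2c, ae_restrict_mem (hB i)] with u h1 h2
    rw [h1, hGB i u h2]
  · rw [he']
    filter_upwards [hy2c] with u h1 h2
    rw [h1, hG0 u h2]

/-- φ_fin(x) = 0 supplies n for which the head dilated by n has norm small compared with n/L. Both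
error functions of the n-fold average then have norm at most ε/2. -/
theorem exists_average_near (hE : IsFullySymmetric ι) (hL1 : ∀ z : E, ι z ∈ L1) {x : E}
    (hx : 0 ≤ ι x) (hφ : PhiFinEq ι (ι x) 0) {y : E} (hy : ι y ∈ OmegaPlus (ι x)) {B : ℕ → Set ℝ}
    (hB : ∀ i, MeasurableSet (B i)) (hBd : Pairwise (Function.onFun Disjoint B))
    (hBf : m (⋃ i, B i) ≠ ∞) {v : ℕ → ℝ} (hv : ∀ i, 0 ≤ v i)
    (hyv : ∀ i, ∀ᵐ u ∂m.restrict (B i), ι y u = v i)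
    (hyB : ∀ᵐ u ∂m, u ∉ ⋃ i, B i → ι y u = 0) {ε : ℝ} (hε : 0 < ε) :
    ∃ w ∈ ι ⁻¹' convexHull ℝ (extremePoints ℝ (OmegaPlus (ι x))), ‖w - y‖ ≤ ε := by
  have hyΩ := (mem_OmegaPlus_iff hx (hL1 x)).1 hy
  by_cases hy0 : exc (ι y) 0 = 0
  · refine ⟨0, ?_, ?_⟩
    · rw [mem_preimage, map_zero]
      exact subset_convexHull _ _ (zero_mem_extremePoints_OmegaPlus hx (hL1 x))
    · have h0 : y = 0 := by
        refine hE.injective ?_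
        rw [map_zero]
        have h1 := (lintegral_eq_zero_iff
          ((AEEqFun.measurable (ι y)).sub_const 0).ennreal_ofReal).1 hy0
        refine AEEqFun.ext ?_
        filter_upwards [h1, coe_nonneg hyΩ.1, AEEqFun.coeFn_zero (α := ℝ) (β := ℝ) (μ := m)]
          with u h2 h3 h4
        rw [h4]
        have := ENNReal.ofReal_eq_zero.1 h2
        exact le_antisymm (by simpa using this) h3
      rw [h0, sub_zero, norm_zero]
      exact hε.le
  set L := max (m.real (⋃ i, B i)) 1 with hL
  have hL1' : 1 ≤ L := le_max_right _ _
  have hWL : m (⋃ i, B i) ≤ ENNReal.ofReal L := by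
    rw [← ENNReal.ofReal_toReal hBf]
    exact ENNReal.ofReal_le_ofReal (le_max_left _ _)
  obtain ⟨n, w, hn, hw, hwn⟩ := hφ.exists_norm_le (show 0 < L by linarith) (half_pos hε)
  have hn' : (0 : ℝ) < n := Nat.cast_pos.2 hn
  obtain ⟨z, e, hz, he, hze⟩ := exists_extremePoints_average hx (hL1 x) hyΩ.1 hyΩ.2.1 hyΩ.2.2 hy0
    hB hBd (fun i => measure_ne_top_of_subset (subset_iUnion B i) hBf) hv hyv hyB hn
  have hw' : ∀ j, ∃ w' : E, ι w' = e j ∧ ‖w'‖ ≤ ε / 2 := fun j => by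
    obtain ⟨h0, h1, h2, h3⟩ := he j
    obtain ⟨w', hw', hwn'⟩ := exists_norm_le_dilatedHead hE hL1 hx hn' hw (MeasurableSet.iUnion hB)
      hL1' hWL h0 h1 h2 h3
    exact ⟨w', hw', hwn'.trans hwn⟩
  choose w' hw' hwn' using hw'
  have hζ : ∀ k, ∃ ζ : E, ι ζ = z k := fun k => by
    obtain ⟨h0, h1, h2⟩ := (mem_OmegaPlus_iff hx (hL1 x)).1 (hz k).1
    obtain ⟨ζ, hζ, -⟩ := exists_norm_le_of_exc_le hE hx h0 h1 h2
    exact ⟨ζ, hζ⟩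
  choose ζ hζ using hζ
  have hιs : ι (∑ k, (n : ℝ)⁻¹ • ζ k) = ∑ k, (n : ℝ)⁻¹ • z k := by
    simp only [map_sum, map_smul, hζ]
  refine ⟨∑ k, (n : ℝ)⁻¹ • ζ k, ?_, ?_⟩
  · rw [mem_preimage, hιs]
    refine (convex_convexHull ℝ _).sum_mem (fun k _ => by positivity) ?_
      fun k _ => subset_convexHull _ _ (hz k)
    simp [hn'.ne']
  · have h1 : ‖∑ k, (n : ℝ)⁻¹ • ζ k - y‖ ≤ ‖w' 0 + w' 1‖ := by
      refine norm_le_of_abs_le hE ?_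
      rw [map_sub, hιs, map_add, hw', hw']
      filter_upwards [AEEqFun.coeFn_sub (∑ k, (n : ℝ)⁻¹ • z k) (ι y),
        AEEqFun.coeFn_add (e 0) (e 1), coeFn_sum Finset.univ fun k => (n : ℝ)⁻¹ • z k,
        ae_all_iff.2 fun k => AEEqFun.coeFn_smul (n : ℝ)⁻¹ (z k), hze] with u h1 h2 h3 h4 h5
      rw [h1, h2, Pi.sub_apply, Pi.add_apply, h3]
      simp only [h4, Pi.smul_apply, smul_eq_mul]
      exact h5
    refine h1.trans ((norm_add_le _ _).trans ?_)
    linarith [hwn' 0, hwn' 1]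

theorem OmegaPlus_subset_QPlus (hE : IsFullySymmetric ι) (hL1 : ∀ z : E, ι z ∈ L1) {x : E}
    (hx : 0 ≤ ι x) (hφ : PhiFinEq ι (ι x) 0) : OmegaPlus (ι x) ⊆ QPlus ι (ι x) := by
  intro y hy
  have hyΩ := (mem_OmegaPlus_iff hx (hL1 x)).1 hy
  obtain ⟨e, he, hen⟩ := exists_norm_le_of_exc_le hE hx hyΩ.1 hyΩ.2.1 hyΩ.2.2
  refine ⟨e, Metric.mem_closure_iff.2 fun ε hε => ?_, he⟩
  rcases eq_or_ne x 0 with rfl | hx0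
  · refine ⟨0, ?_, ?_⟩
    · rw [mem_preimage, map_zero]
      refine subset_convexHull _ _ (zero_mem_extremePoints_OmegaPlus le_rfl ?_)
      exact (map_zero ι) ▸ hL1 0
    · rw [dist_zero_right]
      exact (hen.trans_eq norm_zero).trans_lt hε
  obtain ⟨e₁, e', B, v, he₁, he'Ω, hee', hB, hBd, hBf, hv, hev, heB⟩ :=
    exists_step_approx hE hL1 hx hx0 hy (ε := ε / 3) (by positivity)
  have hee : e₁ = e := hE.injective (he₁.trans he.symm)
  obtain ⟨w, hw, hwn⟩ := exists_average_near hE hL1 hx hφ he'Ω hB hBd hBf hv hev heB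
    (ε := ε / 3) (by positivity)
  refine ⟨w, hw, ?_⟩
  rw [dist_eq_norm]
  calc ‖e - w‖ = ‖(e₁ - e') - (w - e')‖ := by rw [hee]; congr 1; abel
    _ ≤ ‖e₁ - e'‖ + ‖w - e'‖ := norm_sub_le _ _
    _ < ε := by linarith

end Sufficiency

end

end Orbits

theorem mainTheorem6 {E : Type*} [NormedAddCommGroup E] [NormedSpace ℝ E] [CompleteSpace E]
    (ι : E →ₗ[ℝ] Orbits.L0) (hE : Orbits.IsFullySymmetric ι)
    (hL1 : ∀ z : E, ι z ∈ Orbits.L1)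
    (x : E) (hx : 0 ≤ ι x) :
    (Orbits.PhiFinEq ι (ι x) 0 → Orbits.OmegaPlus (ι x) = Orbits.QPlus ι (ι x)) ∧
    (Orbits.HasFatouNorm ι → Orbits.OmegaPlus (ι x) = Orbits.QPlus ι (ι x) →
      Orbits.PhiFinEq ι (ι x) 0) :=
  ⟨fun h => (Orbits.OmegaPlus_subset_QPlus hE hL1 hx h).antisymm
    (Orbits.QPlus_subset_OmegaPlus hE hL1 hx),
    fun _ h => Orbits.phiFinEq_zero_of_subset_QPlus hE hL1 hx h.subset⟩
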